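/- **Setting.** Let $k$ be a nonzero commutative ring in which $2$ is invertible. A *disoriented* 1- or 2-manifold is a compact, piecewise oriented manifold together with a preferred normal direction (drawn as a fringe) on each component of the interface between differently oriented pieces; these interface components are called *disorientation marks* in dimension 1 and *seams* in dimension 2. For $\omega\in k^\times$, let $\mathcal{D}is\mathcal{A}b$ be the $k$-linear category whose objects are disoriented 1-manifolds with a fixed finite set $B$ of boundary points, with a formal grading shift $q^m$ ($m\in\mathbb Z$), and whose morphisms are $k$-linear combinations of abstract disoriented cobordisms (up to homeomorphism rel boundary, composed by gluing), modulo * the following relations, imposed away from the seams: a sphere is $0$, a torus is $2$, and (neck cutting) a surface containing an annulus equals $\tfrac12$ times the sum of the two surfaces obtained by cutting the annulus along its core, capping off both new boundary circles with discs, and attaching a handle to one or to the other of these discs; * the fringe relations: a circular seam bounding a disc can be removed at the cost of the factor $\omega$ if its fringe points into the disc, and $\omega^{-1}$ if it points out of the disc; two parallel pieces of seam whose fringes point towards each other equal $\omega^{-1}$ times the two pieces of seam obtained by reconnecting them the other way, whose fringes then point away from each other. Let $\mathcal{U}n\mathcal{A}b$ be the category defined in the same way with unoriented (possibly non-orientable)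 manifolds, without marks and seams, and with the sphere, torus and neck cutting relations only. A cobordism $C$ from $q^{m_1}M_1$ to $q^{m_2}M_2$ has degree $\chi(C)-|B|/2+m_2-m_1$. To a positive crossing (with both strands running upwards, the over-strand from the bottom left to the top right) one assigns the two-term cochain complex, in heights $0$ and $1$, $$ q\,M \xrightarrow{\ d\ } q^2\,N ,$$ where $M$ is the oriented smoothing (two vertical strands oriented upwards), $N$ is the disoriented smoothing (a bottom arc and a top arc, oriented compatibly with the four ends of the crossing, each with one disorientation mark pointing to the right), and $d$ is the saddle, a disc with a single seam joining the two marks and with the fringe pointing to the right. In the unoriented theory one uses the same complex with orientations, marks and seams forgotten. Let $F$ and $G$ be the endomorphisms of this complex induced by attaching a handle to the over-sheet to the right, respectively to the left, of the crossing: in each height $F$ is the identity cobordism with a handle attached, next to the top right end point (the end of the over-strand), to the sheet containing that point; and $G$ is the identity cobordism with a handle attached in the same way next to the bottom left end point (the beginning of the over-strand). **Proposition 4.6.** $F$ and $G$ are chain maps in both theories, and: 1. In the disoriented theory, if $\omega^2=-1$, then $F\simeq G$. 2. In the unoriented theory, $F\simeq -G$ and $F\not\simeq G$. The homotopies in (1)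 and (2) can be chosen homogeneous of degree $-2$ (the degree of $F$ and $G$). -/

import Mathlib

open CategoryTheory

/-!
Abstract (dis)oriented cobordisms, presented by cell decompositions.

A cell complex is stored through its flags.  A flag of a 1-dimensional complex is an incident pair
(vertex, edge); a flag of a surface is an incident triple (vertex, edge, face).  The involutions
`v`, `e`, `f` replace the vertex, the edge, the face of a flag and keep its other members (for a
surface, faces are polygons).  Thus faces are the orbits of `v, e`, edges the orbits of `v, f`,
vertices the orbits of `e, f`; the flags fixed by `f` are those on the boundary of the surface.

The letter `O` is the type of local orientations: `O = ℤˣ` gives disoriented manifolds and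
`O = Unit` gives unoriented (possibly non-orientable) ones, for which all conditions below on
orientations and seams are void, apart from the one that forces the seams to be absent.
-/

namespace Disor

section Relations

variable {X : Type}

/-- Two flags have the same vertex. -/
def Around (e f : X → X) : X → X → Prop :=
  Relation.EqvGen fun x y => y = e x ∨ y = f x

/-- Two flags have the same vertex, and one gets from one to the other by moving around this
vertex without crossing a seam. -/
def OneSide (e f : X → X) (s : X → SignType) : X → X → Prop :=
  Relation.EqvGen fun x y => y = e x ∨ (s x = 0 ∧ y = f x)

theorem Around.closed {e f : X → X} (he : ∀ x, e (e x) = x) (hf : ∀ x, f (f x) = x)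
    {P : X → Prop} (h1 : ∀ x, P x → P (e x)) (h2 : ∀ x, P x → P (f x)) {x y : X}
    (h : Around e f x y) : P x ↔ P y := by
  induction h with
  | rel a b h =>
    rcases h with rfl | rfl
    · exact ⟨h1 a, fun h => by simpa [he] using h1 _ h⟩
    · exact ⟨h2 a, fun h => by simpa [hf] using h2 _ h⟩
  | refl => exact Iff.rfl
  | symm _ _ _ ih => exact ih.symm
  | trans _ _ _ _ _ ih1 ih2 => exact ih1.trans ih2

theorem Around.map {Y : Type} {e f : X → X} {e' f' : Y → Y} (j : X → Y)
    (h1 : ∀ x, Around e' f' (j x) (j (e x))) (h2 : ∀ x, Around e' f' (j x) (j (f x)))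
    {x y : X} (h : Around e f x y) : Around e' f' (j x) (j y) := by
  induction h with
  | rel a b h =>
    rcases h with rfl | rfl
    · exact h1 a
    · exact h2 a
  | refl => exact .refl _
  | symm _ _ _ ih => exact .symm _ _ ih
  | trans _ _ _ _ _ ih1 ih2 => exact .trans _ _ _ ih1 ih2

theorem OneSide.map {Y : Type} {e f : X → X} {e' f' : Y → Y} {s : X → SignType}
    {s' : Y → SignType} (j : X → Y)
    (h1 : ∀ x, OneSide e' f' s' (j x) (j (e x)))
    (h2 : ∀ x, s x = 0 → OneSide e' f' s' (j x) (j (f x)))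
    {x y : X} (h : OneSide e f s x y) : OneSide e' f' s' (j x) (j y) := by
  induction h with
  | rel a b h =>
    rcases h with rfl | ⟨h0, rfl⟩
    · exact h1 a
    · exact h2 a h0
  | refl => exact .refl _
  | symm _ _ _ ih => exact .symm _ _ ih
  | trans _ _ _ _ _ ih1 ih2 => exact .trans _ _ _ ih1 ih2

theorem OneSide.around {e f : X → X} {s : X → SignType} {x y : X} (h : OneSide e f s x y) :
    Around e f x y := by
  induction h with
  | rel a b h => exact .rel _ _ (h.imp id And.right)
  | refl => exact .refl _
  | symm _ _ _ ih => exact .symm _ _ ih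
  | trans _ _ _ _ _ ih1 ih2 => exact .trans _ _ _ ih1 ih2

end Relations

/-- A compact 1-manifold with a cell decomposition, with boundary points labelled by `B`, and
with a disorientation: orientations of the edges, and a preferred normal direction at each vertex
(a disorientation mark) where the orientations of the two edges do not match. -/
structure Curve (O : Type) [InvolutiveNeg O] (B : Type) where
  /-- flags, that is, half-edges -/
  X : Type
  finite : Finite X
  /-- the other end of the edge -/
  v : X → X
  /-- the other edge at the vertex, if there is one -/
  e : X → X
  v_v : ∀ x, v (v x) = x
  v_ne : ∀ x, v x ≠ x
  e_e : ∀ x, e (e x) = x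
  /-- the half-edge at a boundary point -/
  pt : B → X
  pt_injective : Function.Injective pt
  e_eq_iff : ∀ x, e x = x ↔ ∃ b, pt b = x
  /-- direction of the edge as seen from the vertex; in the case `O = ℤˣ`, the value `1` means
  that the edge is oriented away from the vertex -/
  o : X → O
  /-- `1` if at the vertex of `x` there is a mark whose normal direction points from the edge of
  `x` to the edge of `e x`, `-1` if there is one that points the other way, `0` if there is none -/
  s : X → SignType
  o_v : ∀ x, o (v x) = -o x
  s_e : ∀ x, s (e x) = -s x
  s_eq_zero_iff : ∀ x, e x ≠ x → (s x = 0 ↔ o (e x) = -o x)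

variable {O : Type} [InvolutiveNeg O] {B : Type}

/-- In the closed 1-manifold made of `M` and `N`, glued along the common boundary points `B`: two
different half-edges with the same vertex. -/
inductive Meets (M N : Curve O B) : M.X ⊕ N.X → M.X ⊕ N.X → Prop
  | src (m : M.X) (h : M.e m ≠ m) : Meets M N (.inl m) (.inl (M.e m))
  | tgt (n : N.X) (h : N.e n ≠ n) : Meets M N (.inr n) (.inr (N.e n))
  | st (b : B) : Meets M N (.inl (M.pt b)) (.inr (N.pt b))
  | ts (b : B) : Meets M N (.inr (N.pt b)) (.inl (M.pt b))

/-- `Meets`, spelled out. -/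
theorem Meets.iff {M N : Curve O B} {u w : M.X ⊕ N.X} : Meets M N u w ↔
    match u, w with
    | .inl m, .inl m' => M.e m ≠ m ∧ M.e m = m'
    | .inr n, .inr n' => N.e n ≠ n ∧ N.e n = n'
    | .inl m, .inr n => ∃ b, M.pt b = m ∧ N.pt b = n
    | .inr n, .inl m => ∃ b, M.pt b = m ∧ N.pt b = n := by
  constructor
  · intro h
    cases h with
    | src m h => exact ⟨h, rfl⟩
    | tgt n h => exact ⟨h, rfl⟩
    | st b => exact ⟨b, rfl, rfl⟩
    | ts b => exact ⟨b, rfl, rfl⟩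
  · rcases u with u | u <;> rcases w with w | w
    · rintro ⟨h, rfl⟩; exact .src u h
    · rintro ⟨b, rfl, rfl⟩; exact .st b
    · rintro ⟨b, rfl, rfl⟩; exact .ts b
    · rintro ⟨h, rfl⟩; exact .tgt u h

/-- A cobordism from `M` to `N`: a compact surface with a cell decomposition and a disorientation
whose boundary is identified with `M` and `N`, glued along their boundary points.  (The vertical
part `B × [0, 1]` of the boundary of a cobordism is shrunk to `B`.)  The seams consist of edges,
and each seam carries a normal direction (its fringe). -/
structure Cob (M N : Curve O B) where
  /-- flags -/
  X : Type
  finite : Finite X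
  v : X → X
  e : X → X
  f : X → X
  v_v : ∀ x, v (v x) = x
  e_e : ∀ x, e (e x) = x
  f_f : ∀ x, f (f x) = x
  v_ne : ∀ x, v x ≠ x
  e_ne : ∀ x, e x ≠ x
  v_f : ∀ x, v (f x) = f (v x)
  f_ne_v : ∀ x, f x ≠ v x
  /-- the identification of the boundary -/
  i : M.X ⊕ N.X → X
  i_injective : Function.Injective i
  f_eq_iff : ∀ x, f x = x ↔ ∃ u, i u = x
  i_v : ∀ u, i (Sum.map M.v N.v u) = v (i u)
  /-- orientation of the face, as seen at the flag; in the case `O = ℤˣ`, the value `1` means that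
  the orientation of the face makes its edge point away from the vertex -/
  o : X → O
  /-- `1` if the edge of `x` belongs to a seam with fringe pointing from the face of `x` to the
  face of `f x`, `-1` if the fringe points the other way, `0` if the edge is not in a seam -/
  s : X → SignType
  o_v : ∀ x, o (v x) = -o x
  o_e : ∀ x, o (e x) = -o x
  s_v : ∀ x, s (v x) = s x
  s_f : ∀ x, s (f x) = -s x
  s_eq_zero_iff : ∀ x, f x ≠ x → (s x = 0 ↔ o (f x) = -o x)
  /-- the surface induces the given orientation on the target, the opposite one on the source -/
  o_i : ∀ u, o (i u) = Sum.elim (fun m => -M.o m) N.o u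
  /-- the vertices on the boundary are those of the boundary curve -/
  bdry_vertex : ∀ u w, Around e f (i u) (i w) ↔ w = u ∨ Meets M N u w
  /-- no seam ends at a boundary vertex without a mark -/
  seam_plain : ∀ u, Sum.elim M.s N.s u = 0 → ∀ x, Around e f (i u) x → s x = 0
  /-- exactly one seam ends at each mark on the boundary, with the same normal direction -/
  seam_mark : ∀ u w, Meets M N u w → Sum.elim M.s N.s u = 1 →
    ∃ z, OneSide e f s (i u) z ∧ s z = 1 ∧ OneSide e f s (f z) (i w)
  /-- at most one seam passes through a vertex, and its fringe stays on the same side -/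
  seam_vertex : ∀ x y, Around e f x y → s x = 1 → s y = 1 → OneSide e f s x y

namespace Cob

variable {M N P : Curve O B}

theorem s_i (S : Cob M N) (u) : S.s (S.i u) = 0 := by
  have h := S.s_f (S.i u)
  rw [(S.f_eq_iff _).2 ⟨u, rfl⟩] at h
  revert h
  generalize S.s (S.i u) = a
  revert a
  decide

theorem f_i (S : Cob M N) (u) : S.f (S.i u) = S.i u := (S.f_eq_iff _).2 ⟨u, rfl⟩


section Glue

variable (S : Cob M N) (T : Cob N P)

open Classical in
/-- Exchange of faces in the surface glued from `S` and `T` along `N`. -/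
noncomputable def glueF : S.X ⊕ T.X → S.X ⊕ T.X
  | .inl x => if h : ∃ n, S.i (.inr n) = x then .inr (T.i (.inl h.choose)) else .inl (S.f x)
  | .inr y => if h : ∃ n, T.i (.inl n) = y then .inl (S.i (.inr h.choose)) else .inr (T.f y)

theorem glueF_inl_i (n : N.X) : glueF S T (.inl (S.i (.inr n))) = .inr (T.i (.inl n)) := by
  have h : ∃ n', S.i (.inr n') = S.i (.inr n) := ⟨n, rfl⟩
  have h2 : h.choose = n := Sum.inr_injective (S.i_injective h.choose_spec)
  simp only [glueF, dif_pos h, h2]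

theorem glueF_inr_i (n : N.X) : glueF S T (.inr (T.i (.inl n))) = .inl (S.i (.inr n)) := by
  have h : ∃ n', T.i (.inl n') = T.i (.inl n) := ⟨n, rfl⟩
  have h2 : h.choose = n := Sum.inl_injective (T.i_injective h.choose_spec)
  simp only [glueF, dif_pos h, h2]

theorem glueF_inl {x : S.X} (h : ¬∃ n, S.i (.inr n) = x) :
    glueF S T (.inl x) = .inl (S.f x) := by
  simp only [glueF, dif_neg h]

theorem glueF_inr {y : T.X} (h : ¬∃ n, T.i (.inl n) = y) :
    glueF S T (.inr y) = .inr (T.f y) := by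
  simp only [glueF, dif_neg h]

/-- An induction principle for flags of the glued surface. -/
theorem glue_cases {p : S.X ⊕ T.X → Prop} (h1 : ∀ n, p (.inl (S.i (.inr n))))
    (h2 : ∀ n, p (.inr (T.i (.inl n))))
    (h3 : ∀ x, (¬∃ n, S.i (.inr n) = x) → p (.inl x))
    (h4 : ∀ y, (¬∃ n, T.i (.inl n) = y) → p (.inr y)) (z) : p z := by
  rcases z with x | y
  · by_cases h : ∃ n, S.i (.inr n) = x
    · obtain ⟨n, rfl⟩ := h; exact h1 n
    · exact h3 x h
  · by_cases h : ∃ n, T.i (.inl n) = y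
    · obtain ⟨n, rfl⟩ := h; exact h2 n
    · exact h4 y h

theorem not_i_f_left {x : S.X} (h : ¬∃ n, S.i (.inr n) = x) :
    ¬∃ n, S.i (.inr n) = S.f x := by
  rintro ⟨n, hn⟩
  exact h ⟨n, by rw [← S.f_f x, ← hn, S.f_i]⟩

theorem not_i_f_right {x : T.X} (h : ¬∃ n, T.i (.inl n) = x) :
    ¬∃ n, T.i (.inl n) = T.f x := by
  rintro ⟨n, hn⟩
  exact h ⟨n, by rw [← T.f_f x, ← hn, T.f_i]⟩

theorem not_i_v_left {x : S.X} (h : ¬∃ n, S.i (.inr n) = x) :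
    ¬∃ n, S.i (.inr n) = S.v x := by
  rintro ⟨n, hn⟩
  exact h ⟨N.v n, by rw [← S.v_v x, ← hn, ← S.i_v]; rfl⟩

theorem not_i_v_right {x : T.X} (h : ¬∃ n, T.i (.inl n) = x) :
    ¬∃ n, T.i (.inl n) = T.v x := by
  rintro ⟨n, hn⟩
  exact h ⟨N.v n, by rw [← T.v_v x, ← hn, ← T.i_v]; rfl⟩

theorem glueF_glueF (z) : glueF S T (glueF S T z) = z := by
  induction z using glue_cases S T with
  | h1 n => rw [glueF_inl_i, glueF_inr_i]
  | h2 n => rw [glueF_inr_i, glueF_inl_i]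
  | h3 x h => rw [glueF_inl S T h, glueF_inl S T (not_i_f_left S h), S.f_f]
  | h4 y h => rw [glueF_inr S T h, glueF_inr S T (not_i_f_right T h), T.f_f]

theorem around_glue_inl {x y : S.X} (h : Around S.e S.f x y) :
    Around (Sum.map S.e T.e) (glueF S T) (.inl x) (.inl y) := by
  refine h.map Sum.inl (fun x => .rel _ _ (.inl rfl)) fun x => ?_
  by_cases h : ∃ n, S.i (.inr n) = x
  · obtain ⟨n, rfl⟩ := h
    rw [S.f_i]
    exact .refl _
  · exact .rel _ _ (.inr (glueF_inl S T h).symm)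

theorem around_glue_inr {x y : T.X} (h : Around T.e T.f x y) :
    Around (Sum.map S.e T.e) (glueF S T) (.inr x) (.inr y) := by
  refine h.map Sum.inr (fun x => .rel _ _ (.inl rfl)) fun x => ?_
  by_cases h : ∃ n, T.i (.inl n) = x
  · obtain ⟨n, rfl⟩ := h
    rw [T.f_i]
    exact .refl _
  · exact .rel _ _ (.inr (glueF_inr S T h).symm)

theorem oneSide_glue_inl {x y : S.X} (h : OneSide S.e S.f S.s x y) :
    OneSide (Sum.map S.e T.e) (glueF S T) (Sum.elim S.s T.s) (.inl x) (.inl y) := by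
  refine h.map Sum.inl (fun x => .rel _ _ (.inl rfl)) fun x h0 => ?_
  by_cases h : ∃ n, S.i (.inr n) = x
  · obtain ⟨n, rfl⟩ := h
    rw [S.f_i]
    exact .refl _
  · exact .rel _ _ (.inr ⟨h0, (glueF_inl S T h).symm⟩)

theorem oneSide_glue_inr {x y : T.X} (h : OneSide T.e T.f T.s x y) :
    OneSide (Sum.map S.e T.e) (glueF S T) (Sum.elim S.s T.s) (.inr x) (.inr y) := by
  refine h.map Sum.inr (fun x => .rel _ _ (.inl rfl)) fun x h0 => ?_
  by_cases h : ∃ n, T.i (.inl n) = x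
  · obtain ⟨n, rfl⟩ := h
    rw [T.f_i]
    exact .refl _
  · exact .rel _ _ (.inr ⟨h0, (glueF_inr S T h).symm⟩)

theorem oneSide_glue_i (n : N.X) :
    OneSide (Sum.map S.e T.e) (glueF S T) (Sum.elim S.s T.s) (.inl (S.i (.inr n)))
      (.inr (T.i (.inl n))) :=
  .rel _ _ (.inr ⟨S.s_i _, (glueF_inl_i S T n).symm⟩)

/-- The flags of the glued surface around a vertex of the source. -/
def SrcNbhd (m : M.X) : S.X ⊕ T.X → Prop :=
  Sum.elim (Around S.e S.f (S.i (.inl m)))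
    fun y => ∃ b, M.pt b = m ∧ Around T.e T.f (T.i (.inl (N.pt b))) y

/-- The flags of the glued surface around a vertex of the target. -/
def TgtNbhd (p : P.X) : S.X ⊕ T.X → Prop :=
  Sum.elim (fun x => ∃ b, P.pt b = p ∧ Around S.e S.f (S.i (.inr (N.pt b))) x)
    (Around T.e T.f (T.i (.inr p)))

theorem srcNbhd_iff {m : M.X} {z} (h : Around (Sum.map S.e T.e) (glueF S T)
    (.inl (S.i (.inl m))) z) : SrcNbhd S T m z := by
  refine (h.closed (P := SrcNbhd S T m) ?_ (glueF_glueF S T) ?_ ?_).1 (.refl _)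
  · rintro (x | x) <;> simp [S.e_e, T.e_e]
  · rintro (x | x) hx
    · exact .trans _ _ _ hx (.rel _ _ (.inl rfl))
    · obtain ⟨b, hb, hx⟩ := hx
      exact ⟨b, hb, .trans _ _ _ hx (.rel _ _ (.inl rfl))⟩
  · intro z
    induction z using glue_cases S T with
    | h1 n =>
      intro hz
      rw [glueF_inl_i]
      rcases (S.bdry_vertex _ _).1 hz with h | h
      · cases h
      · cases h with
        | st b => exact ⟨b, rfl, .refl _⟩
    | h2 n =>
      rintro ⟨b, rfl, hz⟩
      rw [glueF_inr_i]
      rcases (T.bdry_vertex _ _).1 hz with h | h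
      · cases h
        exact (S.bdry_vertex _ _).2 (.inr (.st b))
      · exact absurd ((N.e_eq_iff _).2 ⟨b, rfl⟩) (Meets.iff.1 h).1
    | h3 x h =>
      intro hx
      rw [glueF_inl S T h]
      exact .trans _ _ _ hx (.rel _ _ (.inr rfl))
    | h4 y h =>
      rintro ⟨b, hb, hx⟩
      rw [glueF_inr S T h]
      exact ⟨b, hb, .trans _ _ _ hx (.rel _ _ (.inr rfl))⟩

theorem tgtNbhd_iff {p : P.X} {z} (h : Around (Sum.map S.e T.e) (glueF S T)
    (.inr (T.i (.inr p))) z) : TgtNbhd S T p z := by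
  refine (h.closed (P := TgtNbhd S T p) ?_ (glueF_glueF S T) ?_ ?_).1 (.refl _)
  · rintro (x | x) <;> simp [S.e_e, T.e_e]
  · rintro (x | x) hx
    · obtain ⟨b, hb, hx⟩ := hx
      exact ⟨b, hb, .trans _ _ _ hx (.rel _ _ (.inl rfl))⟩
    · exact .trans _ _ _ hx (.rel _ _ (.inl rfl))
  · intro z
    induction z using glue_cases S T with
    | h1 n =>
      rintro ⟨b, rfl, hz⟩
      rw [glueF_inl_i]
      rcases (S.bdry_vertex _ _).1 hz with h | h
      · cases h
        exact (T.bdry_vertex _ _).2 (.inr (.ts b))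
      · exact absurd ((N.e_eq_iff _).2 ⟨b, rfl⟩) (Meets.iff.1 h).1
    | h2 n =>
      intro hz
      rw [glueF_inr_i]
      rcases (T.bdry_vertex _ _).1 hz with h | h
      · cases h
      · cases h with
        | ts b => exact ⟨b, rfl, .refl _⟩
    | h3 y h =>
      rintro ⟨b, hb, hx⟩
      rw [glueF_inl S T h]
      exact ⟨b, hb, .trans _ _ _ hx (.rel _ _ (.inr rfl))⟩
    | h4 x h =>
      intro hx
      rw [glueF_inr S T h]
      exact .trans _ _ _ hx (.rel _ _ (.inr rfl))

/-- All seams around the vertex of `z` have flags on the same side as `x`. -/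
def SeamsNear (x : S.X ⊕ T.X) : S.X ⊕ T.X → Prop :=
  Sum.elim
    (fun z => ∀ y, Around S.e S.f z y → S.s y = 1 →
      OneSide (Sum.map S.e T.e) (glueF S T) (Sum.elim S.s T.s) x (.inl y))
    (fun z => ∀ y, Around T.e T.f z y → T.s y = 1 →
      OneSide (Sum.map S.e T.e) (glueF S T) (Sum.elim S.s T.s) x (.inr y))

theorem seamsNear_cross (x) (n : N.X) :
    SeamsNear S T x (.inl (S.i (.inr n))) ↔ SeamsNear S T x (.inr (T.i (.inl n))) := by
  have key : ∀ n : N.X, N.s n = 1 →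
      (SeamsNear S T x (.inl (S.i (.inr n))) ↔ SeamsNear S T x (.inr (T.i (.inl n)))) := by
    intro n hn
    have hne : N.e n ≠ n := fun h => by
      have := N.s_e n
      rw [h, hn] at this
      exact absurd this (by decide)
    obtain ⟨z, hz, hz1, -⟩ := S.seam_mark _ _ (.tgt n hne) hn
    obtain ⟨z', hz', hz1', -⟩ := T.seam_mark _ _ (.src n hne) hn
    have hzz : OneSide (Sum.map S.e T.e) (glueF S T) (Sum.elim S.s T.s) (.inl z) (.inr z') :=
      .trans _ _ _ (.symm _ _ (oneSide_glue_inl S T hz))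
        (.trans _ _ _ (oneSide_glue_i S T n) (oneSide_glue_inr S T hz'))
    constructor
    · intro h y hy hy1
      have h1 := h z hz.around hz1
      have h2 := T.seam_vertex z' y (.trans _ _ _ (.symm _ _ hz'.around) hy) hz1' hy1
      exact .trans _ _ _ h1 (.trans _ _ _ hzz (oneSide_glue_inr S T h2))
    · intro h y hy hy1
      have h1 := h z' hz'.around hz1'
      have h2 := S.seam_vertex z y (.trans _ _ _ (.symm _ _ hz.around) hy) hz1 hy1
      exact .trans _ _ _ h1 (.trans _ _ _ (.symm _ _ hzz) (oneSide_glue_inl S T h2))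
  rcases hs : N.s n with _ | _ | _
  · constructor
    · intro _ y hy hy1
      exact absurd ((T.seam_plain (.inl n) hs y hy).symm.trans hy1) (by decide)
    · intro _ y hy hy1
      exact absurd ((S.seam_plain (.inr n) hs y hy).symm.trans hy1) (by decide)
  · have hne : N.e n ≠ n := fun h => by
      have := N.s_e n
      rw [h, hs] at this
      exact absurd this (by decide)
    have h1 := key (N.e n) (by rw [N.s_e, hs]; rfl)
    have a1 : Around S.e S.f (S.i (.inr n)) (S.i (.inr (N.e n))) :=
      (S.bdry_vertex _ _).2 (.inr (.tgt n hne))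
    have a2 : Around T.e T.f (T.i (.inl n)) (T.i (.inl (N.e n))) :=
      (T.bdry_vertex _ _).2 (.inr (.src n hne))
    constructor
    · intro h y hy
      exact h1.1 (fun y hy => h y (.trans _ _ _ a1 hy)) y (.trans _ _ _ (.symm _ _ a2) hy)
    · intro h y hy
      exact h1.2 (fun y hy => h y (.trans _ _ _ a2 hy)) y (.trans _ _ _ (.symm _ _ a1) hy)
  · exact key n hs

theorem seamsNear_iff (x) {z w} (h : Around (Sum.map S.e T.e) (glueF S T) z w) :
    SeamsNear S T x z ↔ SeamsNear S T x w := by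
  refine h.closed ?_ (glueF_glueF S T) ?_ ?_
  · rintro (x | x) <;> simp [S.e_e, T.e_e]
  · rintro (z | z) hz y hy
    · exact hz y (.trans _ _ _ (.rel _ _ (.inl rfl)) hy)
    · exact hz y (.trans _ _ _ (.rel _ _ (.inl rfl)) hy)
  · intro z
    induction z using glue_cases S T with
    | h1 n => rw [glueF_inl_i]; exact (seamsNear_cross S T x n).1
    | h2 n => rw [glueF_inr_i]; exact (seamsNear_cross S T x n).2
    | h3 z h =>
      rw [glueF_inl S T h]
      exact fun hz y hy => hz y (.trans _ _ _ (.rel _ _ (.inr rfl)) hy)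
    | h4 z h =>
      rw [glueF_inr S T h]
      exact fun hz y hy => hz y (.trans _ _ _ (.rel _ _ (.inr rfl)) hy)

/-- Composition of cobordisms: gluing along the middle curve. -/
noncomputable def glue : Cob M P where
  X := S.X ⊕ T.X
  finite := by
    have := S.finite
    have := T.finite
    infer_instance
  v := Sum.map S.v T.v
  e := Sum.map S.e T.e
  f := glueF S T
  v_v := by rintro (x | x) <;> simp [S.v_v, T.v_v]
  e_e := by rintro (x | x) <;> simp [S.e_e, T.e_e]
  f_f := glueF_glueF S T
  v_ne := by rintro (x | x) <;> simp [S.v_ne, T.v_ne]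
  e_ne := by rintro (x | x) <;> simp [S.e_ne, T.e_ne]
  v_f z := by
    induction z using glue_cases S T with
    | h1 n =>
      have : S.v (S.i (.inr n)) = S.i (.inr (N.v n)) := (S.i_v _).symm
      simp only [Sum.map_inl, this, glueF_inl_i, Sum.map_inr, Sum.inr.injEq]
      exact (T.i_v _).symm
    | h2 n =>
      have : T.v (T.i (.inl n)) = T.i (.inl (N.v n)) := (T.i_v _).symm
      simp only [Sum.map_inl, this, glueF_inr_i, Sum.map_inr, Sum.inl.injEq]
      exact (S.i_v _).symm
    | h3 x h =>
      rw [Sum.map_inl, glueF_inl S T h, glueF_inl S T (not_i_v_left S h), Sum.map_inl, S.v_f]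
    | h4 y h =>
      rw [Sum.map_inr, glueF_inr S T h, glueF_inr S T (not_i_v_right T h), Sum.map_inr, T.v_f]
  f_ne_v z := by
    induction z using glue_cases S T with
    | h1 n => simp [glueF_inl_i]
    | h2 n => simp [glueF_inr_i]
    | h3 x h => simp [glueF_inl S T h, S.f_ne_v]
    | h4 y h => simp [glueF_inr S T h, T.f_ne_v]
  i := Sum.map (fun m => S.i (.inl m)) (fun p => T.i (.inr p))
  i_injective := Sum.map_injective.2
    ⟨S.i_injective.comp Sum.inl_injective, T.i_injective.comp Sum.inr_injective⟩
  f_eq_iff z := by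
    induction z using glue_cases S T with
    | h1 n =>
      rw [glueF_inl_i]
      refine ⟨fun h => (by cases h), ?_⟩
      rintro ⟨(u | u), hu⟩
      · have := S.i_injective (Sum.inl_injective hu)
        cases this
      · cases hu
    | h2 n =>
      rw [glueF_inr_i]
      refine ⟨fun h => (by cases h), ?_⟩
      rintro ⟨(u | u), hu⟩
      · cases hu
      · have := T.i_injective (Sum.inr_injective hu)
        cases this
    | h3 x h =>
      rw [glueF_inl S T h, Sum.inl.injEq, S.f_eq_iff]
      constructor
      · rintro ⟨(u | u), hu⟩
        · exact ⟨.inl u, congrArg Sum.inl hu⟩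
        · exact absurd ⟨u, hu⟩ h
      · rintro ⟨(u | u), hu⟩
        · exact ⟨.inl u, Sum.inl_injective hu⟩
        · cases hu
    | h4 x h =>
      rw [glueF_inr S T h, Sum.inr.injEq, T.f_eq_iff]
      constructor
      · rintro ⟨(u | u), hu⟩
        · exact absurd ⟨u, hu⟩ h
        · exact ⟨.inr u, congrArg Sum.inr hu⟩
      · rintro ⟨(u | u), hu⟩
        · cases hu
        · exact ⟨.inr u, Sum.inr_injective hu⟩
  i_v := by
    rintro (u | u)
    · exact congrArg Sum.inl (S.i_v (.inl u))
    · exact congrArg Sum.inr (T.i_v (.inr u))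
  o := Sum.elim S.o T.o
  s := Sum.elim S.s T.s
  o_v := by rintro (x | x) <;> simp [S.o_v, T.o_v]
  o_e := by rintro (x | x) <;> simp [S.o_e, T.o_e]
  s_v := by rintro (x | x) <;> simp [S.s_v, T.s_v]
  s_f z := by
    induction z using glue_cases S T with
    | h1 n => simp [glueF_inl_i, s_i]
    | h2 n => simp [glueF_inr_i, s_i]
    | h3 x h => simp [glueF_inl S T h, S.s_f]
    | h4 y h => simp [glueF_inr S T h, T.s_f]
  s_eq_zero_iff z := by
    induction z using glue_cases S T with
    | h1 n => simp [glueF_inl_i, s_i, S.o_i, T.o_i]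
    | h2 n => simp [glueF_inr_i, s_i, S.o_i, T.o_i]
    | h3 x h => simpa [glueF_inl S T h] using S.s_eq_zero_iff x
    | h4 y h => simpa [glueF_inr S T h] using T.s_eq_zero_iff y
  o_i := by
    rintro (u | u)
    · exact S.o_i (.inl u)
    · exact T.o_i (.inr u)
  bdry_vertex u w := by
    constructor
    · intro h
      rcases u with m | p
      · have h0 := srcNbhd_iff S T h
        rcases w with m' | p'
        · rcases (S.bdry_vertex _ _).1 h0 with h1 | h1
          · exact .inl (by cases h1; rfl)
          · exact .inr (Meets.iff.2 (Meets.iff.1 h1))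
        · obtain ⟨b, rfl, h0⟩ := h0
          rcases (T.bdry_vertex _ _).1 h0 with h1 | h1
          · cases h1
          · obtain ⟨b', hb, rfl⟩ := Meets.iff.1 h1
            obtain rfl := N.pt_injective hb
            exact .inr (.st _)
      · have h0 := tgtNbhd_iff S T h
        rcases w with m' | p'
        · obtain ⟨b, rfl, h0⟩ := h0
          rcases (S.bdry_vertex _ _).1 h0 with h1 | h1
          · cases h1
          · obtain ⟨b', rfl, hb⟩ := Meets.iff.1 h1
            obtain rfl := N.pt_injective hb
            exact .inr (.ts _)
        · rcases (T.bdry_vertex _ _).1 h0 with h1 | h1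
          · exact .inl (by cases h1; rfl)
          · exact .inr (Meets.iff.2 (Meets.iff.1 h1))
    · have hst : ∀ b, Around (Sum.map S.e T.e) (glueF S T) (.inl (S.i (.inl (M.pt b))))
          (.inr (T.i (.inr (P.pt b)))) := fun b =>
        .trans _ _ _ (around_glue_inl S T ((S.bdry_vertex _ _).2 (.inr (.st b))))
          (.trans _ _ _ (oneSide_glue_i S T _).around
            (around_glue_inr S T ((T.bdry_vertex _ _).2 (.inr (.st b)))))
      rintro (rfl | h)
      · exact .refl _
      · cases h with
        | src m h => exact around_glue_inl S T ((S.bdry_vertex _ _).2 (.inr (.src m h)))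
        | tgt p h => exact around_glue_inr S T ((T.bdry_vertex _ _).2 (.inr (.tgt p h)))
        | st b => exact hst b
        | ts b => exact .symm _ _ (hst b)
  seam_plain u h z hz := by
    have hpt : ∀ b, N.s (N.pt b) = 0 := fun b => by
      have h := N.s_e (N.pt b)
      rw [(N.e_eq_iff _).2 ⟨b, rfl⟩] at h
      revert h
      generalize N.s (N.pt b) = a
      revert a
      decide
    rcases u with m | p
    · rcases z with x | y
      · exact S.seam_plain (.inl m) h x (srcNbhd_iff S T hz)
      · obtain ⟨b, -, hy⟩ := srcNbhd_iff S T hz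
        exact T.seam_plain (.inl _) (hpt b) y hy
    · rcases z with x | y
      · obtain ⟨b, -, hy⟩ := tgtNbhd_iff S T hz
        exact S.seam_plain (.inr _) (hpt b) x hy
      · exact T.seam_plain (.inr p) h y (tgtNbhd_iff S T hz)
  seam_mark u w huw h := by
    have hpt : ∀ (K : Curve O B) b, K.s (K.pt b) ≠ 1 := fun K b h1 => by
      have h := K.s_e (K.pt b)
      rw [(K.e_eq_iff _).2 ⟨b, rfl⟩, h1] at h
      exact absurd h (by decide)
    cases huw with
    | src m hm =>
      obtain ⟨z, h1, h2, h3⟩ := S.seam_mark _ _ (.src m hm) h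
      refine ⟨.inl z, oneSide_glue_inl S T h1, h2, ?_⟩
      have : ¬∃ n, S.i (.inr n) = z := by
        rintro ⟨n, rfl⟩
        rw [s_i] at h2
        exact absurd h2 (by decide)
      rw [glueF_inl S T this]
      exact oneSide_glue_inl S T h3
    | tgt p hp =>
      obtain ⟨z, h1, h2, h3⟩ := T.seam_mark _ _ (.tgt p hp) h
      refine ⟨.inr z, oneSide_glue_inr S T h1, h2, ?_⟩
      have : ¬∃ n, T.i (.inl n) = z := by
        rintro ⟨n, rfl⟩
        rw [s_i] at h2
        exact absurd h2 (by decide)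
      rw [glueF_inr S T this]
      exact oneSide_glue_inr S T h3
    | st b => exact absurd h (hpt M b)
    | ts b => exact absurd h (hpt P b)
  seam_vertex x y hxy hx hy := by
    have h0 : SeamsNear S T x x := by
      rcases x with x | x
      · exact fun y hy hy1 => oneSide_glue_inl S T (S.seam_vertex x y hy hx hy1)
      · exact fun y hy hy1 => oneSide_glue_inr S T (T.seam_vertex x y hy hx hy1)
    have h1 := (seamsNear_iff S T x hxy).1 h0
    rcases y with y | y
    · exact h1 y (.refl _) hy
    · exact h1 y (.refl _) hy

end Glue

section Cylinder

variable (M)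

open Classical in
/-- Exchange of edges in the product `M × [0, 1]`. -/
noncomputable def idE :
    (M.X × Bool) ⊕ ({x // M.e x ≠ x} × Bool) → (M.X × Bool) ⊕ ({x // M.e x ≠ x} × Bool)
  | .inl (x, t) => if h : M.e x ≠ x then .inr (⟨x, h⟩, t) else .inl (x, !t)
  | .inr (x, t) => .inl (x.1, t)

/-- Exchange of faces in the product `M × [0, 1]`. -/
def idF :
    (M.X × Bool) ⊕ ({x // M.e x ≠ x} × Bool) → (M.X × Bool) ⊕ ({x // M.e x ≠ x} × Bool)
  | .inl p => .inl p
  | .inr (x, t) => .inr (⟨M.e x.1, fun h => x.2 (by rw [M.e_e] at h; exact h.symm)⟩, t)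

/-- The flags of `M × [0, 1]` near the vertex of `m` at the end `t`. -/
def IdNbhd (m : M.X) (t : Bool) : (M.X × Bool) ⊕ ({x // M.e x ≠ x} × Bool) → Prop
  | .inl (x, t') => (x = m ∨ x = M.e m) ∧ (M.e m = m ∨ t' = t)
  | .inr (x, t') => (x.1 = m ∨ x.1 = M.e m) ∧ (M.e m = m ∨ t' = t)

theorem idE_idE (x) : idE M (idE M x) = x := by
  rcases x with ⟨x, t⟩ | ⟨⟨x, hx⟩, t⟩
  · by_cases h : M.e x = x <;> simp [idE, h]
  · simp [idE, hx]

theorem idF_idF (x) : idF M (idF M x) = x := by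
  rcases x with ⟨x, t⟩ | ⟨⟨x, hx⟩, t⟩
  · rfl
  · simp [idF, M.e_e]

theorem idNbhd_of_around {m : M.X} {t : Bool} {y z} (h : Around (idE M) (idF M) y z)
    (hy : IdNbhd M m t y) : IdNbhd M m t z := by
  refine (h.closed (idE_idE M) (idF_idF M) ?_ ?_).1 hy
  · rintro (⟨x, t'⟩ | ⟨⟨x, hx⟩, t'⟩) h
    · by_cases hx : M.e x = x
      · simp only [idE, hx, ne_eq, not_true, dif_neg, not_false_eq_true]
        refine ⟨h.1, .inl ?_⟩
        rcases h.1 with rfl | rfl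
        · exact hx
        · rw [M.e_e] at hx; exact hx.symm
      · simp only [idE, hx, ne_eq, not_false_eq_true, dif_pos]
        exact h
    · exact h
  · rintro (⟨x, t'⟩ | ⟨⟨x, hx⟩, t'⟩) h
    · exact h
    · refine ⟨?_, h.2⟩
      rcases h.1 with h | h
      · exact .inr (congrArg M.e h)
      · refine .inl ?_
        simp only at h ⊢
        rw [h, M.e_e]

/-- The product `M × [0, 1]` (with `{b} × [0, 1]` shrunk to a point for the boundary points `b` of
`M`).  Its faces are the products of the edges of `M` with `[0, 1]`, its seams the products of the
marks with `[0, 1]`. -/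
noncomputable def id : Cob M M where
  X := (M.X × Bool) ⊕ ({x // M.e x ≠ x} × Bool)
  finite := by
    have := M.finite
    infer_instance
  v := Sum.map (fun p => (M.v p.1, p.2)) (fun p => (p.1, !p.2))
  e := idE M
  f := idF M
  v_v := by rintro (⟨x, t⟩ | ⟨⟨x, hx⟩, t⟩) <;> simp [M.v_v]
  e_e := idE_idE M
  f_f := idF_idF M
  v_ne := by rintro (⟨x, t⟩ | ⟨⟨x, hx⟩, t⟩) <;> simp [M.v_ne]
  e_ne := by
    rintro (⟨x, t⟩ | ⟨⟨x, hx⟩, t⟩)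
    · by_cases h : M.e x = x <;> simp [idE, h]
    · simp [idE]
  v_f := by rintro (⟨x, t⟩ | ⟨⟨x, hx⟩, t⟩) <;> simp [idF]
  f_ne_v := by
    rintro (⟨x, t⟩ | ⟨⟨x, hx⟩, t⟩)
    · simpa [idF] using (M.v_ne x).symm
    · simp [idF]
  i := Sum.elim (fun m => .inl (m, false)) (fun m => .inl (m, true))
  i_injective := by rintro (x | x) (y | y) h <;> simp_all
  f_eq_iff := by
    rintro (⟨x, t⟩ | ⟨⟨x, hx⟩, t⟩)
    · cases t <;> simp [idF]
    · simp [idF, hx]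
  i_v := by rintro (x | x) <;> rfl
  o := Sum.elim (fun p => if p.2 then M.o p.1 else -M.o p.1)
    (fun p => if p.2 then -M.o p.1 else M.o p.1)
  s := Sum.elim (fun _ => 0) (fun p => M.s p.1)
  o_v := by rintro (⟨x, t⟩ | ⟨⟨x, hx⟩, t⟩) <;> cases t <;> simp [M.o_v]
  o_e := by
    rintro (⟨x, t⟩ | ⟨⟨x, hx⟩, t⟩)
    · by_cases h : M.e x = x <;> cases t <;> simp [idE, h]
    · cases t <;> simp [idE]
  s_v := by rintro (⟨x, t⟩ | ⟨⟨x, hx⟩, t⟩) <;> rfl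
  s_f := by
    rintro (⟨x, t⟩ | ⟨⟨x, hx⟩, t⟩)
    · rfl
    · exact M.s_e x
  s_eq_zero_iff := by
    rintro (⟨x, t⟩ | ⟨⟨x, hx⟩, t⟩) h
    · exact absurd rfl h
    · have := M.s_eq_zero_iff x hx
      cases t <;> simp [idF, this, neg_eq_iff_eq_neg]
  o_i := by rintro (x | x) <;> rfl
  bdry_vertex := by
    have key : ∀ m m' t t', Around (idE M) (idF M) (.inl (m, t)) (.inl (m', t')) ↔
        (m' = m ∨ m' = M.e m) ∧ (M.e m = m ∨ t' = t) := by
      intro m m' t t'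
      constructor
      · intro h
        exact idNbhd_of_around M h (m := m) (t := t) ⟨.inl rfl, .inr rfl⟩
      · intro h
        by_cases hm : M.e m = m
        · have hm' : m' = m := by simpa [hm] using h
          subst hm'
          by_cases ht : t' = t
          · subst ht; exact .refl _
          · refine .rel _ _ (.inl ?_)
            simp only [idE, hm, ne_eq, not_true, dif_neg, not_false_eq_true]
            cases t <;> cases t' <;> simp_all
        · have ht : t' = t := by simpa [hm] using h.2
          subst ht
          rcases h.1 with rfl | rfl
          · exact .refl _
          · refine .trans _ (.inr (⟨m, hm⟩, t')) _ (.rel _ _ (.inl (by simp [idE, hm]))) ?_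
            refine .trans _ _ _ (.rel _ _ (.inr rfl)) (.rel _ _ (.inl ?_))
            rfl
    have hpt : ∀ m, M.e m = m → ∃ b, M.pt b = m := fun m => (M.e_eq_iff m).1
    have hpt' : ∀ b, M.e (M.pt b) = M.pt b := fun b => (M.e_eq_iff _).2 ⟨b, rfl⟩
    rintro (m | m) (m' | m')
    · rw [Meets.iff]
      refine (key m m' false false).trans ?_
      by_cases hm : M.e m = m
      · simp [hm]
      · simp [hm, eq_comm (a := M.e m)]
    · rw [Meets.iff]
      refine (key m m' false true).trans ?_
      by_cases hm : M.e m = m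
      · obtain ⟨b, rfl⟩ := hpt m hm
        simp only [hm, or_self, true_or, and_true, reduceCtorEq, false_or]
        constructor
        · rintro rfl; exact ⟨b, rfl, rfl⟩
        · rintro ⟨b', h1, h2⟩; exact h2.symm.trans h1
      · simp only [hm, reduceCtorEq, or_self, and_false, false_or, false_iff]
        rintro ⟨b, rfl, -⟩
        exact hm (hpt' b)
    · rw [Meets.iff]
      refine (key m m' true false).trans ?_
      by_cases hm : M.e m = m
      · obtain ⟨b, rfl⟩ := hpt m hm
        simp only [hm, or_self, true_or, and_true, reduceCtorEq, false_or]
        constructor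
        · rintro rfl; exact ⟨b, rfl, rfl⟩
        · rintro ⟨b', h1, h2⟩; exact h1.symm.trans h2
      · simp only [hm, reduceCtorEq, or_self, and_false, false_or, false_iff]
        rintro ⟨b, -, rfl⟩
        exact hm (hpt' b)
    · rw [Meets.iff]
      refine (key m m' true true).trans ?_
      by_cases hm : M.e m = m
      · simp [hm]
      · simp [hm, eq_comm (a := M.e m)]
  seam_plain := by
    have key : ∀ m t, M.s m = 0 → ∀ x, Around (idE M) (idF M) (.inl (m, t)) x →
        Sum.elim (fun _ => (0 : SignType)) (fun p : {x // M.e x ≠ x} × Bool => M.s p.1) x = 0 := by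
      intro m t hm x hx
      have h := idNbhd_of_around M hx (m := m) (t := t) ⟨.inl rfl, .inr rfl⟩
      rcases x with ⟨x, t⟩ | ⟨⟨x, hx⟩, t⟩
      · rfl
      · rcases h.1 with h | h
        · simp only at h
          simp [h, hm]
        · simp only at h
          simp [h, M.s_e, hm]
    rintro (m | m) hm x hx
    · exact key m false hm x hx
    · exact key m true hm x hx
  seam_mark := by
    have key : ∀ m t, M.e m ≠ m → M.s m = 1 →
        ∃ z, OneSide (idE M) (idF M) (Sum.elim (fun _ => (0 : SignType))
            (fun p : {x // M.e x ≠ x} × Bool => M.s p.1)) (.inl (m, t)) z ∧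
          Sum.elim (fun _ => (0 : SignType)) (fun p : {x // M.e x ≠ x} × Bool => M.s p.1) z = 1 ∧
          OneSide (idE M) (idF M) (Sum.elim (fun _ => (0 : SignType))
            (fun p : {x // M.e x ≠ x} × Bool => M.s p.1)) (idF M z) (.inl (M.e m, t)) := by
      intro m t hm h
      exact ⟨.inr (⟨m, hm⟩, t), .rel _ _ (.inl (by simp [idE, hm])), h, .rel _ _ (.inl rfl)⟩
    have hpt : ∀ b, M.s (M.pt b) ≠ 1 := fun b h1 => by
      have h := M.s_e (M.pt b)
      rw [(M.e_eq_iff _).2 ⟨b, rfl⟩, h1] at h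
      exact absurd h (by decide)
    intro u w huw h
    cases huw with
    | src m hm => exact key m false hm h
    | tgt m hm => exact key m true hm h
    | st b => exact absurd h (hpt b)
    | ts b => exact absurd h (hpt b)
  seam_vertex := by
    rintro (⟨x, t⟩ | ⟨⟨x, hx⟩, t⟩) (⟨y, t'⟩ | ⟨⟨y, hy⟩, t'⟩) h h1 h2
    · exact absurd h1 (by simp)
    · exact absurd h1 (by simp)
    · exact absurd h2 (by simp)
    · have h := idNbhd_of_around M h (m := x) (t := t) ⟨.inl rfl, .inr rfl⟩
      have ht : t' = t := h.2.resolve_left hx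
      subst ht
      rcases h.1 with h | h
      · simp only at h
        subst h
        exact .refl _
      · simp only [Sum.elim_inr] at h h1 h2
        rw [h, M.s_e, h1] at h2
        exact absurd h2 (by decide)

end Cylinder

section Handle

/-- Exchange of vertices on the four new sides of a handle. -/
def handleV8 : Fin 8 → Fin 8 := ![1, 0, 3, 2, 5, 4, 7, 6]

/-- The gluing of the four new sides of a handle. -/
def handleF8 : Fin 8 → Fin 8 := ![5, 4, 7, 6, 1, 0, 3, 2]

variable (S : Cob M N) (x : S.X)

open Classical in
/-- Exchange of edges after a handle is attached at the corner of `x`. -/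
noncomputable def handleE : S.X ⊕ Fin 8 → S.X ⊕ Fin 8 :=
  Sum.elim (fun y => if y = x then .inr 0 else if y = S.e x then .inr 7 else .inl (S.e y))
    ![.inl x, .inr 2, .inr 1, .inr 4, .inr 3, .inr 6, .inr 5, .inl (S.e x)]

/-- Exchange of faces after a handle is attached at the corner of `x`. -/
def handleF : S.X ⊕ Fin 8 → S.X ⊕ Fin 8 := Sum.map S.f handleF8

theorem handleE_x : handleE S x (.inl x) = .inr 0 := by simp [handleE]

theorem handleE_ex : handleE S x (.inl (S.e x)) = .inr 7 := by simp [handleE, S.e_ne]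

theorem handleE_inl {y : S.X} (h1 : y ≠ x) (h2 : y ≠ S.e x) :
    handleE S x (.inl y) = .inl (S.e y) := by simp [handleE, h1, h2]

theorem handleE_handleE (y) : handleE S x (handleE S x y) = y := by
  rcases y with y | k
  · by_cases h1 : y = x
    · subst h1; rw [handleE_x]; rfl
    · by_cases h2 : y = S.e x
      · subst h2; rw [handleE_ex]; rfl
      · rw [handleE_inl S x h1 h2, handleE_inl, S.e_e]
        · intro h; exact h2 (by rw [← h, S.e_e])
        · intro h; exact h1 (by rw [← S.e_e y, h, S.e_e])
  · fin_cases k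
    · exact handleE_x S x
    all_goals first | rfl | exact handleE_ex S x

theorem oneSide_handle_corner : OneSide (handleE S x) (handleF S) (Sum.elim S.s 0) (.inl x)
    (.inl (S.e x)) := by
  have h0 : OneSide (handleE S x) (handleF S) (Sum.elim S.s 0) (.inl x) (.inr 0) :=
    .rel _ _ (.inl (handleE_x S x).symm)
  have h1 : OneSide (handleE S x) (handleF S) (Sum.elim S.s 0) (.inr 0) (.inr 5) :=
    .rel _ _ (.inr ⟨rfl, rfl⟩)
  have h2 : OneSide (handleE S x) (handleF S) (Sum.elim S.s 0) (.inr 5) (.inr 6) :=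
    .rel _ _ (.inl rfl)
  have h3 : OneSide (handleE S x) (handleF S) (Sum.elim S.s 0) (.inr 6) (.inr 3) :=
    .rel _ _ (.inr ⟨rfl, rfl⟩)
  have h4 : OneSide (handleE S x) (handleF S) (Sum.elim S.s 0) (.inr 3) (.inr 4) :=
    .rel _ _ (.inl rfl)
  have h5 : OneSide (handleE S x) (handleF S) (Sum.elim S.s 0) (.inr 4) (.inr 1) :=
    .rel _ _ (.inr ⟨rfl, rfl⟩)
  have h6 : OneSide (handleE S x) (handleF S) (Sum.elim S.s 0) (.inr 1) (.inr 2) :=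
    .rel _ _ (.inl rfl)
  have h7 : OneSide (handleE S x) (handleF S) (Sum.elim S.s 0) (.inr 2) (.inr 7) :=
    .rel _ _ (.inr ⟨rfl, rfl⟩)
  have h8 : OneSide (handleE S x) (handleF S) (Sum.elim S.s 0) (.inr 7) (.inl (S.e x)) :=
    .rel _ _ (.inl rfl)
  exact .trans _ _ _ h0 (.trans _ _ _ h1 (.trans _ _ _ h2 (.trans _ _ _ h3 (.trans _ _ _ h4
    (.trans _ _ _ h5 (.trans _ _ _ h6 (.trans _ _ _ h7 h8)))))))

theorem oneSide_handle_e (y : S.X) : OneSide (handleE S x) (handleF S) (Sum.elim S.s 0) (.inl y)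
    (.inl (S.e y)) := by
  by_cases h1 : y = x
  · subst h1; exact oneSide_handle_corner S y
  · by_cases h2 : y = S.e x
    · subst h2
      rw [S.e_e]
      exact .symm _ _ (oneSide_handle_corner S x)
    · exact .rel _ _ (.inl (handleE_inl S x h1 h2).symm)

theorem oneSide_handle {y z : S.X} (h : OneSide S.e S.f S.s y z) :
    OneSide (handleE S x) (handleF S) (Sum.elim S.s 0) (.inl y) (.inl z) :=
  h.map _ (oneSide_handle_e S x) fun _ h => .rel _ _ (.inr ⟨h, rfl⟩)

theorem around_handle {y z : S.X} (h : Around S.e S.f y z) :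
    Around (handleE S x) (handleF S) (.inl y) (.inl z) :=
  h.map _ (fun y => (oneSide_handle_e S x y).around) fun _ => .rel _ _ (.inr rfl)

theorem around_of_handle {y z} (h : Around (handleE S x) (handleF S) y z) :
    Around S.e S.f (Sum.elim (fun y => y) (fun _ => x) y)
      (Sum.elim (fun y => y) (fun _ => x) z) := by
  refine h.map _ ?_ ?_
  · rintro (y | k)
    · by_cases h1 : y = x
      · subst h1; rw [handleE_x]; exact .refl _
      · by_cases h2 : y = S.e x
        · subst h2; rw [handleE_ex]; exact .rel _ _ (.inl (S.e_e x).symm)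
        · rw [handleE_inl S x h1 h2]; exact .rel _ _ (.inl rfl)
    · fin_cases k
      all_goals first | exact .refl _ | exact .rel _ _ (.inl rfl)
  · rintro (y | k)
    · exact .rel _ _ (.inr rfl)
    · exact .refl _

/-- Connected sum with a torus, in the face of `x`: the word of this face (that is, the cyclic
sequence of its sides) gets the commutator `a b a⁻¹ b⁻¹` of two new edges inserted at the corner
between `x` and `e x`. -/
noncomputable def addHandle : Cob M N where
  X := S.X ⊕ Fin 8
  finite := by
    have := S.finite
    infer_instance
  v := Sum.map S.v handleV8
  e := handleE S x
  f := handleF S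
  v_v := by
    rintro (y | k)
    · simp [S.v_v]
    · exact congrArg Sum.inr ((by decide : ∀ k, handleV8 (handleV8 k) = k) k)
  e_e := handleE_handleE S x
  f_f := by
    rintro (y | k)
    · simp [handleF, S.f_f]
    · exact congrArg Sum.inr ((by decide : ∀ k, handleF8 (handleF8 k) = k) k)
  v_ne := by
    rintro (y | k)
    · simp [S.v_ne]
    · exact fun h => (by decide : ∀ k, handleV8 k ≠ k) k (Sum.inr_injective h)
  e_ne := by
    rintro (y | k)
    · by_cases h1 : y = x
      · subst h1; rw [handleE_x]; simp
      · by_cases h2 : y = S.e x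
        · subst h2; rw [handleE_ex]; simp
        · rw [handleE_inl S x h1 h2]; simp [S.e_ne]
    · fin_cases k <;> simp [handleE]
  v_f := by
    rintro (y | k)
    · simp [handleF, S.v_f]
    · exact congrArg Sum.inr ((by decide : ∀ k, handleV8 (handleF8 k) = handleF8 (handleV8 k)) k)
  f_ne_v := by
    rintro (y | k)
    · simp [handleF, S.f_ne_v]
    · exact fun h => (by decide : ∀ k, handleF8 k ≠ handleV8 k) k (Sum.inr_injective h)
  i u := .inl (S.i u)
  i_injective := Sum.inl_injective.comp S.i_injective
  f_eq_iff := by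
    rintro (y | k)
    · simp [handleF, S.f_eq_iff]
    · simpa [handleF] using (by decide : ∀ k, handleF8 k ≠ k) k
  i_v u := congrArg Sum.inl (S.i_v u)
  o := Sum.elim S.o
    ![-S.o x, S.o x, -S.o x, S.o x, -S.o x, S.o x, -S.o x, S.o x]
  s := Sum.elim S.s 0
  o_v := by
    rintro (y | k)
    · simp [S.o_v]
    · fin_cases k <;> simp [handleV8]
  o_e := by
    rintro (y | k)
    · by_cases h1 : y = x
      · subst h1; rw [handleE_x]; simp
      · by_cases h2 : y = S.e x
        · subst h2; rw [handleE_ex]; simp [S.o_e]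
        · rw [handleE_inl S x h1 h2]; simp [S.o_e]
    · fin_cases k <;> simp [handleE, S.o_e]
  s_v := by
    rintro (y | k)
    · simp [S.s_v]
    · simp
  s_f := by
    rintro (y | k)
    · simp [handleF, S.s_f]
    · simp [handleF]
  s_eq_zero_iff := by
    rintro (y | k)
    · simpa [handleF] using S.s_eq_zero_iff y
    · fin_cases k <;> simp [handleF, handleF8]
  o_i := S.o_i
  bdry_vertex u w := ⟨fun h => (S.bdry_vertex u w).1 (around_of_handle S x h),
    fun h => around_handle S x ((S.bdry_vertex u w).2 h)⟩
  seam_plain := by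
    rintro u hu (y | k) h
    · exact S.seam_plain u hu y (around_of_handle S x h)
    · rfl
  seam_mark u w huw h := by
    obtain ⟨z, h1, h2, h3⟩ := S.seam_mark u w huw h
    exact ⟨.inl z, oneSide_handle S x h1, h2, oneSide_handle S x h3⟩
  seam_vertex := by
    rintro (y | k) (z | l) h h1 h2
    · exact oneSide_handle S x (S.seam_vertex y z (around_of_handle S x h) h1 h2)
    · exact absurd h2 (by simp)
    · exact absurd h1 (by simp)
    · exact absurd h1 (by simp)

end Handle

section Sphere

variable (S : Cob M N) (a : O)

/-- Disjoint union with a 2-sphere, made of one face with the word `c c⁻¹`, without seams.  (The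
element `a` gives the orientation of the sphere.) -/
def addSphere : Cob M N where
  X := S.X ⊕ Bool × Bool
  finite := by
    have := S.finite
    infer_instance
  v := Sum.map S.v fun p => (p.1, !p.2)
  e := Sum.map S.e fun p => (!p.1, p.2)
  f := Sum.map S.f fun p => (!p.1, p.2)
  v_v := by rintro (y | k) <;> simp [S.v_v]
  e_e := by rintro (y | k) <;> simp [S.e_e]
  f_f := by rintro (y | k) <;> simp [S.f_f]
  v_ne := by
    rintro (y | ⟨k, l⟩)
    · simp [S.v_ne]
    · simp
  e_ne := by
    rintro (y | ⟨k, l⟩)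
    · simp [S.e_ne]
    · simp
  v_f := by rintro (y | k) <;> simp [S.v_f]
  f_ne_v := by
    rintro (y | ⟨k, l⟩)
    · simp [S.f_ne_v]
    · simp
  i u := .inl (S.i u)
  i_injective := Sum.inl_injective.comp S.i_injective
  f_eq_iff := by
    rintro (y | ⟨k, l⟩)
    · simp [S.f_eq_iff]
    · simp
  i_v u := congrArg Sum.inl (S.i_v u)
  o := Sum.elim S.o fun p => if p.1 = p.2 then a else -a
  s := Sum.elim S.s 0
  o_v := by
    rintro (y | ⟨k, l⟩)
    · simp [S.o_v]
    · cases k <;> cases l <;> simp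
  o_e := by
    rintro (y | ⟨k, l⟩)
    · simp [S.o_e]
    · cases k <;> cases l <;> simp
  s_v := by rintro (y | k) <;> simp [S.s_v]
  s_f := by rintro (y | k) <;> simp [S.s_f]
  s_eq_zero_iff := by
    rintro (y | ⟨k, l⟩)
    · simpa using S.s_eq_zero_iff y
    · cases k <;> cases l <;> simp
  o_i := S.o_i
  bdry_vertex u w := by
    refine ⟨fun h => (S.bdry_vertex u w).1 ?_, fun h => ?_⟩
    · refine (h.closed (P := Sum.elim (Around S.e S.f (S.i u)) fun _ => False) ?_ ?_ ?_ ?_).1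
        (.refl _)
      · rintro (y | k) <;> simp [S.e_e]
      · rintro (y | k) <;> simp [S.f_f]
      · rintro (y | k) h
        · exact .trans _ _ _ h (.rel _ _ (.inl rfl))
        · exact h
      · rintro (y | k) h
        · exact .trans _ _ _ h (.rel _ _ (.inr rfl))
        · exact h
    · exact ((S.bdry_vertex u w).2 h).map Sum.inl (fun _ => .rel _ _ (.inl rfl))
        fun _ => .rel _ _ (.inr rfl)
  seam_plain := by
    rintro u hu (y | k) h
    · refine S.seam_plain u hu y ?_
      refine (h.closed (P := Sum.elim (Around S.e S.f (S.i u)) fun _ => False) ?_ ?_ ?_ ?_).1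
        (.refl _)
      · rintro (y | k) <;> simp [S.e_e]
      · rintro (y | k) <;> simp [S.f_f]
      · rintro (y | k) h
        · exact .trans _ _ _ h (.rel _ _ (.inl rfl))
        · exact h
      · rintro (y | k) h
        · exact .trans _ _ _ h (.rel _ _ (.inr rfl))
        · exact h
    · rfl
  seam_mark u w huw h := by
    obtain ⟨z, h1, h2, h3⟩ := S.seam_mark u w huw h
    exact ⟨.inl z, h1.map Sum.inl (fun _ => .rel _ _ (.inl rfl)) fun _ h => .rel _ _ (.inr ⟨h, rfl⟩), h2,
      h3.map Sum.inl (fun _ => .rel _ _ (.inl rfl)) fun _ h => .rel _ _ (.inr ⟨h, rfl⟩)⟩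
  seam_vertex := by
    rintro (y | k) (z | l) h h1 h2
    · have h : Around S.e S.f y z := by
        refine (h.closed (P := Sum.elim (Around S.e S.f y) fun _ => False) ?_ ?_ ?_ ?_).1
          (.refl _)
        · rintro (y | k) <;> simp [S.e_e]
        · rintro (y | k) <;> simp [S.f_f]
        · rintro (y | k) h
          · exact .trans _ _ _ h (.rel _ _ (.inl rfl))
          · exact h
        · rintro (y | k) h
          · exact .trans _ _ _ h (.rel _ _ (.inr rfl))
          · exact h
      exact (S.seam_vertex y z h h1 h2).map Sum.inl (fun _ => .rel _ _ (.inl rfl))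
        fun _ h => .rel _ _ (.inr ⟨h, rfl⟩)
    · exact absurd h2 (by simp)
    · exact absurd h1 (by simp)
    · exact absurd h1 (by simp)

end Sphere

section Moves

/-- Move along `g` until the first flag outside `D` is reached. -/
inductive SkipTo {X : Type} (D : Set X) (g : X → X) : X → X → Prop
  | here {x : X} (h : x ∉ D) : SkipTo D g x x
  | next {x y : X} (h : x ∈ D) (h' : SkipTo D g (g x) y) : SkipTo D g x y

variable (S T : Cob M N)

/-- Two flags of a surface have the same face. -/
def SameFace : S.X → S.X → Prop := Relation.EqvGen fun x y => y = S.v x ∨ y = S.e x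

/-- An isomorphism of cell decompositions, relative to the boundary. -/
structure IsIso (φ : S.X ≃ T.X) : Prop where
  v : ∀ y, φ (S.v y) = T.v (φ y)
  e : ∀ y, φ (S.e y) = T.e (φ y)
  f : ∀ y, φ (S.f y) = T.f (φ y)
  i : ∀ u, φ (S.i u) = T.i u
  o : ∀ y, T.o (φ y) = S.o y
  s : ∀ y, T.s (φ y) = S.s y

/-- `T` is obtained from `S` by deleting the edge of `x`, an interior edge that is not part of a
seam; `j` is the inclusion of the remaining flags.  In the cyclic words of the faces this does the
following.  Two different faces `α c` and `c⁻¹ β` become one face `α β`, the same surface.  One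
face `α c β c⁻¹`, an annulus cut open along `c`, becomes the two discs `α` and `β`, so that the
surface is cut along the core of the annulus and the two holes are capped off. -/
structure DeletesEdge (x : S.X) (j : T.X → S.X) : Prop where
  interior : S.f x ≠ x
  no_seam : S.s x = 0
  injective : Function.Injective j
  range : Set.range j = ({x, S.v x, S.f x, S.v (S.f x)} : Set S.X)ᶜ
  v : ∀ y, j (T.v y) = S.v (j y)
  f : ∀ y, j (T.f y) = S.f (j y)
  e : ∀ y, SkipTo {x, S.v x, S.f x, S.v (S.f x)} (fun z => S.e (S.f z)) (S.e (j y)) (j (T.e y))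
  i : ∀ u, j (T.i u) = S.i u
  o : ∀ y, T.o y = S.o (j y)
  s : ∀ y, T.s y = S.s (j y)

/-- `T` is obtained from `S` by deleting the vertex of `x`, an interior vertex of valence two, so
that the two edges at this vertex become one edge; `j` is the inclusion of the remaining flags.
(The two edges at the vertex are different.) -/
structure DeletesVertex (x : S.X) (j : T.X → S.X) : Prop where
  interior : S.f x ≠ x
  e_ne_f : S.e x ≠ S.f x
  valence_two : S.e (S.f x) = S.f (S.e x)
  v_notMem : S.v x ∉ ({x, S.e x, S.f x, S.e (S.f x)} : Set S.X)
  injective : Function.Injective j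
  range : Set.range j = ({x, S.e x, S.f x, S.e (S.f x)} : Set S.X)ᶜ
  e : ∀ y, j (T.e y) = S.e (j y)
  f : ∀ y, j (T.f y) = S.f (j y)
  v : ∀ y, SkipTo {x, S.e x, S.f x, S.e (S.f x)} (fun z => S.v (S.e z)) (S.v (j y)) (j (T.v y))
  i : ∀ u, j (T.i u) = S.i u
  o : ∀ y, T.o y = S.o (j y)
  s : ∀ y, T.s y = S.s (j y)

/-- `S` and `T` are two disorientations of the same surface with the same cell decomposition.
They have opposite orientations on the face of `x` and the same orientations elsewhere, and seams
and fringes can differ at the sides of this face only. -/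
structure FlipsFace (x : S.X) (φ : S.X ≃ T.X) : Prop where
  v : ∀ y, φ (S.v y) = T.v (φ y)
  e : ∀ y, φ (S.e y) = T.e (φ y)
  f : ∀ y, φ (S.f y) = T.f (φ y)
  i : ∀ u, φ (S.i u) = T.i u
  o_face : ∀ y, SameFace S x y → T.o (φ y) = -S.o y
  o : ∀ y, ¬SameFace S x y → T.o (φ y) = S.o y
  s : ∀ y, ¬SameFace S x y → ¬SameFace S x (S.f y) → T.s (φ y) = S.s y

/-- The Euler characteristic. -/
noncomputable def eulerChar : ℤ :=
  (Nat.card (Quot fun x y => y = S.e x ∨ y = S.f x) : ℤ)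
    - Nat.card (Quot fun x y => y = S.v x ∨ y = S.f x)
    + Nat.card (Quot fun x y => y = S.v x ∨ y = S.e x)

end Moves

/-- The identity cobordism of `M` with a handle attached, next to the boundary point `b`, to the
sheet that contains `b`. -/
noncomputable def handleAt (M : Curve O B) (b : B) : Cob M M :=
  (id M).addHandle (.inl (M.pt b, false))

end Cob

/-! ### The cobordism category -/

/-- A 1-manifold with a formal grading shift: `q ^ shift` times `curve`. -/
structure Obj (O : Type) [InvolutiveNeg O] (B : Type) where
  curve : Curve O B
  shift : ℤ

instance : Quiver (Obj O B) where
  Hom P Q := Cob P.curve Q.curve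

/-- The degree of a cobordism between 1-manifolds with grading shifts. -/
noncomputable def deg {P Q : Obj O B} (S : P ⟶ Q) : ℤ :=
  Cob.eulerChar S - (Nat.card B : ℤ) / 2 + Q.shift - P.shift

section Category

universe u

variable (k : Type u) [CommRing k]

/-- Formal `k`-linear combinations of formal composites of cobordisms. -/
abbrev Pre (O : Type) [InvolutiveNeg O] (B : Type) := Free k (Paths (Obj O B))

/-- A cobordism as a formal linear combination. -/
noncomputable def gen {P Q : Obj O B} (S : P ⟶ Q) :
    (Free.embedding k (Paths (Obj O B))).obj ((Paths.of (Obj O B)).obj P) ⟶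
      (Free.embedding k (Paths (Obj O B))).obj ((Paths.of (Obj O B)).obj Q) :=
  (Free.embedding k (Paths (Obj O B))).map ((Paths.of (Obj O B)).map S)

variable [Invertible (2 : k)] (ω : kˣ)

/-- The defining relations of the category of abstract cobordisms. -/
inductive Basic : HomRel (Pre k O B)
  /-- the product `M × [0, 1]` is the identity -/
  | id (P : Obj O B) : Basic (gen k (P := P) (Q := P) (Cob.id P.curve)) (𝟙 _)
  /-- composition is gluing -/
  | glue {P Q R : Obj O B} (S : P ⟶ Q) (T : Q ⟶ R) :
    Basic (gen k S ≫ gen k T) (gen k (P := P) (Q := R) (Cob.glue S T))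
  /-- homeomorphic surfaces are equal: isomorphic cell decompositions -/
  | iso {P Q : Obj O B} (S T : P ⟶ Q) (φ) (h : Cob.IsIso S T φ) : Basic (gen k S) (gen k T)
  /-- homeomorphic surfaces are equal: subdivision of a face by an edge -/
  | edge {P Q : Obj O B} (S T : P ⟶ Q) (x j) (h : Cob.DeletesEdge S T x j)
    (hx : ¬Cob.SameFace S x (Cob.f S x)) (hx' : Cob.e S x ≠ Cob.v S x) :
    Basic (gen k S) (gen k T)
  /-- homeomorphic surfaces are equal: subdivision of an edge by a vertex -/
  | vertex {P Q : Obj O B} (S T : P ⟶ Q) (x j) (h : Cob.DeletesVertex S T x j) :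
    Basic (gen k S) (gen k T)
  /-- a sphere is `0` -/
  | sphere {P Q : Obj O B} (S : P ⟶ Q) (a : O) :
    Basic (gen k (P := P) (Q := Q) (Cob.addSphere S a)) 0
  /-- a torus is `2` -/
  | torus {P Q : Obj O B} (S : P ⟶ Q) (a : O) :
    Basic (gen k (P := P) (Q := Q)
      (Cob.addHandle (Cob.addSphere S a) (.inr (false, false)))) ((2 : k) • gen k S)
  /-- neck cutting: the face of `x` has the word `α c β c⁻¹`, where `c` is the edge of `x`; here
  `α` and `β` are not empty, as `y` is a flag of `α` and `z` is a flag of `β` -/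
  | neck {P Q : Obj O B} (S T : P ⟶ Q) (x j) (h : Cob.DeletesEdge S T x j)
    (hx : ∃ n : ℕ, (fun w => Cob.v S (Cob.e S w))^[n] (Cob.v S x) = Cob.f S x)
    (y z) (hy : j y = Cob.e S x) (hz : j z = Cob.e S (Cob.v S x)) :
    Basic (gen k S) (⅟(2 : k) • (gen k (P := P) (Q := Q) (Cob.addHandle T y)
      + gen k (P := P) (Q := Q) (Cob.addHandle T z)))
  /-- a circular seam that bounds a disc, with its fringe pointing inward, is `ω` -/
  | inward {P Q : Obj O B} (S T : P ⟶ Q) (x φ) (h : Cob.FlipsFace S T x φ)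
    (hs : ∀ y, Cob.SameFace S x y → Cob.s S y = -1 ∧ Cob.s T (φ y) = 0) :
    Basic (gen k S) ((ω : k) • gen k T)
  /-- a circular seam that bounds a disc, with its fringe pointing outward, is `ω⁻¹` -/
  | outward {P Q : Obj O B} (S T : P ⟶ Q) (x φ) (h : Cob.FlipsFace S T x φ)
    (hs : ∀ y, Cob.SameFace S x y → Cob.s S y = 1 ∧ Cob.s T (φ y) = 0) :
    Basic (gen k S) (((ω⁻¹ : kˣ) : k) • gen k T)
  /-- two parallel seams whose fringes point towards each other are `ω⁻¹` times the two seams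
  obtained by the other reconnection, whose fringes point away from each other; the face of `x` is
  the quadrilateral between the four strands -/
  | saddle {P Q : Obj O B} (S T : P ⟶ Q) (x φ) (h : Cob.FlipsFace S T x φ)
    (hx : (fun w => Cob.v S (Cob.e S w))^[4] x = x)
    (hx' : (fun w => Cob.v S (Cob.e S w))^[2] x ≠ x)
    (hs : ∀ y, Cob.SameFace S x y →
      (Cob.s S y = -1 ∧ Cob.s S (Cob.e S y) = 0 ∧ Cob.s T (φ y) = 0) ∨
      (Cob.s S y = 0 ∧ Cob.s S (Cob.e S y) = -1 ∧ Cob.s T (φ y) = 1)) :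
    Basic (gen k S) (((ω⁻¹ : kˣ) : k) • gen k T)

/-- The `k`-linear congruence generated by the defining relations. -/
inductive Rel : HomRel (Pre k O B)
  | basic {P Q : Pre k O B} {a b : P ⟶ Q} (h : Basic k ω a b) : Rel a b
  | refl {P Q : Pre k O B} (a : P ⟶ Q) : Rel a a
  | symm {P Q : Pre k O B} {a b : P ⟶ Q} (h : Rel a b) : Rel b a
  | trans {P Q : Pre k O B} {a b c : P ⟶ Q} (h : Rel a b) (h' : Rel b c) : Rel a c
  | add {P Q : Pre k O B} {a b a' b' : P ⟶ Q} (h : Rel a b) (h' : Rel a' b') :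
    Rel (a + a') (b + b')
  | smul (r : k) {P Q : Pre k O B} {a b : P ⟶ Q} (h : Rel a b) : Rel (r • a) (r • b)
  | comp_left {P Q R : Pre k O B} (c : P ⟶ Q) {a b : Q ⟶ R} (h : Rel a b) :
    Rel (c ≫ a) (c ≫ b)
  | comp_right {P Q R : Pre k O B} {a b : P ⟶ Q} (c : Q ⟶ R) (h : Rel a b) :
    Rel (a ≫ c) (b ≫ c)

instance : Congruence (Rel k ω : HomRel (Pre k O B)) where
  comp_left c _ _ h := .comp_left c h
  comp_right c h := .comp_right c h
  equivalence := ⟨.refl, .symm, .trans⟩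

/-- The category of abstract cobordisms: disoriented ones for `O = ℤˣ`, unoriented ones for
`O = Unit`.  Objects are 1-manifolds with boundary points `B` (with a formal grading shift),
morphisms are linear combinations of cobordisms, modulo the relations.  The crossingless tangle
diagrams with boundary points `B` form a full subcategory, as the morphisms between them do not
depend on the embedding in the disc. -/
abbrev CobCat (O : Type) [InvolutiveNeg O] (B : Type) :=
  CategoryTheory.Quotient (Rel k ω : HomRel (Pre k O B))

noncomputable instance : Preadditive (CobCat k ω O B) :=
  CategoryTheory.Quotient.preadditive _ fun _ _ _ _ _ _ h h' => .add h h'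

instance : (CategoryTheory.Quotient.functor (Rel k ω : HomRel (Pre k O B))).Additive :=
  CategoryTheory.Quotient.functor_additive _ fun _ _ _ _ _ _ h h' => .add h h'

noncomputable instance : Linear k (CobCat k ω O B) :=
  CategoryTheory.Quotient.linear k _ fun r _ _ _ _ h => .smul r h

/-- A 1-manifold with a grading shift as an object of the cobordism category. -/
def CobCat.obj (P : Obj O B) : CobCat k ω O B := ⟨P⟩

/-- The morphism given by a cobordism. -/
noncomputable def CobCat.hom {P Q : Obj O B} (S : Cob P.curve Q.curve) :
    CobCat.obj k ω P ⟶ CobCat.obj k ω Q :=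
  (CategoryTheory.Quotient.functor _).map (gen k (P := P) (Q := Q) S)

/-- The morphisms of degree `d`. -/
noncomputable def CobCat.homogeneous (d : ℤ) (P Q : CobCat k ω O B) : Submodule k (P ⟶ Q) :=
  Submodule.span k {a | ∃ S : Quiver.Hom (V := Obj O B) P.as Q.as, deg S = d ∧
    a = CobCat.hom k ω (P := P.as) (Q := Q.as) S}

variable {k ω}

/-- A matrix of morphisms of degree `d`. -/
def IsHomogeneous (d : ℤ) {P Q : Mat_ (CobCat k ω O B)} (a : P ⟶ Q) : Prop :=
  ∀ i j, a i j ∈ CobCat.homogeneous k ω d (P.X i) (Q.X j)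

variable (k ω)

/-- The complex `q M ⟶ q² N`, in heights `0` and `1`, with a given cobordism as differential. -/
noncomputable def twoTerm {M N : Curve O B} (d : Cob M N) : CochainComplex (Mat_ (CobCat k ω O B)) ℤ :=
  HomologicalComplex.double (c := ComplexShape.up ℤ) (i₀ := 0) (i₁ := 1)
    ((Mat_.embedding (CobCat k ω O B)).map (CobCat.hom k ω (P := ⟨M, 1⟩) (Q := ⟨N, 2⟩) d)) rfl

variable {k ω}

/-- `F` is the map induced by attaching a handle to the sheet at the boundary point `b`: in each
height it is the identity cobordism with such a handle. -/
def IsHandleMap {M N : Curve O B} {d : Cob M N} (b : B) (F : twoTerm k ω d ⟶ twoTerm k ω d) :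
    Prop :=
  F.f 0 = (HomologicalComplex.doubleXIso₀ _ _).hom ≫
    (Mat_.embedding (CobCat k ω O B)).map (CobCat.hom k ω (P := ⟨M, 1⟩) (Q := ⟨M, 1⟩) (Cob.handleAt M b)) ≫
    (HomologicalComplex.doubleXIso₀ _ _).inv ∧
  F.f 1 = (HomologicalComplex.doubleXIso₁ _ _ zero_ne_one).hom ≫
    (Mat_.embedding (CobCat k ω O B)).map (CobCat.hom k ω (P := ⟨N, 2⟩) (Q := ⟨N, 2⟩) (Cob.handleAt N b)) ≫
    (HomologicalComplex.doubleXIso₁ _ _ zero_ne_one).inv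

end Category

/-! ### Forgetting disorientations -/

/-- The underlying unoriented 1-manifold. -/
def Curve.forget (M : Curve O B) : Curve Unit B where
  X := M.X
  finite := M.finite
  v := M.v
  e := M.e
  v_v := M.v_v
  v_ne := M.v_ne
  e_e := M.e_e
  pt := M.pt
  pt_injective := M.pt_injective
  e_eq_iff := M.e_eq_iff
  o _ := ()
  s _ := 0
  o_v _ := rfl
  s_e _ := rfl
  s_eq_zero_iff _ _ := by simp

theorem Meets.forget_iff {M N : Curve O B} {u w : M.X ⊕ N.X} :
    Meets M.forget N.forget u w ↔ Meets M N u w := by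
  rcases u with u | u <;> rcases w with w | w
  · exact (Meets.iff (M := M.forget) (N := N.forget) (u := .inl u) (w := .inl w)).trans
      (Meets.iff (M := M) (N := N) (u := .inl u) (w := .inl w)).symm
  · exact (Meets.iff (M := M.forget) (N := N.forget) (u := .inl u) (w := .inr w)).trans
      (Meets.iff (M := M) (N := N) (u := .inl u) (w := .inr w)).symm
  · exact (Meets.iff (M := M.forget) (N := N.forget) (u := .inr u) (w := .inl w)).trans
      (Meets.iff (M := M) (N := N) (u := .inr u) (w := .inl w)).symm
  · exact (Meets.iff (M := M.forget) (N := N.forget) (u := .inr u) (w := .inr w)).trans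
      (Meets.iff (M := M) (N := N) (u := .inr u) (w := .inr w)).symm

/-- The underlying unoriented cobordism. -/
def Cob.forget {M N : Curve O B} (S : Cob M N) : Cob M.forget N.forget where
  X := S.X
  finite := S.finite
  v := S.v
  e := S.e
  f := S.f
  v_v := S.v_v
  e_e := S.e_e
  f_f := S.f_f
  v_ne := S.v_ne
  e_ne := S.e_ne
  v_f := S.v_f
  f_ne_v := S.f_ne_v
  i := S.i
  i_injective := S.i_injective
  f_eq_iff := S.f_eq_iff
  i_v := S.i_v
  o _ := ()
  s _ := 0
  o_v _ := rfl
  o_e _ := rfl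
  s_v _ := rfl
  s_f _ := rfl
  s_eq_zero_iff _ _ := by simp
  o_i _ := rfl
  bdry_vertex u w := (S.bdry_vertex u w).trans (or_congr Iff.rfl Meets.forget_iff.symm)
  seam_plain _ _ _ _ := rfl
  seam_mark u _ _ h := by rcases u with u | u <;> exact absurd h (by simp [Curve.forget])
  seam_vertex _ _ _ h := absurd h (by simp)

/-! ### The positive crossing -/

/-- The four boundary points of a crossing whose strands run upwards; the components tell whether
the point is at the top, and whether it is on the right.  At a positive crossing the over-strand
runs from the bottom left to the top right. -/
abbrev Corner := Bool × Bool

/-- the beginning of the over-strand, on the left of the crossing -/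
def bottomLeft : Corner := (false, false)

/-- the end of the over-strand, on the right of the crossing -/
def topRight : Corner := (true, true)

/-- The oriented smoothing: two vertical strands, oriented upwards. -/
def orientedSmoothing : Curve ℤˣ Corner where
  X := Corner
  finite := inferInstance
  v c := (!c.1, c.2)
  e c := c
  v_v := by decide
  v_ne := by decide
  e_e := by decide
  pt c := c
  pt_injective _ _ h := h
  e_eq_iff := by decide
  o c := if c.1 then -1 else 1
  s _ := 0
  o_v := by decide
  s_e := by decide
  s_eq_zero_iff := by decide

/-- The disoriented smoothing: an arc at the bottom oriented from its two ends towards a mark in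
its middle, and an arc at the top oriented from a mark in its middle to its two ends; the normal
directions of both marks point to the right.  The flag `(c, true)` is the one at the end `c` of an
arc, `(c, false)` is the flag of the same edge at the mark. -/
def disorientedSmoothing : Curve ℤˣ Corner where
  X := Corner × Bool
  finite := inferInstance
  v x := (x.1, !x.2)
  e x := if x.2 then x else ((x.1.1, !x.1.2), false)
  v_v := by decide
  v_ne := by decide
  e_e := by decide
  pt c := (c, true)
  pt_injective _ _ h := congrArg Prod.fst h
  e_eq_iff := by decide
  o x := if x.1.1 = x.2 then -1 else 1
  s x := if x.2 then 0 else if x.1.2 then -1 else 1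
  o_v := by decide
  s_e := by decide
  s_eq_zero_iff := by decide

/-- Exchange of edges in the saddle. -/
def saddleE (x : Corner × Fin 4) : Corner × Fin 4 := (x.1, ![1, 0, 3, 2] x.2)

/-- Exchange of faces in the saddle. -/
def saddleF (x : Corner × Fin 4) : Corner × Fin 4 :=
  (if x.2 = 3 then (x.1.1, !x.1.2) else x.1, x.2)

theorem saddle_vertex {x y : Corner × Fin 4} (h : Around saddleE saddleF x y) :
    x.1.1 = y.1.1 ∧ (x.2 ≤ 1 ↔ y.2 ≤ 1) ∧ (x.2 ≤ 1 → x.1 = y.1) := by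
  refine (h.closed (P := fun y => x.1.1 = y.1.1 ∧ (x.2 ≤ 1 ↔ y.2 ≤ 1) ∧ (x.2 ≤ 1 → x.1 = y.1))
    (by decide) (by decide) ?_ ?_).1 (by simp)
  all_goals
    clear h
    revert x
    decide

/-- The saddle from the oriented to the disoriented smoothing: a disc, divided by a seam from mark
to mark into a left and a right quadrilateral; the fringe points to the right.  Near each corner
`c` there are the flags `(c, 0)` on the source, `(c, 1)` and `(c, 2)` on the target, and `(c, 3)`
on the seam. -/
def saddle : Cob orientedSmoothing disorientedSmoothing where
  X := Corner × Fin 4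
  finite := inferInstance
  v x := (if x.2 = 0 ∨ x.2 = 3 then (!x.1.1, x.1.2) else x.1, ![0, 2, 1, 3] x.2)
  e := saddleE
  f := saddleF
  v_v := by decide
  e_e := by decide
  f_f := by decide
  v_ne := by decide
  e_ne := by decide
  v_f := by decide
  f_ne_v := by decide
  i := Sum.elim (fun c => (c, 0)) (fun x => (x.1, if x.2 then 1 else 2))
  i_injective := by
    rintro (⟨_ | _, _ | _⟩ | ⟨⟨_ | _, _ | _⟩, _ | _⟩) (⟨_ | _, _ | _⟩ | ⟨⟨_ | _, _ | _⟩, _ | _⟩) h <;>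
      first | rfl | exact absurd h (by decide)
  f_eq_iff := by
    have h1 : ∀ x : Corner × Fin 4,
        saddleF x = x ↔ x.2 ≠ 3 := by decide
    intro x
    rw [h1]
    obtain ⟨c, n⟩ := x
    constructor
    · intro h
      fin_cases n
      · exact ⟨.inl c, rfl⟩
      · exact ⟨.inr (c, true), rfl⟩
      · exact ⟨.inr (c, false), rfl⟩
      · exact absurd rfl h
    · rintro ⟨(u | ⟨u, _ | _⟩), hu⟩ h
      · exact absurd ((congrArg Prod.snd hu).trans h) (by decide : (0 : Fin 4) ≠ 3)
      · exact absurd ((congrArg Prod.snd hu).trans h) (by decide : (2 : Fin 4) ≠ 3)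
      · exact absurd ((congrArg Prod.snd hu).trans h) (by decide : (1 : Fin 4) ≠ 3)
  i_v := by rintro (c | ⟨c, _ | _⟩) <;> rfl
  o x := if x.1.1 = decide (x.2 = 1 ∨ x.2 = 3) then -1 else 1
  s x := if x.2 = 3 then (if x.1.2 then -1 else 1) else 0
  o_v := by decide
  o_e := by decide
  s_v := by decide
  s_f := by decide
  s_eq_zero_iff := by decide
  o_i := by rintro (⟨_ | _, _ | _⟩ | ⟨⟨_ | _, _ | _⟩, _ | _⟩) <;> decide
  bdry_vertex u w := by
    constructor
    · intro h
      have h := saddle_vertex h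
      rcases u with ⟨_ | _, _ | _⟩ | ⟨⟨_ | _, _ | _⟩, _ | _⟩ <;>
        rcases w with ⟨_ | _, _ | _⟩ | ⟨⟨_ | _, _ | _⟩, _ | _⟩ <;>
        first
          | exact absurd h (by decide)
          | exact .inl rfl
          | exact .inr (.st _)
          | exact .inr (.ts _)
          | exact .inr (.tgt _ (fun h => absurd (congrArg (fun x => x.1.2) h) (by decide)))
    · intro h
      have h1 : ∀ c : Corner, Around saddleE saddleF (c, 0) (c, 1) := fun c => .rel _ _ (.inl rfl)
      have h2 : ∀ c : Corner, Around saddleE saddleF (c, 2) ((c.1, !c.2), 2) := fun c =>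
        .trans _ _ _ (.rel _ _ (.inl rfl)) (.trans _ _ _ (.rel _ _ (.inr rfl)) (.rel _ _ (.inl rfl)))
      rcases h with rfl | h
      · exact .refl _
      · cases h with
        | src m h => exact absurd rfl h
        | tgt n h =>
          obtain ⟨c, _ | _⟩ := n
          · exact h2 c
          · exact absurd rfl h
        | st b => exact h1 b
        | ts b => exact .symm _ _ (h1 b)
  seam_plain u hu x hx := by
    have h := saddle_vertex hx
    clear hx
    revert hu h
    revert x
    rcases u with ⟨_ | _, _ | _⟩ | ⟨⟨_ | _, _ | _⟩, _ | _⟩ <;> decide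
  seam_mark u w huw hu := by
    cases huw with
    | src m h => exact absurd rfl h
    | tgt n h =>
      obtain ⟨⟨t, _ | _⟩, _ | _⟩ := n
      · exact ⟨((t, false), 3), .rel _ _ (.inl rfl), rfl, .rel _ _ (.inl rfl)⟩
      · exact absurd rfl h
      · exact absurd hu (by decide : (-1 : SignType) ≠ 1)
      · exact absurd rfl h
    | st b => exact absurd hu (by decide : (0 : SignType) ≠ 1)
    | ts b => exact absurd hu (by decide : (0 : SignType) ≠ 1)
  seam_vertex x y hxy hx hy := by
    have h := saddle_vertex hxy
    have : x = y := by
      clear hxy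
      revert x y
      decide
    rw [this]
    exact .refl _

end Disor

/-! The homotopies are multiples of the reversed saddle `s : q² N ⟶ q M`, a disc of degree `-2`. It
has to be shown that `d ≫ s` and `s ≫ d` are multiples of `F - G` (disoriented) or `F + G`
(unoriented) in the two heights. Both composites are annuli, so neck cutting applies.

In the unoriented theory, cutting the neck leaves the identity with a handle on one or the other
component. Hence both composites are `½ (F + G)`, and `2 s` is a homotopy from `F` to `-G`.

In the disoriented theory, `d ≫ s` has a circular seam around the neck. After a cut to the right of
the seam, the seam bounds a disc in the left strip, and the handle lies on the right strip or in
this disc. A handle moves across a seam at the cost of `ω²`: a tube both of whose ends straddle the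
seam belongs to one side of it, and after two reconnections of seams to the other side
(`hom_disc_handle`, `hom_idDisoriented_handle`). Removing the seam costs `ω`. For `ω² = -1` the sum
is `½ ω (F - G)`. In `s ≫ d`, one reconnection makes the seams run from source to target, the cut
leaves handles at the right ends of the two arcs, and moving one of them across the lower seam gives
`½ ω (F - G)` again (`hom_saddle_comp_coSaddle`, `hom_coSaddle_comp_saddle`). So `2 ω⁻¹ s` is a
homotopy from `F` to `G`.

These identities are checked by evaluation. Cell decompositions are coded by numbers. A Boolean test
guarantees that a code is a surface, or that an elementary move is an instance of a defining
relation; the soundness lemmas turn tests into equations of morphisms, with the exponent of `ω`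
recorded.

To exclude `F ≃ G` in the unoriented theory, a functor to modules over `k` is built with scalars `K
= k[i]`. The connected components of curves and surfaces are coloured by `true` and `false`, with
fixed colours at the boundary points, and a surface is evaluated to the sum over its colourings of
the product of `w(colour) ^ χ` over the components, where `w true = i` and `w false = 1`. A sphere
is then `i² + 1 = 0`, a torus is `2`, and a handle multiplies by `w⁻²`, which is `-1` or `1`; so the
mean of the two handles in neck cutting vanishes unless the colours agree. Let the boundary points
on the left be `false` and those on the right `true`. The vertical strands can be coloured, but the
horizontal arcs cannot, so the module of `N` is zero. A homotopy would make `F - G` in height `0`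
factor through `N`, while it acts on the nonzero module of `M` as `-2` (`handleAt_sub_handleAt_ne`).
-/

set_option linter.unusedSectionVars false
namespace Disor

/-! ### Surfaces coded by numbers -/

section Walks

/-- A bounded universal quantifier. -/
def allBelow (n : ℕ) (p : ℕ → Bool) : Bool :=
  Nat.rec true (fun i b => p i && b) n

theorem allBelow_iff {n : ℕ} {p : ℕ → Bool} : allBelow n p = true ↔ ∀ x < n, p x = true := by
  induction n with
  | zero => simp [allBelow]
  | succ n ih =>
    have : allBelow (n + 1) p = (p n && allBelow n p) := rfl
    rw [this, Bool.and_eq_true, ih]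
    constructor
    · rintro ⟨h1, h2⟩ x hx
      rcases Nat.lt_succ_iff_lt_or_eq.1 hx with h | rfl
      · exact h2 x h
      · exact h1
    · exact fun h => ⟨h n n.lt_succ_self, fun x hx => h x (hx.trans n.lt_succ_self)⟩

/-- Membership in a list of numbers. -/
def isIn (L : List ℕ) (x : ℕ) : Bool := L.any (Nat.beq x)

theorem isIn_iff {L : List ℕ} {x : ℕ} : isIn L x = true ↔ x ∈ L := by
  simp [isIn]

/-- The sequence `y, a y, b (a y), a (b (a y)), …`, which ends before an application of `b` to a
number `z` with `halt z`. -/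
def walk (a b : ℕ → ℕ) (halt : ℕ → Bool) : ℕ → ℕ → List ℕ
  | 0, _ => []
  | n + 1, y => y :: a y :: if halt (a y) then [] else walk a b halt n (b (a y))

/-- Both kinds of steps stay within `R`, so everything on a walk is related to its start. In the
applications `P` means being a flag, and `R` is `Around`, `OneSide` or `SameFace`. That a walk lists
a whole orbit is never proved in general; the tests check closure of the list instead. -/
theorem walk_mem {a b : ℕ → ℕ} {halt : ℕ → Bool} {R : ℕ → ℕ → Prop} (P : ℕ → Prop)
    (hrefl : ∀ x, P x → R x x) (htrans : ∀ x y z, R x y → R y z → R x z)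
    (ha : ∀ x, P x → P (a x) ∧ R x (a x))
    (hb : ∀ x, P x → halt x = false → P (b x) ∧ R x (b x)) (n x : ℕ) (hx : P x) :
    ∀ y ∈ walk a b halt n x, R x y := by
  induction n generalizing x with
  | zero => simp [walk]
  | succ n ih =>
    intro y hy
    simp only [walk, List.mem_cons] at hy
    have h1 := ha x hx
    rcases hy with rfl | rfl | hy
    · exact hrefl _ hx
    · exact h1.2
    · split at hy
      · simp at hy
      · rename_i h
        have h2 := hb _ h1.1 (by simpa using h)
        exact htrans _ _ _ h1.2 (htrans _ _ _ h2.2 (ih _ h2.1 y hy))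

end Walks

/-! ### Codes of surfaces and the tests of their validity -/

section Codes

/-- The `x`-th digit of `t` in base 256. -/
def digit (t x : ℕ) : ℕ := (t >>> (8 * x)) % 256

/-- The number whose first `n` digits are the values of `g`. -/
def tabulate (n : ℕ) (g : ℕ → ℕ) : ℕ :=
  Nat.rec 0 (fun x t => t + g x <<< (8 * x)) n

/-- Decoding of orientations. -/
class OrientationCode (O : Type) where
  decode : ℕ → O

/-- The digit 1 stands for `-1` and the digit 0 for `1`; hence the opposite orientation of a digit
`d` is coded by `1 - d`. -/
instance : OrientationCode ℤˣ := ⟨fun n => if n = 1 then -1 else 1⟩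

instance : OrientationCode Unit := ⟨fun _ => ()⟩

/-- Decoding of fringes. -/
def fringe (n : ℕ) : SignType := if n = 0 then 0 else if n = 1 then 1 else -1

variable {O : Type} [InvolutiveNeg O] {B : Type}

/-- A curve with a list of its flags. -/
class Curve.Listed (M : Curve O B) where
  elems : List M.X
  mem_elems : ∀ x, x ∈ elems
  decEq : DecidableEq M.X
  label : M.X → B
  pt_label : ∀ x, M.e x = x → M.pt (label x) = x

instance (M : Curve O B) [M.Listed] : DecidableEq M.X := Curve.Listed.decEq

instance (M : Curve O B) [h : M.Listed] : M.forget.Listed where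
  elems := h.elems
  mem_elems := h.mem_elems
  decEq := h.decEq
  label := h.label
  pt_label := h.pt_label

instance : orientedSmoothing.Listed where
  elems := [(false, false), (false, true), (true, false), (true, true)]
  mem_elems := (by decide : ∀ x : Corner,
    x ∈ [(false, false), (false, true), (true, false), (true, true)])
  decEq := inferInstanceAs (DecidableEq Corner)
  label c := c
  pt_label _ _ := rfl

instance : disorientedSmoothing.Listed where
  elems := [((false, false), false), ((false, false), true), ((false, true), false),
    ((false, true), true), ((true, false), false), ((true, false), true), ((true, true), false),
    ((true, true), true)]
  mem_elems := (by decide : ∀ x : Corner × Bool,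
    x ∈ [((false, false), false), ((false, false), true), ((false, true), false),
      ((false, true), true), ((true, false), false), ((true, false), true),
      ((true, true), false), ((true, true), true)])
  decEq := inferInstanceAs (DecidableEq (Corner × Bool))
  label x := x.1
  pt_label := (by decide : ∀ x : Corner × Bool,
    (if x.2 then x else ((x.1.1, !x.1.2), false)) = x → (x.1, true) = x)

variable (M N : Curve O B) [M.Listed] [N.Listed]

/-- The other half-edge at the same vertex of the closed 1-manifold made of `M` and `N`. -/
def meet : M.X ⊕ N.X → M.X ⊕ N.X
  | .inl m => if M.e m = m then .inr (N.pt (Curve.Listed.label m)) else .inl (M.e m)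
  | .inr n => if N.e n = n then .inl (M.pt (Curve.Listed.label n)) else .inr (N.e n)

variable {M N}

/-- Exactly two half-edges end at each vertex of the closed 1-manifold, so the relation is the graph
of a function. This makes the boundary conditions on a surface decidable. -/
theorem meets_iff_meet {u w : M.X ⊕ N.X} : Meets M N u w ↔ w = meet M N u := by
  have hM : ∀ b, M.e (M.pt b) = M.pt b := fun b => (M.e_eq_iff _).2 ⟨b, rfl⟩
  have hN : ∀ b, N.e (N.pt b) = N.pt b := fun b => (N.e_eq_iff _).2 ⟨b, rfl⟩
  have hM' : ∀ b, Curve.Listed.label (M.pt b) = b := fun b =>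
    M.pt_injective (Curve.Listed.pt_label _ (hM b))
  have hN' : ∀ b, Curve.Listed.label (N.pt b) = b := fun b =>
    N.pt_injective (Curve.Listed.pt_label _ (hN b))
  constructor
  · rintro (⟨m, h⟩ | ⟨m, h⟩ | b | b)
    · simp [meet, h]
    · simp [meet, h]
    · simp [meet, hM, hM']
    · simp [meet, hN, hN']
  · rintro rfl
    rcases u with m | n
    · by_cases h : M.e m = m
      · have := Curve.Listed.pt_label m h
        simp only [meet, h, if_true]
        rw [Meets.iff]
        exact ⟨_, this, rfl⟩
      · simp only [meet, h, if_false]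
        exact .src m h
    · by_cases h : N.e n = n
      · have := Curve.Listed.pt_label n h
        simp only [meet, h, if_true]
        rw [Meets.iff]
        exact ⟨_, rfl, this⟩
      · simp only [meet, h, if_false]
        exact .tgt n h

variable (M N)

/-- A cell decomposition of a surface coded by numbers: the flags are some of the numbers below
`size`, and the values of a function at the flags are the digits in base 256 of a number. -/
structure Net where
  size : ℕ
  v : ℕ
  e : ℕ
  f : ℕ
  o : ℕ
  s : ℕ
  i : M.X ⊕ N.X → ℕ

variable {M N} [DecidableEq O] [OrientationCode O]

namespace Net

variable (S T : Net M N)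

def V (x : ℕ) : ℕ := digit S.v x
def E (x : ℕ) : ℕ := digit S.e x
def F (x : ℕ) : ℕ := digit S.f x
def Or (x : ℕ) : O := OrientationCode.decode (digit S.o x)
def Fr (x : ℕ) : SignType := fringe (digit S.s x)

/-- The numbers that are flags. -/
def Live (x : ℕ) : Prop := x < S.size ∧ S.V x ≠ x

instance (x) : Decidable (S.Live x) := inferInstanceAs (Decidable (_ ∧ _))

/-- The list of flags around the vertex of `x`. -/
def around (x : ℕ) : List ℕ :=
  walk S.E S.F (fun z => Nat.beq (S.F z) z || Nat.beq (S.F z) x) S.size x ++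
  walk S.E S.F (fun z => Nat.beq (S.F z) z || Nat.beq (S.F z) (S.F x)) S.size (S.F x)

/-- The list of flags on one side of the seam around the vertex of `x`, in one direction. -/
def oneSide (x : ℕ) : List ℕ :=
  walk S.E S.F (fun z => Nat.beq (S.F z) z || Nat.beq (S.F z) x || !decide (S.Fr z = 0)) S.size x

/-- The conditions on a flag of a surface. -/
def FlagValid (x : ℕ) : Prop :=
  S.Live (S.V x) ∧ S.V (S.V x) = x ∧ S.Live (S.E x) ∧ S.E (S.E x) = x ∧ S.E x ≠ x ∧
  S.Live (S.F x) ∧ S.F (S.F x) = x ∧ S.V (S.F x) = S.F (S.V x) ∧ S.F x ≠ S.V x ∧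
  S.Or (S.V x) = -S.Or x ∧ S.Or (S.E x) = -S.Or x ∧
  S.Fr (S.V x) = S.Fr x ∧ S.Fr (S.F x) = -S.Fr x ∧
  (S.F x ≠ x → (S.Fr x = 0 ↔ S.Or (S.F x) = -S.Or x))

instance (x) : Decidable (S.FlagValid x) := by unfold FlagValid; infer_instance

/-- Closure of a list under the exchange of edges and faces. -/
def closedEF (L : List ℕ) : Bool := L.all fun y => isIn L (S.E y) && isIn L (S.F y)

/-- Closure of a list under the exchange of vertices and edges. -/
def closedVE (L : List ℕ) : Bool := L.all fun y => isIn L (S.V y) && isIn L (S.E y)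

/-- The half-edges on the boundary. -/
def bdry (M N : Curve O B) [M.Listed] [N.Listed] : List (M.X ⊕ N.X) :=
  (Curve.Listed.elems (M := M)).map .inl ++ (Curve.Listed.elems (M := N)).map .inr

/-- The conditions on a half-edge on the boundary. -/
def bdryValid (u : M.X ⊕ N.X) : Bool :=
  decide (S.Live (S.i u) ∧ S.F (S.i u) = S.i u ∧ S.i (Sum.map M.v N.v u) = S.V (S.i u) ∧
    S.Or (S.i u) = Sum.elim (fun m => -M.o m) N.o u) &&
  isIn (S.around (S.i u)) (S.i u) && S.closedEF (S.around (S.i u)) &&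
  (bdry M N).all (fun w => decide (S.i u = S.i w → u = w) &&
    decide (isIn (S.around (S.i u)) (S.i w) = true ↔ (w = u ∨ w = meet M N u))) &&
  (!decide (Sum.elim M.s N.s u = 0) || (S.around (S.i u)).all fun x => decide (S.Fr x = 0)) &&
  (!decide (Sum.elim M.s N.s u = 1) || (S.oneSide (S.i u)).any fun z => decide (S.Fr z = 1) &&
    isIn (S.oneSide (S.F z)) (S.i (meet M N u)))

/-- At most one seam passes through the vertex of `x`. -/
def seamValid (x : ℕ) : Bool :=
  !decide (S.Fr x = 1) || (isIn (S.around x) x && S.closedEF (S.around x) &&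
    (S.around x).all fun y => !decide (S.Fr y = 1) || isIn (S.oneSide x) y)

/-- The conditions on a surface. -/
def valid : Bool :=
  allBelow S.size (fun x => !decide (S.Live x) || (decide (S.FlagValid x) &&
    (!Nat.beq (S.F x) x || (bdry M N).any fun u => Nat.beq (S.i u) x) && S.seamValid x)) &&
  (bdry M N).all S.bdryValid

end Net

end Codes
-- The surface with a valid code
section Realization

variable {O : Type} [InvolutiveNeg O] {B : Type}
variable {M N : Curve O B} [M.Listed] [N.Listed] [DecidableEq O] [OrientationCode O]

namespace Net

variable {S T : Net M N}

/-- The conditions on a surface, spelled out. -/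
structure Valid (S : Net M N) : Prop where
  flag : ∀ x, S.Live x → S.FlagValid x
  fixed : ∀ x, S.Live x → S.F x = x → ∃ u, S.i u = x
  seam : ∀ x, S.Live x → S.seamValid x = true
  bdry : ∀ u, S.bdryValid u = true

theorem mem_bdry (u : M.X ⊕ N.X) : u ∈ bdry M N := by
  rcases u with u | u <;> simp [Net.bdry, Curve.Listed.mem_elems]

theorem valid_iff : S.valid = true ↔ S.Valid := by
  constructor
  · intro h
    simp only [valid, Bool.and_eq_true, allBelow_iff, List.all_eq_true, Bool.or_eq_true,
      Bool.not_eq_true', decide_eq_false_iff_not, decide_eq_true_eq, List.any_eq_true,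
      Nat.beq_eq] at h
    obtain ⟨h1, h2⟩ := h
    refine ⟨fun x hx => ?_, fun x hx hf => ?_, fun x hx => ?_, fun u => h2 u (mem_bdry u)⟩
    · exact (((h1 x hx.1).resolve_left (not_not.2 hx)).1).1
    · rcases (((h1 x hx.1).resolve_left (not_not.2 hx)).1).2 with h | ⟨u, -, hu⟩
      · rw [← Bool.not_eq_true, Nat.beq_eq] at h
        exact absurd hf h
      · exact ⟨u, hu⟩
    · exact ((h1 x hx.1).resolve_left (not_not.2 hx)).2
  · intro h
    simp only [valid, Bool.and_eq_true, allBelow_iff, List.all_eq_true, Bool.or_eq_true,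
      Bool.not_eq_true', decide_eq_false_iff_not, decide_eq_true_eq, List.any_eq_true,
      Nat.beq_eq]
    refine ⟨fun x hx => ?_, fun u _ => h.bdry u⟩
    by_cases hl : S.Live x
    · refine .inr ⟨⟨h.flag x hl, ?_⟩, h.seam x hl⟩
      by_cases hf : S.F x = x
      · obtain ⟨u, hu⟩ := h.fixed x hl hf
        exact .inr ⟨u, mem_bdry u, hu⟩
      · exact .inl (by rw [← Bool.not_eq_true, Nat.beq_eq]; exact hf)
    · exact .inl hl

/-- The flags of a coded surface. -/
abbrev Flag (S : Net M N) := {x : ℕ // S.Live x}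

variable (h : S.Valid)

def Valid.v (x : S.Flag) : S.Flag := ⟨S.V x, (h.flag x x.2).1⟩
def Valid.e (x : S.Flag) : S.Flag := ⟨S.E x, (h.flag x x.2).2.2.1⟩
def Valid.f (x : S.Flag) : S.Flag := ⟨S.F x, (h.flag x x.2).2.2.2.2.2.1⟩

theorem Valid.bdry_spec (h : S.Valid) (u) : (S.Live (S.i u) ∧ S.F (S.i u) = S.i u ∧
    S.i (Sum.map M.v N.v u) = S.V (S.i u) ∧ S.Or (S.i u) = Sum.elim (fun m => -M.o m) N.o u) ∧
    S.i u ∈ S.around (S.i u) ∧ S.closedEF (S.around (S.i u)) = true ∧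
    (∀ w, (S.i u = S.i w → u = w) ∧ (S.i w ∈ S.around (S.i u) ↔ w = u ∨ w = meet M N u)) ∧
    (Sum.elim M.s N.s u = 0 → ∀ x ∈ S.around (S.i u), S.Fr x = 0) ∧
    (Sum.elim M.s N.s u = 1 → ∃ z ∈ S.oneSide (S.i u), S.Fr z = 1 ∧
      S.i (meet M N u) ∈ S.oneSide (S.F z)) := by
  have := h.bdry u
  simp only [bdryValid, Bool.and_eq_true, List.all_eq_true, Bool.or_eq_true,
      Bool.not_eq_true', decide_eq_false_iff_not, decide_eq_true_eq, List.any_eq_true,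
      isIn_iff] at this
  obtain ⟨⟨⟨⟨⟨h1, h2⟩, h3⟩, h4⟩, h5⟩, h6⟩ := this
  exact ⟨h1, h2, h3, fun w => h4 w (mem_bdry w), fun h => h5.resolve_left (not_not.2 h),
    fun h => h6.resolve_left (not_not.2 h)⟩

def Valid.i (u : M.X ⊕ N.X) : S.Flag := ⟨S.i u, (h.bdry_spec u).1.1⟩

theorem closedEF_iff {L : List ℕ} :
    S.closedEF L = true ↔ ∀ y ∈ L, S.E y ∈ L ∧ S.F y ∈ L := by
  simp [closedEF, isIn_iff]

theorem closedVE_iff {L : List ℕ} :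
    S.closedVE L = true ↔ ∀ y ∈ L, S.V y ∈ L ∧ S.E y ∈ L := by
  simp [closedVE, isIn_iff]

theorem Valid.e_e (x) : h.e (h.e x) = x := Subtype.ext (h.flag x x.2).2.2.2.1
theorem Valid.v_v (x) : h.v (h.v x) = x := Subtype.ext (h.flag x x.2).2.1
theorem Valid.f_f (x) : h.f (h.f x) = x := Subtype.ext (h.flag x x.2).2.2.2.2.2.2.1

/-- A list closed under the two involutions that contains `x` contains its whole orbit. With
`Valid.around_of_mem`, membership in a closed walk that contains `x` is equivalent to `Around`. -/
theorem Valid.mem_of_around {L : List ℕ} (hL : S.closedEF L = true) {x y : S.Flag}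
    (hxy : Around h.e h.f x y) (hx : (x : ℕ) ∈ L) : (y : ℕ) ∈ L := by
  rw [closedEF_iff] at hL
  exact (hxy.closed (P := fun z => (z : ℕ) ∈ L) h.e_e h.f_f (fun z hz => (hL z hz).1)
    (fun z hz => (hL z hz).2)).1 hx

theorem Valid.around_of_mem {x y : S.Flag} (hy : (y : ℕ) ∈ S.around x) :
    Around h.e h.f x y := by
  have key : ∀ halt n (x : S.Flag), ∀ y ∈ walk S.E S.F halt n x,
      ∃ hy : S.Live y, Around h.e h.f x ⟨y, hy⟩ := by
    intro halt n x y hy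
    obtain ⟨h1, h2, h3⟩ := walk_mem
      (R := fun a b => ∃ (ha : S.Live a) (hb : S.Live b), Around h.e h.f ⟨a, ha⟩ ⟨b, hb⟩)
      S.Live (fun x hx => ⟨hx, hx, .refl _⟩)
      (fun x y z ⟨h1, h2, h3⟩ ⟨h4, h5, h6⟩ => ⟨h1, h5, .trans _ _ _ h3 h6⟩)
      (fun x hx => ⟨(h.e ⟨x, hx⟩).2, hx, (h.e ⟨x, hx⟩).2, .rel _ _ (.inl rfl)⟩)
      (fun x hx _ => ⟨(h.f ⟨x, hx⟩).2, hx, (h.f ⟨x, hx⟩).2, .rel _ _ (.inr rfl)⟩) n x x.2 y hy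
    exact ⟨h2, h3⟩
  rw [around, List.mem_append] at hy
  rcases hy with hy | hy
  · exact (key _ _ x _ hy).2
  · exact .trans _ _ _ (.rel _ _ (.inr rfl)) (key _ _ (h.f x) _ hy).2

/-- Only this direction is needed, since in the axioms of `Cob` the relation `OneSide` occurs in
conclusions alone. -/
theorem Valid.oneSide_of_mem {x : S.Flag} {y : ℕ} (hy : y ∈ S.oneSide x) :
    ∃ hy : S.Live y, OneSide h.e h.f (fun x => S.Fr x) x ⟨y, hy⟩ := by
  obtain ⟨h1, h2, h3⟩ := walk_mem
    (R := fun a b => ∃ (ha : S.Live a) (hb : S.Live b),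
      OneSide h.e h.f (fun x => S.Fr x) ⟨a, ha⟩ ⟨b, hb⟩)
    S.Live (fun x hx => ⟨hx, hx, .refl _⟩)
    (fun x y z ⟨h1, h2, h3⟩ ⟨h4, h5, h6⟩ => ⟨h1, h5, .trans _ _ _ h3 h6⟩)
    (fun x hx => ⟨(h.e ⟨x, hx⟩).2, hx, (h.e ⟨x, hx⟩).2, .rel _ _ (.inl rfl)⟩)
    (fun x hx hs => ⟨(h.f ⟨x, hx⟩).2, hx, (h.f ⟨x, hx⟩).2, .rel _ _ (.inr ⟨by simp_all, rfl⟩)⟩)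
    _ x x.2 y hy
  exact ⟨h2, h3⟩

/-- The surface with a given code. -/
def Valid.toCob : Cob M N where
  X := S.Flag
  finite := Finite.of_injective (β := Fin S.size) (fun x => ⟨x, x.2.1⟩)
    fun x y h => Subtype.ext (congrArg Fin.val h)
  v := h.v
  e := h.e
  f := h.f
  v_v := h.v_v
  e_e := h.e_e
  f_f := h.f_f
  v_ne x hx := x.2.2 (congrArg Subtype.val hx)
  e_ne x hx := (h.flag x x.2).2.2.2.2.1 (congrArg Subtype.val hx)
  v_f x := Subtype.ext (h.flag x x.2).2.2.2.2.2.2.2.1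
  f_ne_v x hx := (h.flag x x.2).2.2.2.2.2.2.2.2.1 (congrArg Subtype.val hx)
  i := h.i
  i_injective u w huw := ((h.bdry_spec u).2.2.2.1 w).1 (congrArg Subtype.val huw)
  f_eq_iff x := by
    constructor
    · intro hx
      obtain ⟨u, hu⟩ := h.fixed x x.2 (congrArg Subtype.val hx)
      exact ⟨u, Subtype.ext hu⟩
    · rintro ⟨u, rfl⟩
      exact Subtype.ext (h.bdry_spec u).1.2.1
  i_v u := Subtype.ext (h.bdry_spec u).1.2.2.1
  o x := S.Or x
  s x := S.Fr x
  o_v x := (h.flag x x.2).2.2.2.2.2.2.2.2.2.1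
  o_e x := (h.flag x x.2).2.2.2.2.2.2.2.2.2.2.1
  s_v x := (h.flag x x.2).2.2.2.2.2.2.2.2.2.2.2.1
  s_f x := (h.flag x x.2).2.2.2.2.2.2.2.2.2.2.2.2.1
  s_eq_zero_iff x hx := (h.flag x x.2).2.2.2.2.2.2.2.2.2.2.2.2.2
    fun h => hx (Subtype.ext h)
  o_i u := (h.bdry_spec u).1.2.2.2
  bdry_vertex u w := by
    rw [meets_iff_meet, ← ((h.bdry_spec u).2.2.2.1 w).2]
    exact ⟨fun h1 => h.mem_of_around (h.bdry_spec u).2.2.1 h1 (h.bdry_spec u).2.1,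
      fun h1 => h.around_of_mem (x := h.i u) (y := h.i w) h1⟩
  seam_plain u hu x hx :=
    (h.bdry_spec u).2.2.2.2.1 hu x (h.mem_of_around (h.bdry_spec u).2.2.1 hx (h.bdry_spec u).2.1)
  seam_mark u w huw hu := by
    rw [meets_iff_meet] at huw
    subst huw
    obtain ⟨z, hz, hz1, hz2⟩ := (h.bdry_spec u).2.2.2.2.2 hu
    obtain ⟨hz', hz⟩ := h.oneSide_of_mem (x := h.i u) hz
    exact ⟨⟨z, hz'⟩, hz, hz1, (h.oneSide_of_mem (x := h.f ⟨z, hz'⟩) hz2).2⟩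
  seam_vertex x y hxy hx hy := by
    have := h.seam x x.2
    simp only [seamValid, Bool.and_eq_true, List.all_eq_true, Bool.or_eq_true,
      Bool.not_eq_true', decide_eq_false_iff_not, isIn_iff] at this
    have h1 := this.resolve_left (not_not.2 hx)
    exact (h.oneSide_of_mem ((h1.2 y (h.mem_of_around h1.1.2 hxy h1.1.1)).resolve_left
      (not_not.2 hy))).2

end Net

end Realization

/-! ### Operations on codes, and the codes of the saddle and the identities -/

section Operations

variable {O : Type} [InvolutiveNeg O] {B : Type}
variable {M N P : Curve O B}

namespace Net

/-- The surface whose functions are given on numbers below `n`. -/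
def ofFun (n : ℕ) (v e f o s : ℕ → ℕ) (i : M.X ⊕ N.X → ℕ) : Net M N :=
  ⟨n, tabulate n v, tabulate n e, tabulate n f, tabulate n o, tabulate n s, i⟩

variable (S : Net M N)

/-- The digit of the opposite orientation. -/
def opp (d : ℕ) : ℕ := 1 - d

/-- The list of flags of the face of `x`. -/
def face (x : ℕ) : List ℕ := walk S.E S.V (fun z => Nat.beq (S.V z) x) S.size x

/-- The flags of the edge of `x`. -/
def onEdge (x y : ℕ) : Bool :=
  Nat.beq y x || Nat.beq y (S.V x) || Nat.beq y (S.F x) || Nat.beq y (S.V (S.F x))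

/-- The flags of a vertex of valence two. -/
def onVertex (x y : ℕ) : Bool :=
  Nat.beq y x || Nat.beq y (S.E x) || Nat.beq y (S.F x) || Nat.beq y (S.E (S.F x))

/-- Apply `g` until the first number not in `D` is reached, at most four times. -/
def skip (D : ℕ → Bool) (g : ℕ → ℕ) (z : ℕ) : ℕ :=
  let g' := fun z => if D z then g z else z
  g' (g' (g' (g' z)))

/-- Delete the edge of `x`. -/
def delEdge (x : ℕ) : Net M N :=
  { S with
    -- A number fixed by `V` is not `Live`, so this deletes a flag without renumbering the others.
    v := tabulate S.size fun y => if S.onEdge x y then y else S.V y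
    e := tabulate S.size fun y => skip (S.onEdge x) (fun z => S.E (S.F z)) (S.E y) }

/-- Delete the vertex of `x`, which has valence two. -/
def delVertex (x : ℕ) : Net M N :=
  { S with
    v := tabulate S.size fun y =>
      if S.onVertex x y then y else skip (S.onVertex x) (fun z => S.V (S.E z)) (S.V y) }

/-- Insert `p` and `q` between `x` and `e x`. -/
def insert (e : ℕ → ℕ) (x p q z : ℕ) : ℕ :=
  if z = x then p else if z = p then x else if z = e x then q else if z = q then e x else e z

/-- Add an edge from the corner of `x` to the corner of `y`. -/
def addEdge (x y : ℕ) : Net M N :=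
  -- The flags `n` and `n + 1`, exchanged by `F`, are inserted between `x` and `E x`, the flags `n +
  -- 3` and `n + 2` between `y` and `E y`. If the two corners belong to different faces, the new
  -- edge does not divide a face, but joins two faces to an annulus: a tube is attached. Such an
  -- operation is not an admissible move; it only serves to define `discTube` and `idTube`.
  let n := S.size
  ofFun (n + 4)
    (fun z => if z < n then S.V z else n + ((z - n) ^^^ 2))
    (insert (insert S.E x n (n + 1)) y (n + 3) (n + 2))
    (fun z => if z < n then S.F z else n + ((z - n) ^^^ 1))
    (fun z => if z < n then digit S.o z else
      if z = n ∨ z = n + 3 then opp (digit S.o x) else digit S.o x)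
    (fun z => if z < n then digit S.s z else 0) S.i

/-- Subdivide the edge of `x` by a vertex. -/
def addVertex (x : ℕ) : Net M N :=
  let n := S.size
  let y := S.F x
  ofFun (n + 4)
    (fun z => if z = x then n else if z = S.V x then n + 1 else if z = y then n + 2 else
      if z = S.V y then n + 3 else if z = n then x else if z = n + 1 then S.V x else
      if z = n + 2 then y else if z = n + 3 then S.V y else S.V z)
    (fun z => if z < n then S.E z else n + ((z - n) ^^^ 1))
    (fun z => if z < n then S.F z else n + ((z - n) ^^^ 2))
    (fun z => if z < n then digit S.o z else
      if z = n then digit S.o (S.V x) else if z = n + 1 then digit S.o x else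
      if z = n + 2 then digit S.o (S.V y) else digit S.o y)
    (fun z => if z < n then digit S.s z else if z < n + 2 then digit S.s x else digit S.s y) S.i

/-- Change the orientation of the face of `x`, where all sides are seams, and delete these. -/
def capDisc (x : ℕ) : Net M N :=
  { S with
    o := tabulate S.size fun y => if isIn (S.face x) y then opp (digit S.o y) else digit S.o y
    s := tabulate S.size fun y =>
      if isIn (S.face x) y || isIn (S.face x) (S.F y) then 0 else digit S.s y }

/-- Change the orientation of the face of `x` and exchange the sides that are not seams with those
that are seams, the new ones having fringes that point into the face. -/
def flipQuad (x : ℕ) : Net M N :=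
  { S with
    o := tabulate S.size fun y => if isIn (S.face x) y then opp (digit S.o y) else digit S.o y
    s := tabulate S.size fun y =>
      -- The digit 2 is a fringe that points into the face of the flag, the digit 1 one that points
      -- out of it.
      if isIn (S.face x) y then (if digit S.s y = 0 then 2 else 0) else
      if isIn (S.face x) (S.F y) then (if digit S.s y = 0 then 1 else 0) else digit S.s y }

/-- Attach a handle at the corner of `x`. -/
def handle (x : ℕ) : Net M N :=
  let n := S.size
  ofFun (n + 8)
    (fun z => if z < n then S.V z else n + ((z - n) ^^^ 1))
    (fun z => if z = x then n else if z = S.E x then n + 7 else if z = n then x else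
      if z = n + 7 then S.E x else if z < n then S.E z else n + ((z - n - 1) ^^^ 1) + 1)
    -- Exclusive or with 5 is the gluing `Cob.handleF8` of the sides of the commutator.
    (fun z => if z < n then S.F z else n + ((z - n) ^^^ 5))
    (fun z => if z < n then digit S.o z else
      if (z - n) % 2 = 0 then opp (digit S.o x) else digit S.o x)
    (fun z => if z < n then digit S.s z else 0) S.i

/-- Glue two surfaces along a curve with flags `X`. -/
def glue (X : List N.X) (S : Net M N) (T : Net N P) : Net M P :=
  let n := S.size
  ofFun (n + T.size)
    (fun z => if z < n then S.V z else n + T.V (z - n))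
    (fun z => if z < n then S.E z else n + T.E (z - n))
    (fun z =>
      if z < n then ((X.find? fun m => Nat.beq (S.i (.inr m)) z).map fun m =>
        n + T.i (.inl m)).getD (S.F z)
      else ((X.find? fun m => Nat.beq (T.i (.inl m)) (z - n)).map fun m =>
        S.i (.inr m)).getD (n + T.F (z - n)))
    (fun z => if z < n then digit S.o z else digit T.o (z - n))
    (fun z => if z < n then digit S.s z else digit T.s (z - n))
    (Sum.elim (fun m => S.i (.inl m)) fun p => n + T.i (.inr p))

/-- Forget the seams. -/
def forget (S : Net M N) : Net M.forget N.forget := ⟨S.size, S.v, S.e, S.f, 0, 0, S.i⟩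

/-- The steps by which the cell decomposition or the disorientation of a surface is changed. -/
inductive Move
  | delEdge (x : ℕ)
  | addEdge (x y : ℕ)
  | delVertex (x : ℕ)
  | addVertex (x : ℕ)
  | capDisc (x : ℕ)
  | flipQuad (x : ℕ)

/-- Carry out a move. -/
def move (S : Net M N) : Move → Net M N
  | .delEdge x => S.delEdge x
  | .addEdge x y => S.addEdge x y
  | .delVertex x => S.delVertex x
  | .addVertex x => S.addVertex x
  | .capDisc x => S.capDisc x
  | .flipQuad x => S.flipQuad x

/-- Carry out several moves. -/
def run (S : Net M N) (l : List Move) : Net M N := l.foldl move S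

end Net

/-- The index of a corner. -/
def Corner.index (c : Corner) : ℕ := (if c.1 then 2 else 0) + if c.2 then 1 else 0

namespace Net

/-- The code of the saddle. -/
def saddle : Net orientedSmoothing disorientedSmoothing :=
  -- The flag `(c, j)` of the saddle has the number `4 * Corner.index c + j`. The bit 8 tells the
  -- top from the bottom, the bit 4 the right from the left.
  ofFun 16 (fun x => if x % 4 = 0 ∨ x % 4 = 3 then x ^^^ 8 else x ^^^ 3) (fun x => x ^^^ 1)
    (fun x => if x % 4 = 3 then x ^^^ 4 else x) (fun x => if x / 8 = x % 2 then 1 else 0)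
    (fun x => if x % 4 = 3 then x / 4 % 2 + 1 else 0)
    (Sum.elim (fun c => 4 * Corner.index c) fun x => 4 * Corner.index x.1 + if x.2 then 1 else 2)

/-- The code of the saddle, read backwards. -/
def coSaddle : Net disorientedSmoothing orientedSmoothing :=
  { saddle with
    -- Exchanging source and target reverses all orientations of faces; the fringe still points to
    -- the right.
    o := tabulate 16 fun x => if x / 8 = x % 2 then 0 else 1
    i := fun u => saddle.i u.swap }

/-- The code of the identity of the oriented smoothing. -/
def idOriented : Net orientedSmoothing orientedSmoothing :=
  ofFun 8 (fun x => x ^^^ 4) (fun x => x ^^^ 1) (fun x => x)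
    (fun x => if x / 4 = x % 2 then 1 else 0) (fun _ => 0)
    (Sum.elim (fun c => 2 * Corner.index c) fun c => 2 * Corner.index c + 1)

/-- The code of the identity of the disoriented smoothing. -/
def idDisoriented : Net disorientedSmoothing disorientedSmoothing :=
  -- The numbers below 16 are the flags whose edges lie on the boundary, the others those whose
  -- edges are the seams, that is, marks times the interval.
  ofFun 24 (fun x => if x < 16 then x ^^^ 2 else x ^^^ 1)
    (fun x => if x < 16 then if x % 4 < 2 then 16 + x / 4 * 2 + x % 4 else x ^^^ 1
      else (x - 16) / 2 * 4 + x % 2)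
    (fun x => if x < 16 then x else x ^^^ 2)
    (fun x => if x < 16 then (x / 8 + x / 2 + x) % 2 else ((x - 16) / 4 + x + 1) % 2)
    (fun x => if x < 16 then 0 else (x - 16) / 2 % 2 + 1)
    (Sum.elim (fun x => 4 * Corner.index x.1 + if x.2 then 2 else 0)
      fun x => 4 * Corner.index x.1 + if x.2 then 3 else 1)

end Net

end Operations
-- The defining relations, read off from codes
section Soundness

universe u
variable (k : Type u) [CommRing k] [Invertible (2 : k)] (ω : kˣ)
variable {O : Type} [InvolutiveNeg O] {B : Type}

namespace CobCat

variable {k ω}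

theorem map_eq_of_basic {P Q : Obj O B} {a b : (Free.embedding k (Paths (Obj O B))).obj
    ((Paths.of (Obj O B)).obj P) ⟶ (Free.embedding k (Paths (Obj O B))).obj
      ((Paths.of (Obj O B)).obj Q)} (h : Basic k ω a b) :
    (CategoryTheory.Quotient.functor (Rel k ω : HomRel (Pre k O B))).map a =
      (CategoryTheory.Quotient.functor (Rel k ω : HomRel (Pre k O B))).map b :=
  CategoryTheory.Quotient.sound _ (.basic h)

theorem map_smul {P Q : Pre k O B} (r : k) (a : P ⟶ Q) :
    (CategoryTheory.Quotient.functor (Rel k ω : HomRel (Pre k O B))).map (r • a) =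
      r • (CategoryTheory.Quotient.functor (Rel k ω : HomRel (Pre k O B))).map a := rfl

theorem map_add {P Q : Pre k O B} (a b : P ⟶ Q) :
    (CategoryTheory.Quotient.functor (Rel k ω : HomRel (Pre k O B))).map (a + b) =
      (CategoryTheory.Quotient.functor (Rel k ω : HomRel (Pre k O B))).map a +
      (CategoryTheory.Quotient.functor (Rel k ω : HomRel (Pre k O B))).map b :=
  Functor.map_add _

variable {P Q R : Obj O B}

theorem hom_comp (S : Cob P.curve Q.curve) (T : Cob Q.curve R.curve) :
    hom k ω (P := P) (Q := Q) S ≫ hom k ω (P := Q) (Q := R) T =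
      hom k ω (P := P) (Q := R) (Cob.glue S T) :=
  ((CategoryTheory.Quotient.functor (Rel k ω : HomRel (Pre k O B))).map_comp _ _).symm.trans
    (map_eq_of_basic (.glue (P := P) (Q := Q) (R := R) S T))

variable {S T : Cob P.curve Q.curve}

theorem hom_iso {φ} (h : Cob.IsIso S T φ) :
    hom k ω (P := P) (Q := Q) S = hom k ω (P := P) (Q := Q) T :=
  map_eq_of_basic (.iso (P := P) (Q := Q) S T φ h)

theorem hom_edge {x j} (h : Cob.DeletesEdge S T x j) (hx : ¬Cob.SameFace S x (S.f x))
    (hx' : S.e x ≠ S.v x) : hom k ω (P := P) (Q := Q) S = hom k ω (P := P) (Q := Q) T :=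
  map_eq_of_basic (.edge (P := P) (Q := Q) S T x j h hx hx')

theorem hom_vertex {x j} (h : Cob.DeletesVertex S T x j) :
    hom k ω (P := P) (Q := Q) S = hom k ω (P := P) (Q := Q) T :=
  map_eq_of_basic (.vertex (P := P) (Q := Q) S T x j h)

theorem hom_neck {x j} (h : Cob.DeletesEdge S T x j)
    (hx : ∃ n : ℕ, (fun w => S.v (S.e w))^[n] (S.v x) = S.f x)
    {y z} (hy : j y = S.e x) (hz : j z = S.e (S.v x)) :
    hom k ω (P := P) (Q := Q) S = ⅟(2 : k) • (hom k ω (P := P) (Q := Q) (Cob.addHandle T y) +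
      hom k ω (P := P) (Q := Q) (Cob.addHandle T z)) :=
  (map_eq_of_basic (.neck (P := P) (Q := Q) S T x j h hx y z hy hz)).trans
    ((map_smul _ _).trans (congrArg _ (map_add _ _)))

theorem hom_inward {x φ} (h : Cob.FlipsFace S T x φ)
    (hs : ∀ y, Cob.SameFace S x y → S.s y = -1 ∧ T.s (φ y) = 0) :
    hom k ω (P := P) (Q := Q) S = (ω : k) • hom k ω (P := P) (Q := Q) T :=
  (map_eq_of_basic (.inward (P := P) (Q := Q) S T x φ h hs)).trans (map_smul _ _)

/-- The relation is solved for the surface whose fringes point away from each other, so that this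
move, like the removal of an inward seam, contributes a positive power of `ω`. -/
theorem hom_saddle {x φ} (h : Cob.FlipsFace S T x φ)
    (hx : (fun w => S.v (S.e w))^[4] x = x) (hx' : (fun w => S.v (S.e w))^[2] x ≠ x)
    (hs : ∀ y, Cob.SameFace S x y →
      (S.s y = -1 ∧ S.s (S.e y) = 0 ∧ T.s (φ y) = 0) ∨
      (S.s y = 0 ∧ S.s (S.e y) = -1 ∧ T.s (φ y) = 1)) :
    hom k ω (P := P) (Q := Q) T = (ω : k) • hom k ω (P := P) (Q := Q) S := by
  have := (map_eq_of_basic (.saddle (ω := ω) (P := P) (Q := Q) S T x φ h hx hx' hs)).trans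
    (map_smul _ _)
  change hom k ω (P := P) (Q := Q) S = ((ω⁻¹ : kˣ) : k) • hom k ω (P := P) (Q := Q) T at this
  rw [this, smul_smul, ← Units.val_mul, mul_inv_cancel, Units.val_one, one_smul]

end CobCat

variable {M N L : Curve O B} [M.Listed] [N.Listed] [L.Listed] [DecidableEq O] [OrientationCode O]

namespace Net

open Classical in
/-- The morphism given by a code. -/
noncomputable def hom (S : Net M N) (a b : ℤ) :
    CobCat.obj k ω ⟨M, a⟩ ⟶ CobCat.obj k ω ⟨N, b⟩ :=
  if h : S.Valid then CobCat.hom k ω (P := ⟨M, a⟩) (Q := ⟨N, b⟩) h.toCob else 0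

variable {k ω} {S T : Net M N} {a b : ℤ}

theorem Valid.hom_eq (h : S.Valid) :
    S.hom k ω a b = CobCat.hom k ω (P := ⟨M, a⟩) (Q := ⟨N, b⟩) h.toCob := dif_pos h

/-- The flags of `C` are numbered by `g`, in accordance with the code `S`. -/
structure Numbers (S : Net M N) (C : Cob M N) (g : C.X → ℕ) : Prop where
  live : ∀ y, S.Live (g y)
  injective : Function.Injective g
  surjective : ∀ x, S.Live x → ∃ y, g y = x
  v : ∀ y, g (C.v y) = S.V (g y)
  e : ∀ y, g (C.e y) = S.E (g y)
  f : ∀ y, g (C.f y) = S.F (g y)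
  i : ∀ u, g (C.i u) = S.i u
  o : ∀ y, S.Or (g y) = C.o y
  s : ∀ y, S.Fr (g y) = C.s y

/-- A surface whose flags are numbered is given by the code. -/
theorem Numbers.hom_eq {C : Cob M N} {g : C.X → ℕ} (hg : S.Numbers C g) (h : S.Valid) :
    CobCat.hom k ω (P := ⟨M, a⟩) (Q := ⟨N, b⟩) C = S.hom k ω a b := by
  rw [h.hom_eq]
  refine CobCat.hom_iso
    (φ := Equiv.ofBijective (fun y => (⟨g y, hg.live y⟩ : S.Flag)) ⟨?_, ?_⟩) ?_
  · exact fun x y hxy => hg.injective (congrArg Subtype.val hxy)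
  · exact fun (x : S.Flag) => (hg.surjective x x.2).imp fun y hy => Subtype.ext hy
  · exact ⟨fun y => Subtype.ext (hg.v y), fun y => Subtype.ext (hg.e y),
      fun y => Subtype.ext (hg.f y), fun y => Subtype.ext (hg.i y), hg.o, hg.s⟩

theorem Valid.numbers (h : S.Valid) : S.Numbers h.toCob fun y : S.Flag => y :=
  ⟨fun y : S.Flag => y.2, fun _ _ => Subtype.ext, fun x hx => ⟨(⟨x, hx⟩ : S.Flag), rfl⟩,
    fun _ => rfl, fun _ => rfl, fun _ => rfl, fun _ => rfl, fun _ => rfl, fun _ => rfl⟩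

section Skip

/-- Once outside `D`, `skip` stands still. So a result outside `D` is the first element outside, and
it need not be shown that four steps suffice. -/
theorem skipTo_skip {D : ℕ → Bool} {g : ℕ → ℕ} {z : ℕ} (h : D (skip D g z) = false) :
    Cob.SkipTo {y | D y = true} g z (skip D g z) := by
  have key : ∀ (D : ℕ → Bool) (g : ℕ → ℕ) (z w : ℕ),
      Cob.SkipTo {y | D y = true} g (if D z then g z else z) w →
      Cob.SkipTo {y | D y = true} g z w := by
    intro D g z w h
    split at h
    · rename_i h'
      exact .next h' h
    · exact h
  exact key _ _ _ _ (key _ _ _ _ (key _ _ _ _ (key _ _ _ _ (.here (Bool.eq_false_iff.1 h)))))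

theorem skipTo_subtype {p : ℕ → Prop} {D : ℕ → Bool} {g : ℕ → ℕ} {D' : Set {x // p x}}
    {g' : {x // p x} → {x // p x}} (hD : ∀ y : {x // p x}, y ∈ D' ↔ D y = true)
    (hg : ∀ y : {x // p x}, ((g' y : {x // p x}) : ℕ) = g y) {z w : ℕ}
    (h : Cob.SkipTo {y | D y = true} g z w) (hz : p z) (hw : p w) :
    Cob.SkipTo D' g' ⟨z, hz⟩ ⟨w, hw⟩ := by
  induction h with
  | here h => exact .here (by rwa [hD])
  | @next x y h h' ih =>
    have := hg ⟨x, hz⟩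
    refine .next (by rwa [hD]) ?_
    have h2 : g' ⟨x, hz⟩ = ⟨g x, this ▸ (g' ⟨x, hz⟩).2⟩ := Subtype.ext this
    rw [h2]
    exact ih _ hw

end Skip

/-- `T` is obtained from `S` by deleting the edge of `x`. -/
def checkEdge (S T : Net M N) (x : ℕ) : Bool :=
  decide (S.Live x ∧ S.F x ≠ x ∧ S.Fr x = 0 ∧ T.size ≤ S.size) &&
  allBelow S.size fun y => decide (T.Live y ↔ S.Live y ∧ S.onEdge x y = false) &&
    (!decide (T.Live y) || decide (T.V y = S.V y ∧ T.F y = S.F y ∧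
      T.E y = skip (S.onEdge x) (fun z => S.E (S.F z)) (S.E y) ∧ T.Or y = S.Or y ∧ T.Fr y = S.Fr y))

theorem checkEdge_spec (h : checkEdge S T x = true) :
    (S.Live x ∧ S.F x ≠ x ∧ S.Fr x = 0) ∧
    (∀ y, T.Live y ↔ S.Live y ∧ S.onEdge x y = false) ∧
    ∀ y, T.Live y → T.V y = S.V y ∧ T.F y = S.F y ∧
      T.E y = skip (S.onEdge x) (fun z => S.E (S.F z)) (S.E y) ∧
      T.Or y = S.Or y ∧ T.Fr y = S.Fr y := by
  simp only [checkEdge, Bool.and_eq_true, allBelow_iff, Bool.or_eq_true,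
    Bool.not_eq_true', decide_eq_false_iff_not, decide_eq_true_eq] at h
  obtain ⟨⟨h1, h2, h3, h4⟩, h5⟩ := h
  refine ⟨⟨h1, h2, h3⟩, fun y => ?_, fun y hy => ?_⟩
  · by_cases hy : y < S.size
    · exact (h5 y hy).1
    · exact ⟨fun h => absurd (h.1.trans_le h4) hy, fun h => absurd h.1.1 hy⟩
  · exact (h5 y (hy.1.trans_le h4)).2.resolve_left (not_not.2 hy)

theorem Valid.deletesEdge (hS : S.Valid) (hT : T.Valid) {x : ℕ} (h : checkEdge S T x = true)
    (hi : T.i = S.i) :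
    Cob.DeletesEdge hS.toCob hT.toCob ⟨x, (checkEdge_spec h).1.1⟩
      fun y : T.Flag => ⟨y, (((checkEdge_spec h).2.1 y).1 y.2).1⟩ := by
  obtain ⟨⟨h1, h2, h3⟩, h4, h5⟩ := checkEdge_spec h
  have hD : ∀ y : S.Flag, y ∈ ({⟨x, h1⟩, hS.v ⟨x, h1⟩, hS.f ⟨x, h1⟩, hS.v (hS.f ⟨x, h1⟩)} :
      Set S.Flag) ↔ S.onEdge x y = true := by
    intro y
    simp only [Set.mem_insert_iff, Set.mem_singleton_iff, Subtype.ext_iff, onEdge,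
      Bool.or_eq_true, Nat.beq_eq, Valid.v, Valid.f, or_assoc]
  refine ⟨fun h => h2 (congrArg Subtype.val h), h3,
    fun (y z : T.Flag) hyz => Subtype.ext (congrArg (fun w : S.Flag => (w : ℕ)) hyz), ?_,
    fun (y : T.Flag) => Subtype.ext (h5 y y.2).1, fun (y : T.Flag) => Subtype.ext (h5 y y.2).2.1, ?_,
    fun u => Subtype.ext (congrFun hi u), fun (y : T.Flag) => (h5 y y.2).2.2.2.1,
    fun (y : T.Flag) => (h5 y y.2).2.2.2.2⟩
  · ext (y : S.Flag)
    refine Iff.trans ?_ (not_congr (hD y)).symm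
    constructor
    · rintro ⟨(z : T.Flag), rfl⟩
      simpa using ((h4 z).1 z.2).2
    · intro hy
      exact ⟨⟨y, (h4 y).2 ⟨y.2, by simpa using hy⟩⟩, rfl⟩
  · intro (y : T.Flag)
    have h6 := (h5 y y.2).2.2.1
    -- Since `T` is a valid code, `T.E y` is a flag of `T` and hence not deleted. This shows that
    -- skipping has ended outside the deleted edge.
    have h7 : T.Live (T.E y) := (hT.e y).2
    have h8 : S.onEdge x (T.E y) = false := ((h4 _).1 h7).2
    have h9 : S.Live (T.E y) := ((h4 _).1 h7).1
    have := skipTo_skip (h6 ▸ h8)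
    rw [← h6] at this
    exact skipTo_subtype (g' := fun z => hS.e (hS.f z)) hD (fun z => rfl) this (hS.e ⟨y, ((h4 y).1 y.2).1⟩).2 h9

/-- `T` is obtained from `S` by deleting the vertex of `x`. -/
def checkVertex (S T : Net M N) (x : ℕ) : Bool :=
  decide (S.Live x ∧ S.F x ≠ x ∧ S.E x ≠ S.F x ∧ S.E (S.F x) = S.F (S.E x) ∧
    S.onVertex x (S.V x) = false ∧ T.size ≤ S.size) &&
  allBelow S.size fun y => decide (T.Live y ↔ S.Live y ∧ S.onVertex x y = false) &&
    (!decide (T.Live y) || decide (T.E y = S.E y ∧ T.F y = S.F y ∧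
      T.V y = skip (S.onVertex x) (fun z => S.V (S.E z)) (S.V y) ∧
      T.Or y = S.Or y ∧ T.Fr y = S.Fr y))

theorem checkVertex_spec (h : checkVertex S T x = true) :
    (S.Live x ∧ S.F x ≠ x ∧ S.E x ≠ S.F x ∧ S.E (S.F x) = S.F (S.E x) ∧
      S.onVertex x (S.V x) = false) ∧
    (∀ y, T.Live y ↔ S.Live y ∧ S.onVertex x y = false) ∧
    ∀ y, T.Live y → T.E y = S.E y ∧ T.F y = S.F y ∧
      T.V y = skip (S.onVertex x) (fun z => S.V (S.E z)) (S.V y) ∧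
      T.Or y = S.Or y ∧ T.Fr y = S.Fr y := by
  simp only [checkVertex, Bool.and_eq_true, allBelow_iff, Bool.or_eq_true,
    Bool.not_eq_true', decide_eq_false_iff_not, decide_eq_true_eq] at h
  obtain ⟨⟨h1, h2, h3, h3', h3'', h4⟩, h5⟩ := h
  refine ⟨⟨h1, h2, h3, h3', h3''⟩, fun y => ?_, fun y hy => ?_⟩
  · by_cases hy : y < S.size
    · exact (h5 y hy).1
    · exact ⟨fun h => absurd (h.1.trans_le h4) hy, fun h => absurd h.1.1 hy⟩
  · exact (h5 y (hy.1.trans_le h4)).2.resolve_left (not_not.2 hy)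

theorem Valid.deletesVertex (hS : S.Valid) (hT : T.Valid) {x : ℕ} (h : checkVertex S T x = true)
    (hi : T.i = S.i) :
    Cob.DeletesVertex hS.toCob hT.toCob ⟨x, (checkVertex_spec h).1.1⟩
      fun y : T.Flag => ⟨y, (((checkVertex_spec h).2.1 y).1 y.2).1⟩ := by
  obtain ⟨⟨h1, h2, h3, h3', h3''⟩, h4, h5⟩ := checkVertex_spec h
  have hD : ∀ y : S.Flag, y ∈ ({⟨x, h1⟩, hS.e ⟨x, h1⟩, hS.f ⟨x, h1⟩, hS.e (hS.f ⟨x, h1⟩)} :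
      Set S.Flag) ↔ S.onVertex x y = true := by
    intro y
    simp only [Set.mem_insert_iff, Set.mem_singleton_iff, Subtype.ext_iff, onVertex,
      Bool.or_eq_true, Nat.beq_eq, Valid.e, Valid.f, or_assoc]
  refine ⟨fun h => h2 (congrArg Subtype.val h), fun h => h3 (congrArg Subtype.val h),
    Subtype.ext h3', ?_,
    fun (y z : T.Flag) hyz => Subtype.ext (congrArg (fun w : S.Flag => (w : ℕ)) hyz), ?_,
    fun (y : T.Flag) => Subtype.ext (h5 y y.2).1, fun (y : T.Flag) => Subtype.ext (h5 y y.2).2.1, ?_,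
    fun u => Subtype.ext (congrFun hi u), fun (y : T.Flag) => (h5 y y.2).2.2.2.1,
    fun (y : T.Flag) => (h5 y y.2).2.2.2.2⟩
  · exact fun h => Bool.eq_false_iff.1 h3'' ((hD _).1 h)
  · ext (y : S.Flag)
    refine Iff.trans ?_ (not_congr (hD y)).symm
    constructor
    · rintro ⟨(z : T.Flag), rfl⟩
      simpa using ((h4 z).1 z.2).2
    · intro hy
      exact ⟨⟨y, (h4 y).2 ⟨y.2, by simpa using hy⟩⟩, rfl⟩
  · intro (y : T.Flag)
    have h6 := (h5 y y.2).2.2.1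
    have h7 : T.Live (T.V y) := (hT.v y).2
    have h8 : S.onVertex x (T.V y) = false := ((h4 _).1 h7).2
    have h9 : S.Live (T.V y) := ((h4 _).1 h7).1
    have := skipTo_skip (h6 ▸ h8)
    rw [← h6] at this
    exact skipTo_subtype (g' := fun z => hS.v (hS.e z)) hD (fun z => rfl) this (hS.v ⟨y, ((h4 y).1 y.2).1⟩).2 h9

/-- The list of flags of the face of `x` is complete. -/
def checkFace (S : Net M N) (x : ℕ) : Bool :=
  isIn (S.face x) x && S.closedVE (S.face x)

theorem Valid.sameFace_iff (hS : S.Valid) {x : ℕ} (hx : S.Live x) (h : S.checkFace x = true)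
    (y : S.Flag) : Cob.SameFace hS.toCob ⟨x, hx⟩ y ↔ (y : ℕ) ∈ S.face x := by
  simp only [checkFace, Bool.and_eq_true, isIn_iff, closedVE_iff] at h
  constructor
  · intro hy
    -- `SameFace` is `Around` for the involutions `v` and `e` in place of `e` and `f`.
    have := Around.closed (e := hS.v) (f := hS.e) (P := fun z => (z : ℕ) ∈ S.face x) hS.v_v hS.e_e
      (fun z hz => (h.2 z hz).1) (fun z hz => (h.2 z hz).2) hy
    exact this.1 h.1
  · intro hy
    obtain ⟨h1, h2, h3⟩ := walk_mem
      (R := fun a b => ∃ (ha : S.Live a) (hb : S.Live b), Cob.SameFace hS.toCob ⟨a, ha⟩ ⟨b, hb⟩)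
      S.Live (fun x hx => ⟨hx, hx, .refl _⟩)
      (fun x y z ⟨h1, h2, h3⟩ ⟨h4, h5, h6⟩ => ⟨h1, h5, .trans _ _ _ h3 h6⟩)
      (fun x hx => ⟨(hS.e ⟨x, hx⟩).2, hx, (hS.e ⟨x, hx⟩).2, .rel _ _ (.inr rfl)⟩)
      (fun x hx _ => ⟨(hS.v ⟨x, hx⟩).2, hx, (hS.v ⟨x, hx⟩).2, .rel _ _ (.inl rfl)⟩) _ x hx y hy
    exact h3

theorem Valid.hom_delEdge (hS : S.Valid) (hT : T.Valid) {x : ℕ} (h : checkEdge S T x = true)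
    (hi : T.i = S.i)
    (h' : (S.checkFace x && !isIn (S.face x) (S.F x) && !Nat.beq (S.E x) (S.V x)) = true) :
    S.hom k ω a b = T.hom k ω a b := by
  rw [hS.hom_eq, hT.hom_eq]
  simp only [Bool.and_eq_true, Bool.not_eq_true', ← Bool.not_eq_true, isIn_iff, Nat.beq_eq] at h'
  refine CobCat.hom_edge (hS.deletesEdge hT h hi) (fun hx => h'.1.2 ?_)
    fun hx => h'.2 (congrArg Subtype.val hx)
  exact (hS.sameFace_iff _ h'.1.1 (hS.f _)).1 hx

theorem Valid.hom_delVertex (hS : S.Valid) (hT : T.Valid) {x : ℕ}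
    (h : checkVertex S T x = true) (hi : T.i = S.i) : S.hom k ω a b = T.hom k ω a b := by
  rw [hS.hom_eq, hT.hom_eq]
  exact CobCat.hom_vertex (hS.deletesVertex hT h hi)

/-- `S` and `T` differ by a change of the disorientation at the face of `x`. -/
def checkFlip (S T : Net M N) (x : ℕ) : Bool :=
  decide (S.Live x ∧ S.size = T.size) && S.checkFace x &&
  allBelow S.size fun y => decide (S.V y = T.V y ∧ S.E y = T.E y ∧ S.F y = T.F y) &&
    decide (if isIn (S.face x) y then T.Or y = -S.Or y else T.Or y = S.Or y ∧
      (S.Live y → isIn (S.face x) (S.F y) = true ∨ T.Fr y = S.Fr y))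

theorem checkFlip_live (h : checkFlip S T x = true) : S.Live x := by
  simp only [checkFlip, Bool.and_eq_true, decide_eq_true_eq] at h
  exact h.1.1.1

theorem checkFlip_live_iff (h : checkFlip S T x = true) (y : ℕ) : S.Live y ↔ T.Live y := by
  simp only [checkFlip, Bool.and_eq_true, decide_eq_true_eq, allBelow_iff] at h
  unfold Live
  rw [← h.1.1.2]
  exact and_congr_right fun hy => by rw [(h.2 y hy).1.1]

theorem Valid.flipsFace (hS : S.Valid) (hT : T.Valid) {x : ℕ} (h : checkFlip S T x = true)
    (hi : T.i = S.i) :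
    Cob.FlipsFace hS.toCob hT.toCob ⟨x, checkFlip_live h⟩
      (Equiv.subtypeEquivRight (checkFlip_live_iff h)) := by
  have h0 := h
  simp only [checkFlip, Bool.and_eq_true, decide_eq_true_eq, allBelow_iff] at h
  obtain ⟨⟨⟨h1, h2⟩, h3⟩, h4⟩ := h
  have h5 := hS.sameFace_iff h1 h3
  refine ⟨fun (y : S.Flag) => Subtype.ext (h4 y y.2.1).1.1,
    fun (y : S.Flag) => Subtype.ext (h4 y y.2.1).1.2.1,
    fun (y : S.Flag) => Subtype.ext (h4 y y.2.1).1.2.2, fun u => Subtype.ext (congrFun hi.symm u),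
    fun (y : S.Flag) hy => ?_, fun (y : S.Flag) hy => ?_, fun (y : S.Flag) hy hy' => ?_⟩
  · have := (h4 y y.2.1).2
    rw [if_pos (isIn_iff.2 ((h5 y).1 hy))] at this
    exact this
  · have := (h4 y y.2.1).2
    rw [if_neg (fun h => hy ((h5 y).2 (isIn_iff.1 h)))] at this
    exact this.1
  · have := (h4 y y.2.1).2
    rw [if_neg (fun h => hy ((h5 y).2 (isIn_iff.1 h)))] at this
    exact (this.2 y.2).resolve_left fun h => hy' ((h5 (hS.f y)).2 (isIn_iff.1 h))

theorem Valid.hom_capDisc (hS : S.Valid) (hT : T.Valid) {x : ℕ} (h : checkFlip S T x = true)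
    (hi : T.i = S.i)
    (h' : ((S.face x).all fun y => decide (S.Fr y = -1 ∧ T.Fr y = 0)) = true) :
    S.hom k ω a b = (ω : k) • T.hom k ω a b := by
  rw [hS.hom_eq, hT.hom_eq]
  have h0 := h
  simp only [checkFlip, Bool.and_eq_true, decide_eq_true_eq] at h0
  refine CobCat.hom_inward (hS.flipsFace hT h hi) fun (y : S.Flag) hy => ?_
  exact of_decide_eq_true (List.all_eq_true.1 h' y ((hS.sameFace_iff h0.1.1.1 h0.1.2 y).1 hy))

theorem Valid.hom_flipQuad (hS : S.Valid) (hT : T.Valid) {x : ℕ} (h : checkFlip S T x = true)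
    (hi : S.i = T.i)
    (h' : ((S.face x).all fun y => decide ((S.Fr y = -1 ∧ S.Fr (S.E y) = 0 ∧ T.Fr y = 0) ∨
      (S.Fr y = 0 ∧ S.Fr (S.E y) = -1 ∧ T.Fr y = 1))) = true)
    (h'' : (fun w => S.V (S.E w))^[4] x = x ∧ (fun w => S.V (S.E w))^[2] x ≠ x) :
    T.hom k ω a b = (ω : k) • S.hom k ω a b := by
  rw [hS.hom_eq, hT.hom_eq]
  have h0 := h
  simp only [checkFlip, Bool.and_eq_true, decide_eq_true_eq] at h0
  refine CobCat.hom_saddle (hS.flipsFace hT h hi.symm) (Subtype.ext h''.1)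
    (fun hx => h''.2 (congrArg Subtype.val hx)) fun (y : S.Flag) hy => ?_
  exact of_decide_eq_true (List.all_eq_true.1 h' y ((hS.sameFace_iff h0.1.1.1 h0.1.2 y).1 hy))

end Net

end Soundness
-- Handles, neck cutting, sequences of moves, isomorphisms and gluing
section Soundness

universe u
variable {k : Type u} [CommRing k] [Invertible (2 : k)] {ω : kˣ}
variable {O : Type} [InvolutiveNeg O] {B : Type}
variable {M N L : Curve O B} [M.Listed] [N.Listed] [L.Listed] [DecidableEq O] [OrientationCode O]

namespace Net

variable {S T : Net M N} {a b c : ℤ}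

/-- Attaching a handle is compatible with codes. -/
def checkHandle (S : Net M N) (x : ℕ) : Bool :=
  let T := S.handle x
  T.valid && decide (S.Live x) &&
  (allBelow S.size fun y => decide (T.Live y ↔ S.Live y) && (!decide (S.Live y) ||
    decide (T.V y = S.V y ∧ T.F y = S.F y ∧
      T.E y = (if y = x then S.size else if y = S.E x then S.size + 7 else S.E y) ∧
      T.Or y = S.Or y ∧ T.Fr y = S.Fr y))) &&
  decide (∀ i : Fin 8, T.Live (S.size + i) ∧ T.V (S.size + i) = S.size + Cob.handleV8 i ∧
    T.F (S.size + i) = S.size + Cob.handleF8 i ∧ T.E (S.size + i) =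
      (![x, S.size + 2, S.size + 1, S.size + 4, S.size + 3, S.size + 6, S.size + 5, S.E x] :
        Fin 8 → ℕ) i ∧
    T.Or (S.size + i) = (![-S.Or x, S.Or x, -S.Or x, S.Or x, -S.Or x, S.Or x, -S.Or x, S.Or x] :
      Fin 8 → O) i ∧ T.Fr (S.size + i) = 0)

theorem Numbers.addHandle {C : Cob M N} {g : C.X → ℕ} (hg : S.Numbers C g) {x : C.X}
    (h : S.checkHandle (g x) = true) :
    (S.handle (g x)).Numbers (C.addHandle x) (Sum.elim g fun i => S.size + i) := by
  simp only [checkHandle, Bool.and_eq_true, allBelow_iff, decide_eq_true_eq, Bool.or_eq_true,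
    Bool.not_eq_true', decide_eq_false_iff_not, valid_iff] at h
  obtain ⟨⟨-, h1⟩, h2⟩ := h
  have h3 := fun y => (h1 (g y) (hg.live y).1).2.resolve_left (not_not.2 (hg.live y))
  constructor
  · rintro (y | i)
    · exact (h1 _ (hg.live y).1).1.2 (hg.live y)
    · exact (h2 i).1
  · rintro (y | i) (z | j) hyz
    · exact congrArg Sum.inl (hg.injective hyz)
    · have h4 := (hg.live y).1
      have h5 : g y = S.size + j := hyz
      omega
    · have h4 := (hg.live z).1
      have h5 : S.size + i = g z := hyz
      omega
    · have h5 : S.size + i = S.size + j := hyz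
      exact congrArg Sum.inr (Fin.ext (by omega))
  · intro y hy
    by_cases h4 : y < S.size
    · obtain ⟨z, rfl⟩ := hg.surjective y ((h1 y h4).1.1 hy)
      exact ⟨.inl z, rfl⟩
    · have h5 : y < S.size + 8 := hy.1
      exact ⟨.inr ⟨y - S.size, by omega⟩, Nat.add_sub_cancel' (not_lt.1 h4)⟩
  · rintro (y | i)
    · exact (hg.v y).trans (h3 y).1.symm
    · exact (h2 i).2.1.symm
  · rintro (y | i)
    · refine Eq.trans ?_ (h3 y).2.2.1.symm
      rw [← hg.e, ← hg.e]
      by_cases h4 : y = x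
      · subst h4
        exact (congrArg _ (Cob.handleE_x C _)).trans (if_pos rfl).symm
      · refine Eq.trans ?_ (if_neg fun h => h4 (hg.injective h)).symm
        by_cases h5 : y = C.e x
        · subst h5
          exact (congrArg _ (Cob.handleE_ex C _)).trans (if_pos rfl).symm
        · refine Eq.trans ?_ (if_neg fun h => h5 (hg.injective h)).symm
          exact congrArg _ (Cob.handleE_inl C x h4 h5)
    · refine Eq.trans ?_ (h2 i).2.2.2.1.symm
      fin_cases i <;> first | rfl | exact hg.e x
  · rintro (y | i)
    · exact (hg.f y).trans (h3 y).2.1.symm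
    · exact (h2 i).2.2.1.symm
  · exact fun u => hg.i u
  · rintro (y | i)
    · exact (h3 y).2.2.2.1.trans (hg.o y)
    · refine (h2 i).2.2.2.2.1.trans ?_
      rw [hg.o]
      rfl
  · rintro (y | i)
    · exact (h3 y).2.2.2.2.trans (hg.s y)
    · exact (h2 i).2.2.2.2.2

theorem checkHandle_live {x : ℕ} (h : S.checkHandle x = true) : S.Live x := by
  simp only [checkHandle, Bool.and_eq_true, decide_eq_true_eq] at h
  exact h.1.1.2

theorem checkHandle_valid {x : ℕ} (h : S.checkHandle x = true) : (S.handle x).valid = true := by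
  simp only [checkHandle, Bool.and_eq_true, decide_eq_true_eq] at h
  exact h.1.1.1

theorem Numbers.hom_addHandle {C : Cob M N} {g : C.X → ℕ} (hg : S.Numbers C g) (x : C.X)
    (h : S.checkHandle (g x) = true) :
    CobCat.hom k ω (P := ⟨M, a⟩) (Q := ⟨N, b⟩) (C.addHandle x) = (S.handle (g x)).hom k ω a b :=
  (hg.addHandle h).hom_eq (valid_iff.1 (checkHandle_valid h))

/-- The flag `w` is reached from `y` by moving along the sides of a face. -/
def reaches (S : Net M N) (w : ℕ) : ℕ → ℕ → Bool
  | 0, y => Nat.beq y w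
  | n + 1, y => Nat.beq y w || reaches S w n (S.V (S.E y))

theorem reaches_spec {w n y : ℕ} (h : S.reaches w n y = true) :
    ∃ m, (fun z => S.V (S.E z))^[m] y = w := by
  induction n generalizing y with
  | zero => exact ⟨0, Nat.eq_of_beq_eq_true h⟩
  | succ n ih =>
    simp only [reaches, Bool.or_eq_true] at h
    rcases h with h | h
    · exact ⟨0, Nat.eq_of_beq_eq_true h⟩
    · obtain ⟨m, hm⟩ := ih h
      exact ⟨m + 1, hm⟩

/-- The neck along the edge of `x` can be cut. -/
def checkNeck (S : Net M N) (x : ℕ) : Bool :=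
  S.valid && (S.delEdge x).valid && checkEdge S (S.delEdge x) x &&
    S.reaches (S.F x) S.size (S.V x) && (S.delEdge x).checkHandle (S.E x) &&
    (S.delEdge x).checkHandle (S.E (S.V x))

theorem hom_neck {x : ℕ} (h : S.checkNeck x = true) :
    S.hom k ω a b = ⅟(2 : k) • (((S.delEdge x).handle (S.E x)).hom k ω a b +
      ((S.delEdge x).handle (S.E (S.V x))).hom k ω a b) := by
  simp only [checkNeck, Bool.and_eq_true, valid_iff] at h
  obtain ⟨⟨⟨⟨⟨hS, hT⟩, h1⟩, h2⟩, h3⟩, h4⟩ := h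
  rw [← hT.numbers.hom_addHandle (⟨_, checkHandle_live h3⟩ : (S.delEdge x).Flag) h3,
    ← hT.numbers.hom_addHandle (⟨_, checkHandle_live h4⟩ : (S.delEdge x).Flag) h4, hS.hom_eq]
  refine CobCat.hom_neck (P := ⟨M, a⟩) (Q := ⟨N, b⟩) (hS.deletesEdge hT h1 rfl) ?_ rfl rfl
  obtain ⟨m, hm⟩ := reaches_spec h2
  refine ⟨m, Subtype.ext (Eq.trans ?_ hm)⟩
  have : ∀ (m : ℕ) (y : S.Flag), (((fun w => hS.v (hS.e w))^[m] y : S.Flag) : ℕ) =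
      (fun z => S.V (S.E z))^[m] y := by
    intro m
    induction m with
    | zero => exact fun y => rfl
    | succ m ih => exact fun y => ih _
  exact this m _

/-- A move can be carried out. -/
def check (S : Net M N) (m : Move) : Bool :=
  (S.move m).valid &&
  match m with
  | .delEdge x => checkEdge S (S.delEdge x) x && (S.checkFace x && !isIn (S.face x) (S.F x) &&
      !Nat.beq (S.E x) (S.V x))
  -- An edge or vertex is added correctly if its deletion, at the first new flag `S.size`, gives
  -- back `S`.
  | .addEdge x y => checkEdge (S.addEdge x y) S S.size && ((S.addEdge x y).checkFace S.size &&
      !isIn ((S.addEdge x y).face S.size) ((S.addEdge x y).F S.size) &&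
      !Nat.beq ((S.addEdge x y).E S.size) ((S.addEdge x y).V S.size))
  | .delVertex x => checkVertex S (S.delVertex x) x
  | .addVertex x => checkVertex (S.addVertex x) S S.size
  | .capDisc x => checkFlip S (S.capDisc x) x &&
      (S.face x).all fun y => decide (S.Fr y = -1 ∧ (S.capDisc x).Fr y = 0)
  -- In the relation, `T` is the surface whose fringes point towards each other, and in `S` they
  -- point away from each other.
  | .flipQuad x => let T := S.flipQuad x
      checkFlip T S x && ((T.face x).all fun y =>
        decide ((T.Fr y = -1 ∧ T.Fr (T.E y) = 0 ∧ S.Fr y = 0) ∨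
          (T.Fr y = 0 ∧ T.Fr (T.E y) = -1 ∧ S.Fr y = 1))) &&
      decide ((fun w => T.V (T.E w))^[4] x = x ∧ (fun w => T.V (T.E w))^[2] x ≠ x)

/-- Several moves can be carried out. -/
def checks : Net M N → List Move → Bool
  | _, [] => true
  | S, m :: l => S.check m && checks (S.move m) l

/-- The exponent of `ω` in the relation given by a move. -/
def Move.weight : Move → ℕ
  | .capDisc _ => 1
  | .flipQuad _ => 1
  | _ => 0

theorem hom_move (hS : S.Valid) {m : Move} (h : S.check m = true) :
    S.hom k ω a b = (ω : k) ^ m.weight • (S.move m).hom k ω a b := by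
  obtain ⟨hT, h⟩ := (Bool.and_eq_true _ _).mp h
  rw [valid_iff] at hT
  cases m with
  | delEdge x =>
    obtain ⟨h1, h2⟩ := (Bool.and_eq_true _ _).mp h
    exact (hS.hom_delEdge hT h1 rfl h2).trans (by rw [show Move.weight (.delEdge x) = 0 from rfl, pow_zero, one_smul])
  | addEdge x y =>
    obtain ⟨h1, h2⟩ := (Bool.and_eq_true _ _).mp h
    exact (hT.hom_delEdge hS h1 rfl h2).symm.trans (by rw [show Move.weight (.addEdge x y) = 0 from rfl, pow_zero, one_smul])
  | delVertex x =>
    exact (hS.hom_delVertex hT h rfl).trans (by rw [show Move.weight (.delVertex x) = 0 from rfl, pow_zero, one_smul])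
  | addVertex x =>
    exact (hT.hom_delVertex hS h rfl).symm.trans (by rw [show Move.weight (.addVertex x) = 0 from rfl, pow_zero, one_smul])
  | capDisc x =>
    obtain ⟨h1, h2⟩ := (Bool.and_eq_true _ _).mp h
    exact (hS.hom_capDisc hT h1 rfl h2).trans (by rw [show Move.weight (.capDisc x) = 1 from rfl, pow_one])
  | flipQuad x =>
    obtain ⟨h1, h2⟩ := (Bool.and_eq_true _ _).mp h
    obtain ⟨h3, h4⟩ := (Bool.and_eq_true _ _).mp h1
    exact (hT.hom_flipQuad hS h3 rfl h4 (of_decide_eq_true h2)).trans (by rw [show Move.weight (.flipQuad x) = 1 from rfl, pow_one])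

theorem hom_run (hS : S.valid = true) (l : List Move) (h : S.checks l = true) :
    S.hom k ω a b = (ω : k) ^ (l.map Move.weight).sum • (S.run l).hom k ω a b := by
  induction l generalizing S with
  | nil => simp [run]
  | cons m l ih =>
    simp only [checks, Bool.and_eq_true] at h
    have hT : (S.move m).valid = true := ((Bool.and_eq_true _ _).mp h.1).1
    rw [hom_move (valid_iff.1 hS) h.1, ih hT h.2, smul_smul, ← pow_add]
    simp [run]

/-- The numbers of the flags of a surface `T` isomorphic to `S`, found by moving along both
surfaces; the numbers are stored as digits, increased by one. -/
def matching (S T : Net M N) : ℕ :=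
  let next (w : List (ℕ × ℕ) × ℕ) (p : ℕ × ℕ) : List (ℕ × ℕ) × ℕ :=
    if digit w.2 p.1 = 0 then (p :: w.1, w.2 + (p.2 + 1) <<< (8 * p.1)) else w
  let step (w : List (ℕ × ℕ) × ℕ) : List (ℕ × ℕ) × ℕ :=
    match w.1 with
    | [] => w
    | p :: l => next (next (next (l, w.2) (S.V p.1, T.V p.2)) (S.E p.1, T.E p.2)) (S.F p.1, T.F p.2)
  (Nat.rec ((bdry M N).foldl (fun w u => next w (S.i u, T.i u)) ([], 0))
    (fun _ w => step w) S.size : List (ℕ × ℕ) × ℕ).2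

/-- `φ` and `ψ` define an isomorphism of the surfaces with codes `S` and `T`. -/
def checkIsoWith (φ ψ : ℕ → ℕ) (S T : Net M N) : Bool :=
  T.valid &&
  (allBelow S.size fun x => !decide (S.Live x) || decide (T.Live (φ x) ∧ ψ (φ x) = x ∧
    φ (S.V x) = T.V (φ x) ∧ φ (S.E x) = T.E (φ x) ∧ φ (S.F x) = T.F (φ x) ∧
    T.Or (φ x) = S.Or x ∧ T.Fr (φ x) = S.Fr x)) &&
  (allBelow T.size fun x => !decide (T.Live x) || decide (S.Live (ψ x) ∧ φ (ψ x) = x)) &&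
  (bdry M N).all fun u => decide (φ (S.i u) = T.i u)

/-- `S` and `T` are codes of isomorphic surfaces. -/
def checkIso (S T : Net M N) : Bool :=
  let p := matching S T
  let q := matching T S
  checkIsoWith (fun x => digit p x - 1) (fun x => digit q x - 1) S T

theorem hom_iso_of_checkIsoWith {φ ψ : ℕ → ℕ} (hS : S.valid = true)
    (h : checkIsoWith φ ψ S T = true) : S.hom k ω a b = T.hom k ω a b := by
  rw [valid_iff] at hS
  rw [hS.hom_eq]
  unfold checkIsoWith at h
  simp only [Bool.and_eq_true, allBelow_iff, decide_eq_true_eq, Bool.or_eq_true,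
    Bool.not_eq_true', decide_eq_false_iff_not, valid_iff, List.all_eq_true] at h
  obtain ⟨⟨⟨hT, h1⟩, h2⟩, h3⟩ := h
  have h4 := fun (y : S.Flag) => (h1 y y.2.1).resolve_left (not_not.2 y.2)
  refine Numbers.hom_eq (g := fun y : S.Flag => φ y) ⟨fun y => (h4 y).1, ?_, ?_,
    fun y => (h4 y).2.2.1, fun y => (h4 y).2.2.2.1, fun y => (h4 y).2.2.2.2.1,
    fun u => h3 u (mem_bdry u), fun y => (h4 y).2.2.2.2.2.1, fun y => (h4 y).2.2.2.2.2.2⟩ hT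
  · intro (y : S.Flag) (z : S.Flag) hyz
    exact Subtype.ext ((h4 y).2.1.symm.trans ((congrArg ψ hyz).trans (h4 z).2.1))
  · intro x hx
    have := (h2 x hx.1).resolve_left (not_not.2 hx)
    exact ⟨(⟨ψ x, this.1⟩ : S.Flag), this.2⟩

/-- Nothing has to be known about `matching`: the two numberings that it proposes are verified to be
inverse isomorphisms. -/
theorem hom_iso (hS : S.valid = true) (h : checkIso S T = true) :
    S.hom k ω a b = T.hom k ω a b :=
  hom_iso_of_checkIsoWith (φ := fun x => digit (matching S T) x - 1)
    (ψ := fun x => digit (matching T S) x - 1) hS h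

/-- The code of a composition. -/
def checkGlue (X : List N.X) (S : Net M N) (T : Net N L) : Bool :=
  let U := glue X S T
  U.valid &&
  (allBelow S.size fun y => decide (U.Live y ↔ S.Live y) && (!decide (S.Live y) ||
    decide (U.V y = S.V y ∧ U.E y = S.E y ∧ U.Or y = S.Or y ∧ U.Fr y = S.Fr y) &&
    ((X.any fun n => Nat.beq (S.i (.inr n)) y) || Nat.beq (U.F y) (S.F y)))) &&
  (allBelow T.size fun y => decide (U.Live (S.size + y) ↔ T.Live y) && (!decide (T.Live y) ||
    decide (U.V (S.size + y) = S.size + T.V y ∧ U.E (S.size + y) = S.size + T.E y ∧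
      U.Or (S.size + y) = T.Or y ∧ U.Fr (S.size + y) = T.Fr y) &&
    ((X.any fun n => Nat.beq (T.i (.inl n)) y) || Nat.beq (U.F (S.size + y)) (S.size + T.F y)))) &&
  X.all fun n => decide (U.F (S.i (.inr n)) = S.size + T.i (.inl n) ∧
    U.F (S.size + T.i (.inl n)) = S.i (.inr n))

theorem hom_glue {X : List N.X} (hX : ∀ n, n ∈ X) {S : Net M N} {T : Net N L}
    (hS : S.valid = true) (hT : T.valid = true) (h : checkGlue X S T = true) :
    S.hom k ω a b ≫ T.hom k ω b c = (glue X S T).hom k ω a c := by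
  rw [valid_iff] at hS hT
  rw [hS.hom_eq, hT.hom_eq]
  refine (CobCat.hom_comp (P := ⟨M, a⟩) (Q := ⟨N, b⟩) (R := ⟨L, c⟩) hS.toCob hT.toCob).trans ?_
  simp only [checkGlue, Bool.and_eq_true, allBelow_iff, decide_eq_true_eq, Bool.or_eq_true,
    Bool.not_eq_true', decide_eq_false_iff_not, valid_iff, List.all_eq_true, List.any_eq_true,
    Nat.beq_eq] at h
  obtain ⟨⟨⟨hU, h1⟩, h2⟩, h3⟩ := h
  have h4 := fun (y : S.Flag) => (h1 y y.2.1).2.resolve_left (not_not.2 y.2)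
  have h5 := fun (y : T.Flag) => (h2 y y.2.1).2.resolve_left (not_not.2 y.2)
  refine Numbers.hom_eq
    (g := Sum.elim (fun y : S.Flag => (y : ℕ)) fun y : T.Flag => S.size + y) ?_ hU
  constructor
  · rintro ((y : S.Flag) | (y : T.Flag))
    · exact (h1 y y.2.1).1.2 y.2
    · exact (h2 y y.2.1).1.2 y.2
  · rintro ((y : S.Flag) | (y : T.Flag)) ((z : S.Flag) | (z : T.Flag)) hyz
    · exact congrArg Sum.inl (Subtype.ext hyz)
    · have h6 := y.2.1
      have h7 : (y : ℕ) = S.size + z := hyz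
      omega
    · have h6 := z.2.1
      have h7 : S.size + y = z := hyz
      omega
    · have h7 : S.size + y = S.size + z := hyz
      exact congrArg Sum.inr (Subtype.ext (by omega))
  · intro y hy
    by_cases h6 : y < S.size
    · exact ⟨.inl ⟨y, (h1 y h6).1.1 hy⟩, rfl⟩
    · have h7 : y < S.size + T.size := hy.1
      have h8 := (h2 (y - S.size) (by omega)).1
      rw [Nat.add_sub_cancel' (by omega)] at h8
      exact ⟨.inr ⟨y - S.size, h8.1 hy⟩, Nat.add_sub_cancel' (by omega)⟩
  · rintro ((y : S.Flag) | (y : T.Flag))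
    · exact (h4 y).1.1.symm
    · exact (h5 y).1.1.symm
  · rintro ((y : S.Flag) | (y : T.Flag))
    · exact (h4 y).1.2.1.symm
    · exact (h5 y).1.2.1.symm
  · intro y
    induction y using Cob.glue_cases hS.toCob hT.toCob with
    | h1 n =>
      refine (congrArg _ (Cob.glueF_inl_i hS.toCob hT.toCob n)).trans ?_
      exact (h3 n (hX n)).1.symm
    | h2 n =>
      refine (congrArg _ (Cob.glueF_inr_i hS.toCob hT.toCob n)).trans ?_
      exact (h3 n (hX n)).2.symm
    | h3 y hy =>
      refine (congrArg _ (Cob.glueF_inl hS.toCob hT.toCob hy)).trans ?_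
      refine ((h4 y).2.resolve_left ?_).symm
      rintro ⟨n, -, hn⟩
      exact hy ⟨n, Subtype.ext hn⟩
    | h4 y hy =>
      refine (congrArg _ (Cob.glueF_inr hS.toCob hT.toCob hy)).trans ?_
      refine ((h5 y).2.resolve_left ?_).symm
      rintro ⟨n, -, hn⟩
      exact hy ⟨n, Subtype.ext hn⟩
  · rintro (u | u) <;> rfl
  · rintro ((y : S.Flag) | (y : T.Flag))
    · exact (h4 y).1.2.2.1
    · exact (h5 y).1.2.2.1
  · rintro ((y : S.Flag) | (y : T.Flag))
    · exact (h4 y).1.2.2.2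
    · exact (h5 y).1.2.2.2

/-- The moves `l` lead from `S` to `T`. -/
def checkTo (S T : Net M N) (l : List Move) : Bool :=
  S.checks l && checkIso (S.run l) T

theorem valid_run (hS : S.valid = true) {l : List Move} (h : S.checks l = true) :
    (S.run l).valid = true := by
  induction l generalizing S with
  | nil => exact hS
  | cons m l ih =>
    simp only [checks, Bool.and_eq_true] at h
    exact ih ((Bool.and_eq_true _ _).mp h.1).1 h.2

theorem hom_eq_of_checkTo (hS : S.valid = true) {l : List Move} (h : checkTo S T l = true) :
    S.hom k ω a b = (ω : k) ^ (l.map Move.weight).sum • T.hom k ω a b := by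
  simp only [checkTo, Bool.and_eq_true] at h
  rw [hom_run hS l h.1, hom_iso (valid_run hS h.1) h.2]

/-- The moves `l`, followed by cutting a neck along the edge of `x`, and by the moves `l₁` and `l₂`
respectively, lead from `S` to `T₁` and `T₂`. -/
def checkCut (S : Net M N) (l : List Move) (x : ℕ) (l₁ l₂ : List Move) (T₁ T₂ : Net M N) : Bool :=
  S.checks l && (S.run l).checkNeck x &&
  checkTo (((S.run l).delEdge x).handle ((S.run l).E x)) T₁ l₁ &&
  checkTo (((S.run l).delEdge x).handle ((S.run l).E ((S.run l).V x))) T₂ l₂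

/-- Most identities below have this form: the cell decomposition is changed until a face is an
annulus cut open along an edge, the neck is cut there, and both summands are simplified, with powers
of `ω` for the moves that affect seams. -/
theorem hom_eq_of_checkCut (hS : S.valid = true) {l : List Move} {x : ℕ} {l₁ l₂ : List Move}
    {T₁ T₂ : Net M N} (h : S.checkCut l x l₁ l₂ T₁ T₂ = true) :
    S.hom k ω a b = (ω : k) ^ (l.map Move.weight).sum • ⅟(2 : k) •
      ((ω : k) ^ (l₁.map Move.weight).sum • T₁.hom k ω a b +
        (ω : k) ^ (l₂.map Move.weight).sum • T₂.hom k ω a b) := by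
  simp only [checkCut, Bool.and_eq_true] at h
  obtain ⟨⟨⟨h1, h2⟩, h3⟩, h4⟩ := h
  rw [hom_run hS l h1, hom_neck h2]
  simp only [checkNeck, Bool.and_eq_true] at h2
  rw [hom_eq_of_checkTo (checkHandle_valid h2.1.2) h3, hom_eq_of_checkTo (checkHandle_valid h2.2) h4]

end Net

end Soundness
-- The codes describe the saddle and the identities
section Codes

instance : Fintype orientedSmoothing.X := inferInstanceAs (Fintype Corner)
instance : Fintype disorientedSmoothing.X := inferInstanceAs (Fintype (Corner × Bool))
instance : Fintype saddle.X := inferInstanceAs (Fintype (Corner × Fin 4))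
instance : DecidableEq saddle.X := inferInstanceAs (DecidableEq (Corner × Fin 4))

instance : DecidableEq orientedSmoothing.X := inferInstanceAs (DecidableEq Corner)
instance : DecidableEq disorientedSmoothing.X := inferInstanceAs (DecidableEq (Corner × Bool))

instance : Fintype (Cob.id orientedSmoothing).X := inferInstanceAs (Fintype
  ((orientedSmoothing.X × Bool) ⊕ ({x // orientedSmoothing.e x ≠ x} × Bool)))
instance : DecidableEq (Cob.id orientedSmoothing).X := inferInstanceAs (DecidableEq
  ((orientedSmoothing.X × Bool) ⊕ ({x // orientedSmoothing.e x ≠ x} × Bool)))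
instance : Fintype (Cob.id disorientedSmoothing).X := inferInstanceAs (Fintype
  ((disorientedSmoothing.X × Bool) ⊕ ({x // disorientedSmoothing.e x ≠ x} × Bool)))
instance : DecidableEq (Cob.id disorientedSmoothing).X := inferInstanceAs (DecidableEq
  ((disorientedSmoothing.X × Bool) ⊕ ({x // disorientedSmoothing.e x ≠ x} × Bool)))

namespace Net

variable {B : Type}

theorem Numbers.forget {M N : Curve ℤˣ B} [M.Listed] [N.Listed] {S : Net M N} {C : Cob M N}
    {g : C.X → ℕ} (hg : S.Numbers C g) : S.forget.Numbers C.forget g :=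
  ⟨hg.live, hg.injective, hg.surjective, hg.v, hg.e, hg.f, hg.i, fun _ => rfl, fun x => by
    change fringe (digit 0 (g x)) = 0
    simp [digit, fringe]⟩

theorem numbers_saddle : saddle.Numbers Disor.saddle
    fun x : Corner × Fin 4 => 4 * Corner.index x.1 + x.2 :=
  ⟨by decide +kernel, by unfold Function.Injective; decide +kernel,
    fun x hx => (by decide +kernel : ∀ x < 16, ∃ y : Corner × Fin 4,
      4 * Corner.index y.1 + y.2 = x) x hx.1,
    by decide +kernel, by decide +kernel, by decide +kernel, by decide +kernel, by decide +kernel,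
    by decide +kernel⟩

/-- A numbering of the flags of the identity of the oriented smoothing. -/
def numberOriented : (Cob.id orientedSmoothing).X → ℕ :=
  Sum.elim (fun x : Corner × Bool => 2 * Corner.index x.1 + if x.2 then 1 else 0) fun _ => 0

theorem numbers_idOriented : idOriented.Numbers (Cob.id orientedSmoothing) numberOriented :=
  ⟨by decide +kernel, by unfold Function.Injective; decide +kernel,
    fun x hx => (by decide +kernel : ∀ x < 8, ∃ y, numberOriented y = x) x hx.1,
    by decide +kernel, by
      -- The exchange of edges in a product is a classical case distinction, which cannot be
      -- evaluated and is resolved by hand. Here all vertices are boundary points, so the second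
      -- kind of flags does not occur.
      rintro (x | x)
      · exact (congrArg numberOriented (dif_neg fun h => h rfl)).trans
          ((by decide +kernel : ∀ x : Corner × Bool,
            2 * Corner.index x.1 + (if !x.2 then 1 else 0) =
              idOriented.E (2 * Corner.index x.1 + if x.2 then 1 else 0)) x)
      · exact (x.1.2 rfl).elim,
    by decide +kernel, by decide +kernel, by decide +kernel, by decide +kernel⟩

/-- A numbering of the flags of the identity of the disoriented smoothing. -/
def numberDisoriented : (Cob.id disorientedSmoothing).X → ℕ :=
  Sum.elim (fun x : (Corner × Bool) × Bool => 4 * Corner.index x.1.1 + (if x.1.2 then 2 else 0) +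
      if x.2 then 1 else 0) fun x => 16 + 2 * Corner.index x.1.1.1 + if x.2 then 1 else 0

theorem numbers_idDisoriented :
    idDisoriented.Numbers (Cob.id disorientedSmoothing) numberDisoriented :=
  ⟨by decide +kernel, by unfold Function.Injective; decide +kernel,
    fun x hx => (by decide +kernel : ∀ x < 24, ∃ y, numberDisoriented y = x) x hx.1,
    by decide +kernel, by
      rintro (⟨⟨c, _ | _⟩, t⟩ | x)
      · have h : disorientedSmoothing.e (c, false) ≠ (c, false) := fun h => by
          have : (!c.2) = c.2 := congrArg (fun x : Corner × Bool => x.1.2) h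
          simp at this
        exact (congrArg numberDisoriented (dif_pos h)).trans
          ((by decide +kernel : ∀ (c : Corner) (t : Bool),
            16 + 2 * Corner.index c + (if t then 1 else 0) =
              idDisoriented.E (4 * Corner.index c + 0 + if t then 1 else 0)) c t)
      · exact (congrArg numberDisoriented (dif_neg fun h => h rfl)).trans
          ((by decide +kernel : ∀ (c : Corner) (t : Bool),
            4 * Corner.index c + 2 + (if !t then 1 else 0) =
              idDisoriented.E (4 * Corner.index c + 2 + if t then 1 else 0)) c t)
      · revert x
        exact (by decide +kernel : ∀ x : {x // disorientedSmoothing.e x ≠ x} × Bool,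
          4 * Corner.index x.1.1.1 + (if x.1.1.2 then 2 else 0) + (if x.2 then 1 else 0) =
          idDisoriented.E (16 + 2 * Corner.index x.1.1.1 + if x.2 then 1 else 0)),
    by decide +kernel, by decide +kernel, by decide +kernel, by decide +kernel⟩

end Net

end Codes
-- Handles and the composites of the saddle with its reverse
section Identities

universe u
variable {k : Type u} [CommRing k] [Invertible (2 : k)] {ω : kˣ} {a b : ℤ}

namespace Net

/-- `(Cob.id M).forget` and `Cob.id M.forget` have the same flags, and their operations agree by
definition once it is known of which of the two kinds a flag is. -/
theorem Numbers.forget_id {B : Type} {M : Curve ℤˣ B} [M.Listed] {S : Net M M}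
    {g : (Cob.id M).X → ℕ} (h : S.Numbers (Cob.id M) g) :
    S.forget.Numbers (Cob.id M.forget) g := by
  have h := h.forget
  refine ⟨h.live, h.injective, h.surjective, h.v, ?_, ?_, h.i, fun _ => rfl, ?_⟩
  · rintro (x | x)
    · exact h.e (.inl x)
    · exact h.e (.inr x)
  · rintro (x | x)
    · exact h.f (.inl x)
    · exact h.f (.inr x)
  · rintro (x | x)
    · exact h.s (.inl x)
    · exact h.s (.inr x)

/-- The oriented smoothing times an interval, with a handle at a corner. -/
def handleOriented (c : Corner) : Net orientedSmoothing orientedSmoothing :=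
  idOriented.handle (idOriented.i (.inl c))

/-- The disoriented smoothing times an interval, with a handle at a corner. -/
def handleDisoriented (c : Corner) : Net disorientedSmoothing disorientedSmoothing :=
  idDisoriented.handle (idDisoriented.i (.inl (c, true)))

/-- The unoriented smoothing times an interval, with a handle at a corner. -/
def handleOrientedForget (c : Corner) : Net orientedSmoothing.forget orientedSmoothing.forget :=
  idOriented.forget.handle (idOriented.i (.inl c))

/-- The unoriented smoothing times an interval, with a handle at a corner. -/
def handleDisorientedForget (c : Corner) :
    Net disorientedSmoothing.forget disorientedSmoothing.forget :=
  idDisoriented.forget.handle (idDisoriented.i (.inl (c, true)))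

theorem hom_handleAt_orientedSmoothing (c : Corner) :
    CobCat.hom k ω (P := ⟨orientedSmoothing, a⟩) (Q := ⟨orientedSmoothing, b⟩)
      (Cob.handleAt orientedSmoothing c) = (handleOriented c).hom k ω a b :=
  numbers_idOriented.hom_addHandle (.inl (c, false))
    ((by decide +kernel : ∀ c, idOriented.checkHandle (idOriented.i (.inl c)) = true) c)

theorem hom_handleAt_disorientedSmoothing (c : Corner) :
    CobCat.hom k ω (P := ⟨disorientedSmoothing, a⟩) (Q := ⟨disorientedSmoothing, b⟩)
      (Cob.handleAt disorientedSmoothing c) = (handleDisoriented c).hom k ω a b :=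
  numbers_idDisoriented.hom_addHandle (.inl ((c, true), false))
    ((by decide +kernel : ∀ c : Corner,
      idDisoriented.checkHandle (idDisoriented.i (.inl (c, true))) = true) c)

theorem hom_handleAt_orientedSmoothing_forget (c : Corner) :
    CobCat.hom k ω (P := ⟨orientedSmoothing.forget, a⟩) (Q := ⟨orientedSmoothing.forget, b⟩)
      (Cob.handleAt orientedSmoothing.forget c) = (handleOrientedForget c).hom k ω a b :=
  numbers_idOriented.forget_id.hom_addHandle (.inl (c, false))
    ((by decide +kernel : ∀ c : Corner,
      idOriented.forget.checkHandle (idOriented.i (.inl c)) = true) c)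

theorem hom_handleAt_disorientedSmoothing_forget (c : Corner) :
    CobCat.hom k ω (P := ⟨disorientedSmoothing.forget, a⟩)
      (Q := ⟨disorientedSmoothing.forget, b⟩) (Cob.handleAt disorientedSmoothing.forget c) =
      (handleDisorientedForget c).hom k ω a b :=
  numbers_idDisoriented.forget_id.hom_addHandle (.inl ((c, true), false))
    ((by decide +kernel : ∀ c : Corner,
      idDisoriented.forget.checkHandle (idDisoriented.i (.inl (c, true))) = true) c)

theorem valid_saddle : saddle.valid = true := by decide +kernel
theorem valid_coSaddle : coSaddle.valid = true := by decide +kernel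
theorem valid_saddle_forget : saddle.forget.valid = true := by decide +kernel
theorem valid_coSaddle_forget : coSaddle.forget.valid = true := by decide +kernel

/-- In both composites the handle is attached to the sheet of the saddle at `c`, on the same side of
the seam, so the surfaces are homeomorphic. Their cell decompositions become isomorphic when the
middle curve is deleted from both. -/
theorem hom_handle_comp_saddle (c : Corner) :
    (handleOriented c).hom k ω a a ≫ saddle.hom k ω a b =
      saddle.hom k ω a b ≫ (handleDisoriented c).hom k ω b b := by
  have key : ∀ c : Corner, (handleOriented c).valid = true ∧ (handleDisoriented c).valid = true ∧
      checkGlue Curve.Listed.elems (handleOriented c) saddle = true ∧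
      checkGlue Curve.Listed.elems saddle (handleDisoriented c) = true ∧
      (glue Curve.Listed.elems (handleOriented c) saddle).valid = true ∧
      (glue Curve.Listed.elems saddle (handleDisoriented c)).valid = true ∧
      (glue Curve.Listed.elems saddle (handleDisoriented c)).checks
        [.delEdge 1, .delEdge 5, .delEdge 9, .delEdge 13, .delVertex 3, .delVertex 11] = true ∧
      checkTo (glue Curve.Listed.elems (handleOriented c) saddle)
        ((glue Curve.Listed.elems saddle (handleDisoriented c)).run
          [.delEdge 1, .delEdge 5, .delEdge 9, .delEdge 13, .delVertex 3, .delVertex 11])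
        [.delEdge 1, .delEdge 3] = true := by
    decide +kernel
  obtain ⟨h1, h2, h3, h4, h5, h6, h7, h8⟩ := key c
  rw [hom_glue Curve.Listed.mem_elems h1 valid_saddle h3,
    hom_glue Curve.Listed.mem_elems valid_saddle h2 h4, hom_eq_of_checkTo h5 h8, hom_run h6 _ h7]
  -- None of the moves affects a seam, so `ω` occurs with exponent 0 on both sides.
  rfl

theorem hom_handle_comp_saddle_forget (c : Corner) :
    (handleOrientedForget c).hom k ω a a ≫ saddle.forget.hom k ω a b =
      saddle.forget.hom k ω a b ≫ (handleDisorientedForget c).hom k ω b b := by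
  have key : ∀ c : Corner,
      (handleOrientedForget c).valid = true ∧ (handleDisorientedForget c).valid = true ∧
      checkGlue Curve.Listed.elems (handleOrientedForget c) saddle.forget = true ∧
      checkGlue Curve.Listed.elems saddle.forget (handleDisorientedForget c) = true ∧
      (glue Curve.Listed.elems (handleOrientedForget c) saddle.forget).valid = true ∧
      (glue Curve.Listed.elems saddle.forget (handleDisorientedForget c)).valid = true ∧
      (glue Curve.Listed.elems saddle.forget (handleDisorientedForget c)).checks
        [.delEdge 1, .delEdge 5, .delEdge 9, .delEdge 13, .delVertex 3, .delVertex 11] = true ∧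
      checkTo (glue Curve.Listed.elems (handleOrientedForget c) saddle.forget)
        ((glue Curve.Listed.elems saddle.forget (handleDisorientedForget c)).run
          [.delEdge 1, .delEdge 5, .delEdge 9, .delEdge 13, .delVertex 3, .delVertex 11])
        [.delEdge 1, .delEdge 3] = true := by
    decide +kernel
  obtain ⟨h1, h2, h3, h4, h5, h6, h7, h8⟩ := key c
  rw [hom_glue Curve.Listed.mem_elems h1 valid_saddle_forget h3,
    hom_glue Curve.Listed.mem_elems valid_saddle_forget h2 h4, hom_eq_of_checkTo h5 h8,
    hom_run h6 _ h7]
  rfl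

/-- The saddle followed by its reverse, after the removal of two edges and cutting of the neck. -/
def disc : Net orientedSmoothing orientedSmoothing :=
  (glue Curve.Listed.elems saddle coSaddle).run [.delEdge 9, .delEdge 5, .delEdge 13]

/-- The part of `disc` enclosed by the seam, with a handle, is connected with the other part by a
tube. -/
def discTube : Net orientedSmoothing orientedSmoothing :=
  (((((disc.addVertex 11).addVertex 33).addEdge 11 2).addEdge 2 37).addEdge 33 41).addEdge 49 37

/-- A handle is moved across a seam that bounds a half-disc. -/
theorem hom_disc_handle :
    (disc.handle 0).hom k ω a b = (ω : k) ^ 2 • (disc.handle 15).hom k ω a b := by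
  have h1 : discTube.valid = true := by decide +kernel
  -- The tube is an annulus formed by two quadrilaterals, and both of its ends straddle the seam. As
  -- it stands, it belongs to the part outside the seam. Cutting it leaves twice `disc` with a
  -- handle outside the seam, and the factor `½` compensates for this.
  have h2 : discTube.checkCut
      [.delEdge 53, .delEdge 49, .addEdge 0 45, .delEdge 41, .addEdge 57 0, .delEdge 45] 61
      [.delEdge 57, .delVertex 32, .delVertex 37] [.delEdge 57, .delVertex 32, .delVertex 37]
      (disc.handle 0) (disc.handle 0) = true := by decide +kernel
  -- The first quadrilateral has two opposite sides on the seam; after it is flipped, so does the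
  -- second. Flipping both carries the whole tube to the inner side of the seam and costs `ω ^ 2`.
  -- Cutting it now leaves twice `disc` with a handle inside the seam.
  have h3 : discTube.checkCut
      [.flipQuad 42, .flipQuad 49, .delEdge 53, .delEdge 37, .addEdge 31 11, .delEdge 42,
        .addEdge 57 31, .delEdge 11] 61
      [.delEdge 57, .delVertex 49, .delVertex 46] [.delEdge 56, .delVertex 49, .delVertex 46]
      (disc.handle 15) (disc.handle 15) = true := by decide +kernel
  have h4 := (hom_eq_of_checkCut (k := k) (ω := ω) (a := a) (b := b) h1 h2).symm.trans
    (hom_eq_of_checkCut h1 h3)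
  simpa [Move.weight, ← two_smul k, smul_smul] using h4

/-- The composite is an annulus joining the left to the right strip, with a circular seam along the
neck. After a cut to the right of the seam, the seam bounds a disc in the left strip, and its fringe
points into the disc. If the handle is on the right strip, the seam is removed for a factor `ω`. If
the handle is in the disc, it is moved out of it first, which gives the sign because of `ω² = -1`.
-/
theorem hom_saddle_comp_coSaddle (hω : (ω : k) ^ 2 = -1) :
    saddle.hom k ω a b ≫ coSaddle.hom k ω b a = (⅟(2 : k) * ω) •
      ((handleOriented topRight).hom k ω a a - (handleOriented bottomLeft).hom k ω a a) := by
  have h1 : checkGlue Curve.Listed.elems saddle coSaddle = true := by decide +kernel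
  have h2 : (glue Curve.Listed.elems saddle coSaddle).valid = true := by decide +kernel
  -- The edge of 13 is on the right of the seam. The first summand has its handle on the right
  -- strip; the second one, with the handle at 15 inside the seam, is left to `hom_disc_handle`.
  have h3 : (glue Curve.Listed.elems saddle coSaddle).checkCut [.delEdge 9, .delEdge 5] 13
      [.capDisc 7, .addEdge 24 11, .delEdge 7, .delVertex 23, .delVertex 42, .delEdge 1] []
      (handleOriented topRight) (disc.handle 15) = true := by decide +kernel
  have h4 : (disc.handle 0).valid = true := by decide +kernel
  have h5 : checkTo (disc.handle 0) (handleOriented bottomLeft)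
      [.capDisc 7, .addEdge 24 11, .delEdge 7, .delVertex 23, .delVertex 42, .delEdge 1] = true := by
    decide +kernel
  have h6 := hom_disc_handle (k := k) (ω := ω) (a := a) (b := a)
  rw [hom_eq_of_checkTo h4 h5, hω] at h6
  rw [hom_glue Curve.Listed.mem_elems valid_saddle valid_coSaddle h1, hom_eq_of_checkCut h2 h3]
  simp only [Move.weight, List.map_cons, List.map_nil, List.sum_cons, List.sum_nil, pow_zero,
    one_smul, add_zero, pow_one, neg_smul] at h6 ⊢
  rw [eq_neg_iff_add_eq_zero] at h6
  rw [mul_smul, smul_sub, eq_neg_of_add_eq_zero_right h6, sub_eq_add_neg]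

/-- The identity of the disoriented smoothing, with a tube across the lower seam. -/
def idTube : Net disorientedSmoothing disorientedSmoothing :=
  (((((idDisoriented.addVertex 17).addVertex 25).addEdge 17 0).addEdge 0 29).addEdge 25
    33).addEdge 41 29

/-- As in `hom_disc_handle`, a tube straddling the seam, here the product of the lower mark with the
interval, is carried from the left side to the right side by flipping its two quadrilaterals. -/
theorem hom_idDisoriented_handle :
    (handleDisoriented (false, false)).hom k ω a b =
      (ω : k) ^ 2 • (handleDisoriented (false, true)).hom k ω a b := by
  have h1 : idTube.valid = true := by decide +kernel
  have h2 : idTube.checkCut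
      [.delEdge 45, .delEdge 41, .addEdge 3 37, .delEdge 33, .addEdge 49 3, .delEdge 37] 53
      [.delEdge 49, .delVertex 24, .delVertex 29] [.delEdge 49, .delVertex 24, .delVertex 29]
      (handleDisoriented (false, false)) (handleDisoriented (false, false)) = true := by
    decide +kernel
  have h3 : idTube.checkCut
      [.flipQuad 34, .flipQuad 41, .delEdge 45, .delEdge 29, .addEdge 6 17, .delEdge 34,
        .addEdge 49 6, .delEdge 17] 53
      [.delEdge 49, .delVertex 41, .delVertex 38] [.delEdge 49, .delVertex 41, .delVertex 38]
      (handleDisoriented (false, true)) (handleDisoriented (false, true)) = true := by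
    decide +kernel
  have h4 := (hom_eq_of_checkCut (k := k) (ω := ω) (a := a) (b := b) h1 h2).symm.trans
    (hom_eq_of_checkCut h1 h3)
  simpa [Move.weight, ← two_smul k, smul_smul] using h4

/-- The composite has one seam with both ends in the source and one with both ends in the target; on
the left of them the fringes point away from each other. Flipping the quadrilateral between them
costs `ω` and makes the seams run from source to target. Cutting the neck then leaves the cylinder
with a handle at the bottom right or the top right, and the former is moved to the bottom left with
a sign. -/
theorem hom_coSaddle_comp_saddle (hω : (ω : k) ^ 2 = -1) :
    coSaddle.hom k ω b a ≫ saddle.hom k ω a b = (⅟(2 : k) * ω) •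
      ((handleDisoriented topRight).hom k ω b b - (handleDisoriented bottomLeft).hom k ω b b) := by
  have h1 : checkGlue Curve.Listed.elems coSaddle saddle = true := by decide +kernel
  have h2 : (glue Curve.Listed.elems coSaddle saddle).valid = true := by decide +kernel
  have h3 : (glue Curve.Listed.elems coSaddle saddle).checkCut
      [.delEdge 0, .delEdge 4, .addEdge 3 18, .addEdge 10 27, .flipQuad 3, .addEdge 5 29,
        .delEdge 7, .delEdge 31] 41 [] []
      (handleDisoriented (false, true)) (handleDisoriented topRight) = true := by decide +kernel
  have h4 := hom_idDisoriented_handle (k := k) (ω := ω) (a := b) (b := b)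
  rw [hom_glue Curve.Listed.mem_elems valid_coSaddle valid_saddle h1, hom_eq_of_checkCut h2 h3]
  simp only [Move.weight, List.map_cons, List.map_nil, List.sum_cons, List.sum_nil, pow_zero,
    one_smul, add_zero, pow_one, zero_add] at h4 ⊢
  rw [show handleDisoriented bottomLeft = handleDisoriented (false, false) from rfl, h4, hω,
    neg_one_smul, sub_neg_eq_add, smul_smul, mul_comm, add_comm]

/-- Without seams, cutting the neck between the two strips gives both handle terms directly, with
the same sign. -/
theorem hom_saddle_comp_coSaddle_forget :
    saddle.forget.hom k ω a b ≫ coSaddle.forget.hom k ω b a = ⅟(2 : k) •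
      ((handleOrientedForget topRight).hom k ω a a +
        (handleOrientedForget bottomLeft).hom k ω a a) := by
  have h1 : checkGlue Curve.Listed.elems saddle.forget coSaddle.forget = true := by decide +kernel
  have h2 : (glue Curve.Listed.elems saddle.forget coSaddle.forget).valid = true := by
    decide +kernel
  have h3 : (glue Curve.Listed.elems saddle.forget coSaddle.forget).checkCut
      [.delEdge 3, .delEdge 19, .delVertex 2, .delVertex 10, .addEdge 0 12, .delEdge 1,
        .delEdge 9] 33 [] []
      (handleOrientedForget bottomLeft) (handleOrientedForget topRight) = true := by decide +kernel
  rw [hom_glue Curve.Listed.mem_elems valid_saddle_forget valid_coSaddle_forget h1,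
    hom_eq_of_checkCut h2 h3]
  simp [Move.weight, add_comm]

theorem hom_coSaddle_comp_saddle_forget :
    coSaddle.forget.hom k ω b a ≫ saddle.forget.hom k ω a b = ⅟(2 : k) •
      ((handleDisorientedForget topRight).hom k ω b b +
        (handleDisorientedForget bottomLeft).hom k ω b b) := by
  have h1 : checkGlue Curve.Listed.elems coSaddle.forget saddle.forget = true := by decide +kernel
  have h2 : (glue Curve.Listed.elems coSaddle.forget saddle.forget).valid = true := by
    decide +kernel
  -- The edges of 16 and 20 in the cylinder are the products of the two marks with the interval.
  -- They are no longer seams and are deleted, so that each sheet is one face apart from its handle.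
  have h3 : (glue Curve.Listed.elems coSaddle.forget saddle.forget).checkCut
      [.delEdge 3, .delEdge 19, .addEdge 1 13, .delEdge 0, .delEdge 4] 33 [] []
      ((handleDisorientedForget bottomLeft).run [.delEdge 16, .delEdge 20])
      ((handleDisorientedForget topRight).run [.delEdge 16, .delEdge 20]) = true := by
    decide +kernel
  have h4 : ∀ c : Corner, (handleDisorientedForget c).valid = true ∧
      (handleDisorientedForget c).checks [.delEdge 16, .delEdge 20] = true := by decide +kernel
  rw [hom_glue Curve.Listed.mem_elems valid_coSaddle_forget valid_saddle_forget h1,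
    hom_eq_of_checkCut h2 h3, hom_run (h4 topRight).1 _ (h4 topRight).2,
    hom_run (h4 bottomLeft).1 _ (h4 bottomLeft).2]
  simp [Move.weight, add_comm]

end Net
end Identities
-- Products over the orbits of two maps
section Orbits

variable {X Y C : Type} {a b : X → X} {a' b' : Y → Y} {G : Type*} [CommGroup G]

theorem Around.eq_of_eq {Z : Type*} {g : X → Z} (ha : ∀ x, g (a x) = g x) (hb : ∀ x, g (b x) = g x)
    {x y : X} (h : Around a b x y) : g x = g y := by
  induction h with
  | rel x y h => rcases h with rfl | rfl <;> simp [ha, hb]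
  | refl => rfl
  | symm _ _ _ ih => exact ih.symm
  | trans _ _ _ _ _ ih1 ih2 => exact ih1.trans ih2

/-- The orbits of two maps. -/
abbrev Orb (a b : X → X) := Quot fun x y => y = a x ∨ y = b x

/-- The orbit of an element. -/
abbrev Orb.mk (a b : X → X) (x : X) : Orb a b := Quot.mk _ x

theorem Orb.mk_eq_iff {x y : X} : Orb.mk a b x = Orb.mk a b y ↔ Around a b x y := Quot.eq

theorem Orb.mk_left (x : X) : Orb.mk a b (a x) = Orb.mk a b x := (Quot.sound (.inl rfl)).symm
theorem Orb.mk_right (x : X) : Orb.mk a b (b x) = Orb.mk a b x := (Quot.sound (.inr rfl)).symm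

theorem Orb.around_out (x : X) : Around a b (Orb.mk a b x).out x := Quot.eq.1 (Quot.out_eq _)

/-- The product of the values of a function on the orbits. -/
noncomputable def orbProd (a b : X → X) (g : X → G) : G := ∏ᶠ o : Orb a b, g o.out

/-- A function that is constant on the orbits. -/
def Invariant {Z : Type*} (a b : X → X) (g : X → Z) : Prop := ∀ x, g (a x) = g x ∧ g (b x) = g x

theorem Invariant.eq {Z : Type*} {g : X → Z} (hg : Invariant a b g) {x y : X}
    (h : Around a b x y) : g x = g y := h.eq_of_eq (fun x => (hg x).1) fun x => (hg x).2

theorem Invariant.out {Z : Type*} {g : X → Z} (hg : Invariant a b g) (x : X) :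
    g (Orb.mk a b x).out = g x := hg.eq (Orb.around_out x)

/-- `j` induces a map of orbits, which has a left inverse given by `ρ` and is onto by `hs`. So the
two products have the same factors. -/
theorem orbProd_eq_of_map (j : Y → X) (h1 : Invariant a' b' fun y => Orb.mk a b (j y))
    (ρ : X → Orb a' b') (hρ : Invariant a b ρ) (hj : ∀ y, ρ (j y) = Orb.mk a' b' y)
    (hs : ∀ x, ∃ y, Around a b (j y) x) {g : X → G} (hg : Invariant a b g) :
    orbProd a' b' (fun y => g (j y)) = orbProd a b g := by
  refine finprod_eq_of_bijective (fun o => Orb.mk a b (j o.out)) ⟨?_, ?_⟩ ?_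
  · rintro ⟨y⟩ ⟨z⟩ h
    have h2 := hρ.eq (Orb.mk_eq_iff.1 h)
    rw [hj, hj] at h2
    simpa using h2
  · rintro ⟨x⟩
    obtain ⟨y, hy⟩ := hs x
    refine ⟨Orb.mk a' b' y, ?_⟩
    exact (h1.out y).trans (Orb.mk_eq_iff.2 hy)
  · exact fun o => (hg.out _).symm

theorem orbProd_eq_of_equiv (φ : Y ≃ X) (ha : ∀ y, φ (a' y) = a (φ y))
    (hb : ∀ y, φ (b' y) = b (φ y)) {g : X → G} (hg : Invariant a b g) :
    orbProd a' b' (fun y => g (φ y)) = orbProd a b g := by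
  refine orbProd_eq_of_map φ (fun y => ⟨?_, ?_⟩) (fun x => Orb.mk a' b' (φ.symm x))
    (fun x => ⟨?_, ?_⟩) (fun y => by simp) (fun x => ⟨φ.symm x, ?_⟩) hg
  · simp only [ha, Orb.mk_left]
  · simp only [hb, Orb.mk_right]
  · change Orb.mk a' b' (φ.symm (a x)) = _
    rw [show φ.symm (a x) = a' (φ.symm x) by rw [Equiv.symm_apply_eq, ha, φ.apply_symm_apply],
      Orb.mk_left]
  · change Orb.mk a' b' (φ.symm (b x)) = _
    rw [show φ.symm (b x) = b' (φ.symm x) by rw [Equiv.symm_apply_eq, hb, φ.apply_symm_apply],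
      Orb.mk_right]
  · rw [φ.apply_symm_apply]
    exact .refl _

/-- The orbits on `Y` are obtained from those on `X` by identifying the orbits of `x₁` and `x₂`. -/
theorem orbProd_of_merge [Finite X] [Finite Y] (j : Y → X) (ρ : X → Orb a' b') {x₁ x₂ : X}
    (Q : X → X → Prop) (hQ : ∀ x y, Q x y ↔ Around a b x y ∨
      ((Around a b x x₁ ∨ Around a b x x₂) ∧ (Around a b y x₁ ∨ Around a b y x₂)))
    (hρ : Invariant a b ρ) (hj : ∀ y, ρ (j y) = Orb.mk a' b' y) (h12 : ρ x₁ = ρ x₂)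
    (hne : ¬Around a b x₁ x₂)
    (h1 : ∀ y, Q (j (a' y)) (j y) ∧ Q (j (b' y)) (j y))
    (hs : ∀ x, ∃ y, ρ x = Orb.mk a' b' y ∧ Q (j y) x) {g : X → G} {g' : Y → G}
    (hg : Invariant a b g) (hgg : ∀ x y, ρ x = Orb.mk a' b' y → g x = g' y) :
    orbProd a b g = orbProd a' b' g' * g x₁ := by
  have hrefl : ∀ x, Q x x := fun x => (hQ _ _).2 (.inl (.refl _))
  have hsymm : ∀ x y, Q x y → Q y x := fun x y h => (hQ _ _).2
    (((hQ _ _).1 h).imp (Relation.EqvGen.symm _ _) And.symm)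
  have htrans : ∀ x y z, Q x y → Q y z → Q x z := by
    intro x y z h h'
    rw [hQ] at *
    rcases h with h | h
    · rcases h' with h' | h'
      · exact .inl (.trans _ _ _ h h')
      · exact .inr ⟨h'.1.imp (.trans _ _ _ h) (.trans _ _ _ h), h'.2⟩
    · rcases h' with h' | h'
      · have h'' := Relation.EqvGen.symm _ _ h'
        exact .inr ⟨h.1, h.2.imp (.trans _ _ _ h'') (.trans _ _ _ h'')⟩
      · exact .inr ⟨h.1, h'.2⟩
  have hQj : ∀ y z, Around a' b' y z → Q (j y) (j z) := by
    intro y z h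
    induction h with
    | rel y z h => rcases h with rfl | rfl; exacts [hsymm _ _ (h1 y).1, hsymm _ _ (h1 y).2]
    | refl => exact hrefl _
    | symm _ _ _ ih => exact hsymm _ _ ih
    | trans _ _ _ _ _ ih1 ih2 => exact htrans _ _ _ ih1 ih2
  have key : ∀ x x', ρ x = ρ x' → Q x x' := by
    intro x x' h
    obtain ⟨y, hy, hy'⟩ := hs x
    obtain ⟨z, hz, hz'⟩ := hs x'
    exact htrans _ _ _ (hsymm _ _ hy')
      (htrans _ _ _ (hQj _ _ (Orb.mk_eq_iff.1 (hy.symm.trans (h.trans hz)))) hz')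
  have := Fintype.ofFinite (Orb a b)
  have := Fintype.ofFinite (Orb a' b')
  classical
  rw [orbProd, orbProd, finprod_eq_prod_of_fintype, finprod_eq_prod_of_fintype,
    ← Finset.prod_erase_mul _ _ (Finset.mem_univ (Orb.mk a b x₂)), hg.out]
  -- The two orbits have the same image, so `g` takes the same value on them; this is the additional
  -- factor.
  have hx : g x₂ = g x₁ := by
    obtain ⟨y, hy, -⟩ := hs x₁
    rw [hgg _ _ hy, hgg _ _ (h12.symm.trans hy)]
  rw [hx]
  congr 1
  -- `ρ` maps the orbits other than that of `x₂` bijectively to the orbits on `Y`.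
  refine Finset.prod_bij (fun o _ => ρ o.out) (fun _ _ => Finset.mem_univ _) ?_ ?_ ?_
  · rintro ⟨x⟩ hx1 ⟨x'⟩ hx2 h
    have hx1 := (Finset.mem_erase.1 hx1).1
    have hx2 := (Finset.mem_erase.1 hx2).1
    have h : ρ x = ρ x' := by simpa only [hρ.out] using h
    refine Orb.mk_eq_iff.2 ?_
    rcases (hQ _ _).1 (key _ _ h) with h | ⟨h, h'⟩
    · exact h
    · rcases h with h | h
      · rcases h' with h' | h'
        · exact .trans _ _ _ h (.symm _ _ h')
        · exact absurd (Orb.mk_eq_iff.2 h') hx2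
      · exact absurd (Orb.mk_eq_iff.2 h) hx1
  · rintro ⟨y⟩ -
    by_cases h : Around a b (j y) x₂
    · refine ⟨Orb.mk a b x₁, Finset.mem_erase.2 ⟨fun h => hne (Orb.mk_eq_iff.1 h),
        Finset.mem_univ _⟩, ?_⟩
      change ρ _ = Orb.mk a' b' y
      rw [hρ.out, h12, ← hj, hρ.eq h]
    · refine ⟨Orb.mk a b (j y), Finset.mem_erase.2 ⟨fun h' => h (Orb.mk_eq_iff.1 h'),
        Finset.mem_univ _⟩, ?_⟩
      change ρ _ = Orb.mk a' b' y
      rw [hρ.out, hj]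
  · rintro o -
    refine hgg _ _ ?_
    exact (Quot.out_eq _).symm

/-- The orbits on `X` are those on `Y` and the orbit of `x₀`. -/
theorem orbProd_of_delete [Finite X] [Finite Y] (j : Y → X) (hinj : Function.Injective j) {x₀ : X}
    (ha : ∀ y, j (a' y) = a (j y)) (hb : ∀ y, j (b' y) = b (j y))
    (hD : ∀ x, x ∉ Set.range j → Around a b x₀ x ∧ a x ∉ Set.range j ∧ b x ∉ Set.range j)
    (hx₀ : x₀ ∉ Set.range j) {g : X → G} (hg : Invariant a b g) :
    orbProd a b g = orbProd a' b' (fun y => g (j y)) * g x₀ := by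
  have h1 : Invariant a' b' fun y => Orb.mk a b (j y) := fun y => by
    simp only [ha, hb, Orb.mk_left, Orb.mk_right, and_self]
  -- The value `none` distinguishes the deleted orbit from the orbits in the range of `j`.
  have hρ : Invariant a b (Function.extend j (fun y => some (Orb.mk a' b' y)) fun _ => none) := by
    intro x
    by_cases hx : x ∈ Set.range j
    · obtain ⟨y, rfl⟩ := hx
      rw [← ha, ← hb, hinj.extend_apply, hinj.extend_apply, hinj.extend_apply, Orb.mk_left,
        Orb.mk_right]
      exact ⟨rfl, rfl⟩
    · rw [Function.extend_apply' _ _ _ hx, Function.extend_apply' _ _ _ (hD x hx).2.1,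
        Function.extend_apply' _ _ _ (hD x hx).2.2]
      exact ⟨rfl, rfl⟩
  have := Fintype.ofFinite (Orb a b)
  have := Fintype.ofFinite (Orb a' b')
  classical
  rw [orbProd, orbProd, finprod_eq_prod_of_fintype, finprod_eq_prod_of_fintype,
    ← Finset.prod_erase_mul _ _ (Finset.mem_univ (Orb.mk a b x₀)), hg.out]
  congr 1
  symm
  refine Finset.prod_bij (fun o _ => Orb.mk a b (j o.out)) ?_ ?_ ?_ ?_
  · rintro o -
    refine Finset.mem_erase.2 ⟨fun h => ?_, Finset.mem_univ _⟩
    have h2 := hρ.eq (Orb.mk_eq_iff.1 h)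
    rw [hinj.extend_apply, Function.extend_apply' _ _ _ hx₀] at h2
    simp at h2
  · rintro o - o' - h
    have h2 := hρ.eq (Orb.mk_eq_iff.1 h)
    rw [hinj.extend_apply, hinj.extend_apply] at h2
    simpa [Orb.mk] using h2
  · rintro ⟨x⟩ hx
    have hx := (Finset.mem_erase.1 hx).1
    by_cases h : x ∈ Set.range j
    · obtain ⟨y, rfl⟩ := h
      exact ⟨Orb.mk a' b' y, Finset.mem_univ _, h1.out y⟩
    · exact absurd (Orb.mk_eq_iff.2 (Relation.EqvGen.symm _ _ (hD x h).1)) hx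
  · rintro o -
    exact (hg.out _).symm

/-- The orbits on two sets glued along a third one. -/
theorem orbProd_glue [Finite X] [Finite Y] [Finite C] {F : X ⊕ Y → X ⊕ Y} {c : C → C} {i : C → X}
    {i' : C → Y} (ha : ∀ x, a (a x) = x) (ha' : ∀ x, a' (a' x) = x) (hF : ∀ z, F (F z) = z)
    (hi : ∀ n n', Around a b (i n) (i n') ↔ Around c c n n')
    (hi' : ∀ n n', Around a' b' (i' n) (i' n') ↔ Around c c n n')
    (h1 : ∀ n, F (.inl (i n)) = .inr (i' n)) (h2 : ∀ n, F (.inr (i' n)) = .inl (i n))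
    (h3 : ∀ x, x ∉ Set.range i → F (.inl x) = .inl (b x))
    (h4 : ∀ y, y ∉ Set.range i' → F (.inr y) = .inr (b' y))
    (hb : ∀ n, b (i n) = i n) (hb' : ∀ n, b' (i' n) = i' n)
    {g : X ⊕ Y → G} (hg : Invariant (Sum.map a a') F g) :
    orbProd (Sum.map a a') F g * orbProd c c (fun n => g (.inl (i n))) =
      orbProd a b (fun x => g (.inl x)) * orbProd a' b' (fun y => g (.inr y)) := by
  have hl : ∀ x x', Around a b x x' → Around (Sum.map a a') F (.inl x) (.inl x') := by
    intro x x' h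
    refine h.map Sum.inl (fun x => .rel _ _ (.inl rfl)) fun x => ?_
    by_cases h : x ∈ Set.range i
    · obtain ⟨n, rfl⟩ := h
      rw [hb]
      exact .refl _
    · exact .rel _ _ (.inr (h3 x h).symm)
  have hr : ∀ x x', Around a' b' x x' → Around (Sum.map a a') F (.inr x) (.inr x') := by
    intro x x' h
    refine h.map Sum.inr (fun x => .rel _ _ (.inl rfl)) fun x => ?_
    by_cases h : x ∈ Set.range i'
    · obtain ⟨n, rfl⟩ := h
      rw [hb']
      exact .refl _
    · exact .rel _ _ (.inr (h4 x h).symm)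
  have hli : Invariant a b fun x => Orb.mk (Sum.map a a') F (.inl x) := fun x =>
    ⟨Orb.mk_eq_iff.2 (hl _ _ (.symm _ _ (.rel _ _ (.inl rfl)))),
      Orb.mk_eq_iff.2 (hl _ _ (.symm _ _ (.rel _ _ (.inr rfl))))⟩
  have hri : Invariant a' b' fun x => Orb.mk (Sum.map a a') F (.inr x) := fun x =>
    ⟨Orb.mk_eq_iff.2 (hr _ _ (.symm _ _ (.rel _ _ (.inl rfl)))),
      Orb.mk_eq_iff.2 (hr _ _ (.symm _ _ (.rel _ _ (.inr rfl))))⟩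
  have hm : ∀ z, Sum.map a a' (Sum.map a a' z) = z := by rintro (x | y) <;> simp [ha, ha']
  have key : ∀ x z, Around (Sum.map a a') F (.inl x) z → Sum.elim (Around a b x)
      (fun y => ∃ n, Around a b x (i n) ∧ Around a' b' (i' n) y) z := by
    intro x z h
    refine (h.closed (P := Sum.elim (Around a b x)
      (fun y => ∃ n, Around a b x (i n) ∧ Around a' b' (i' n) y)) hm hF ?_ ?_).1 (.refl _)
    · rintro (x | y)
      · exact fun h => .trans _ _ _ h (.rel _ _ (.inl rfl))
      · exact fun ⟨n, h, h'⟩ => ⟨n, h, .trans _ _ _ h' (.rel _ _ (.inl rfl))⟩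
    · rintro (x' | y) h
      · by_cases hx : x' ∈ Set.range i
        · obtain ⟨n, rfl⟩ := hx
          rw [h1]
          exact ⟨n, h, .refl _⟩
        · rw [h3 _ hx]
          exact .trans _ _ _ h (.rel _ _ (.inr rfl))
      · by_cases hy : y ∈ Set.range i'
        · obtain ⟨n, rfl⟩ := hy
          obtain ⟨n', h, h'⟩ := h
          rw [h2]
          exact .trans _ _ _ h ((hi _ _).2 ((hi' _ _).1 h'))
        · rw [h4 _ hy]
          obtain ⟨n, h, h'⟩ := h
          exact ⟨n, h, .trans _ _ _ h' (.rel _ _ (.inr rfl))⟩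
  have key' : ∀ y z, Around (Sum.map a a') F (.inr y) (.inr z) → Around a' b' y z := by
    intro y z h
    refine (h.closed (P := Sum.elim (fun x => ∃ n, Around a' b' y (i' n) ∧ Around a b (i n) x)
      (Around a' b' y)) hm hF ?_ ?_).1 (.refl _)
    · rintro (x | y)
      · exact fun ⟨n, h, h'⟩ => ⟨n, h, .trans _ _ _ h' (.rel _ _ (.inl rfl))⟩
      · exact fun h => .trans _ _ _ h (.rel _ _ (.inl rfl))
    · rintro (x' | y) h
      · by_cases hx : x' ∈ Set.range i
        · obtain ⟨n, rfl⟩ := hx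
          obtain ⟨n', h, h'⟩ := h
          rw [h1]
          exact .trans _ _ _ h ((hi' _ _).2 ((hi _ _).1 h'))
        · rw [h3 _ hx]
          obtain ⟨n, h, h'⟩ := h
          exact ⟨n, h, .trans _ _ _ h' (.rel _ _ (.inr rfl))⟩
      · by_cases hy : y ∈ Set.range i'
        · obtain ⟨n, rfl⟩ := hy
          rw [h2]
          exact ⟨n, h, .refl _⟩
        · rw [h4 _ hy]
          exact .trans _ _ _ h (.rel _ _ (.inr rfl))
  have := Fintype.ofFinite (Orb a b)
  have := Fintype.ofFinite (Orb a' b')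
  have := Fintype.ofFinite (Orb c c)
  have := Fintype.ofFinite (Orb (Sum.map a a') F)
  classical
  simp only [orbProd, finprod_eq_prod_of_fintype]
  have hci : Invariant c c fun n => Orb.mk (Sum.map a a') F (.inl (i n)) := fun n =>
    have h : Orb.mk (Sum.map a a') F (.inl (i (c n))) = Orb.mk (Sum.map a a') F (.inl (i n)) :=
      Orb.mk_eq_iff.2 (hl _ _ ((hi _ _).2 (.symm _ _ (.rel _ _ (.inl rfl)))))
    ⟨h, h⟩
  have e1 : ∏ o : Orb a b, g (.inl o.out) = ∏ p ∈ Finset.univ.image fun o : Orb a b =>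
      Orb.mk (Sum.map a a') F (.inl o.out), g p.out := by
    rw [Finset.prod_image]
    · exact Finset.prod_congr rfl fun o _ => (hg.out _).symm
    · rintro ⟨x⟩ - ⟨x'⟩ - h
      have h : Orb.mk (Sum.map a a') F (.inl x) = Orb.mk (Sum.map a a') F (.inl x') :=
        (hli.out x).symm.trans (Eq.trans h (hli.out x'))
      exact Orb.mk_eq_iff.2 (key _ _ (Orb.mk_eq_iff.1 h))
  have e2 : ∏ o : Orb a' b', g (.inr o.out) = ∏ p ∈ Finset.univ.image fun o : Orb a' b' =>
      Orb.mk (Sum.map a a') F (.inr o.out), g p.out := by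
    rw [Finset.prod_image]
    · exact Finset.prod_congr rfl fun o _ => (hg.out _).symm
    · rintro ⟨x⟩ - ⟨x'⟩ - h
      have h : Orb.mk (Sum.map a a') F (.inr x) = Orb.mk (Sum.map a a') F (.inr x') :=
        (hri.out x).symm.trans (Eq.trans h (hri.out x'))
      exact Orb.mk_eq_iff.2 (key' _ _ (Orb.mk_eq_iff.1 h))
  have e3 : ∏ o : Orb c c, g (.inl (i o.out)) = ∏ p ∈ Finset.univ.image fun o : Orb c c =>
      Orb.mk (Sum.map a a') F (.inl (i o.out)), g p.out := by
    rw [Finset.prod_image]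
    · exact Finset.prod_congr rfl fun o _ => (hg.out _).symm
    · rintro ⟨x⟩ - ⟨x'⟩ - h
      have h : Orb.mk (Sum.map a a') F (.inl (i x)) = Orb.mk (Sum.map a a') F (.inl (i x')) :=
        (hci.out x).symm.trans (Eq.trans h (hci.out x'))
      exact Orb.mk_eq_iff.2 ((hi _ _).1 (key _ _ (Orb.mk_eq_iff.1 h)))
  rw [e1, e2, e3]
  -- Inclusion and exclusion: every orbit of the glued set meets `X` or `Y`, in at most one orbit of
  -- each, and the orbits meeting both correspond to those of `C`.
  refine Eq.trans ?_ Finset.prod_union_inter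
  congr 2
  · symm
    rw [Finset.eq_univ_iff_forall]
    rintro ⟨x | y⟩
    · exact Finset.mem_union_left _ (Finset.mem_image.2 ⟨Orb.mk a b x, Finset.mem_univ _, hli.out x⟩)
    · exact Finset.mem_union_right _
        (Finset.mem_image.2 ⟨Orb.mk a' b' y, Finset.mem_univ _, hri.out y⟩)
  · ext p
    simp only [Finset.mem_image, Finset.mem_univ, true_and, Finset.mem_inter]
    constructor
    · rintro ⟨o, rfl⟩
      refine ⟨⟨Orb.mk a b (i o.out), hli.out _⟩, Orb.mk a' b' (i' o.out), ?_⟩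
      refine (hri.out _).trans ?_
      rw [← h1]
      exact Orb.mk_right _
    · rintro ⟨⟨⟨x⟩, rfl⟩, ⟨y⟩, h⟩
      have h : Orb.mk (Sum.map a a') F (.inl x) = Orb.mk (Sum.map a a') F (.inr y) :=
        (hli.out x).symm.trans (Eq.trans h.symm (hri.out y))
      obtain ⟨n, h, -⟩ := key _ _ (Orb.mk_eq_iff.1 h)
      refine ⟨Orb.mk c c n, (hci.out n).trans ?_⟩
      exact Orb.mk_eq_iff.2 (.trans _ _ _ (hl _ _ (.symm _ _ h))
        (Orb.mk_eq_iff.1 (hli.out x).symm))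

/-- The orbits on a disjoint union. -/
theorem orbProd_sum [Finite X] [Finite Y] (ha : ∀ x, a (a x) = x) (ha' : ∀ x, a' (a' x) = x)
    (hb : ∀ x, b (b x) = x) (hb' : ∀ x, b' (b' x) = x)
    {g : X ⊕ Y → G} (hg : Invariant (Sum.map a a') (Sum.map b b') g) :
    orbProd (Sum.map a a') (Sum.map b b') g =
      orbProd a b (fun x => g (.inl x)) * orbProd a' b' (fun y => g (.inr y)) := by
  have h := orbProd_glue (C := Empty) (F := Sum.map b b') (c := fun x => x) (i := fun x => x.elim)
    (i' := fun x => x.elim) ha ha' (by rintro (x | y) <;> simp [hb, hb']) (fun x => x.elim)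
    (fun x => x.elim) (fun x => x.elim) (fun x => x.elim) (fun _ _ => rfl) (fun _ _ => rfl)
    (fun x => x.elim) (fun x => x.elim) hg
  have h0 : orbProd (fun x : Empty => x) (fun x => x) (fun x => g (.inl x.elim)) = 1 :=
    finprod_of_isEmpty _
  rwa [h0, mul_one] at h

/-- The number of orbits, found by choosing a representative in each orbit. -/
theorem card_orb [Fintype X] [DecidableEq X] (rep : X → X) (h : Invariant a b rep)
    (h' : ∀ x, Around a b x (rep x)) :
    Nat.card (Orb a b) = (Finset.univ.filter fun x => rep x = x).card := by
  rw [← Fintype.card_subtype, ← Nat.card_eq_fintype_card]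
  refine Nat.card_congr ⟨fun o => ⟨rep o.out, (h.eq (h' _)).symm⟩, fun x => Orb.mk a b x, ?_, ?_⟩
  · rintro ⟨x⟩
    exact Orb.mk_eq_iff.2 (.trans _ _ _ (.symm _ _ (h' _)) (Orb.around_out x))
  · rintro ⟨x, hx⟩
    exact Subtype.ext ((h.out x).trans hx)

theorem orbProd_const [Finite X] (c : G) : orbProd a b (fun _ => c) = c ^ Nat.card (Orb a b) := by
  have := Fintype.ofFinite (Orb a b)
  rw [orbProd, finprod_eq_prod_of_fintype, Finset.prod_const, Finset.card_univ, Nat.card_eq_fintype_card]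

end Orbits
-- The effect of deleting an edge or a vertex on orbits
section Deletion

variable {X Y : Type} {G : Type*} [CommGroup G]

theorem orbProd_comm {a b : X → X} {g : X → G} (hg : Invariant a b g) :
    orbProd b a g = orbProd a b g :=
  orbProd_eq_of_map (a' := b) (b' := a) (fun x => x) (fun x => ⟨Orb.mk_right x, Orb.mk_left x⟩)
    (Orb.mk b a) (fun x => ⟨Orb.mk_right x, Orb.mk_left x⟩) (fun _ => rfl)
    (fun x => ⟨x, .refl _⟩) hg

theorem skipTo_inv {D : Set X} {h : X → X} {Z : Type*} {r : X → Z} (hr : ∀ d ∈ D, r (h d) = r d)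
    {u w : X} (hs : Cob.SkipTo D h u w) : r w = r u := by
  induction hs with
  | here => rfl
  | next hx _ ih => rw [ih, hr _ hx]

theorem skipTo_here {D : Set X} {h : X → X} {u w : X} (hs : Cob.SkipTo D h u w) (hu : u ∉ D) :
    w = u := by
  cases hs with
  | here => rfl
  | next h' => exact absurd h' hu

theorem skipTo_next {D : Set X} {h : X → X} {u w : X} (hs : Cob.SkipTo D h u w) (hu : u ∈ D) :
    Cob.SkipTo D h (h u) w := by
  cases hs with
  | here h' => exact absurd hu h'
  | next _ h' => exact h'

/-- Four elements `x`, `a x`, `c x`, `a (c x)` are deleted.  This describes both the deletion of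
an edge and the deletion of a vertex of valence two. -/
structure Deletes (a b c : X → X) (a' b' c' : Y → Y) (x : X) (j : Y → X) (y z : Y) : Prop where
  a_a : ∀ u, a (a u) = u
  b_b : ∀ u, b (b u) = u
  c_c : ∀ u, c (c u) = u
  a_c : a (c x) = c (a x)
  b_ne : ∀ u, b u ≠ u
  a_ne : a x ≠ x
  c_ne_a : c x ≠ a x
  injective : Function.Injective j
  range : ∀ u, u ∈ Set.range j ↔ u ∉ ({x, a x, c x, a (c x)} : Set X)
  map_a : ∀ t, j (a' t) = a (j t)
  map_c : ∀ t, j (c' t) = c (j t)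
  skip_b : ∀ t, Cob.SkipTo {x, a x, c x, a (c x)} (fun u => b (c u)) (b (j t)) (j (b' t))
  j_y : j y = b x
  j_z : j z = b (a x)

namespace Deletes

variable {a b c : X → X} {a' b' c' : Y → Y} {x : X} {j : Y → X} {y z : Y}

theorem y_notMem (h : Deletes a b c a' b' c' x j y z) : b x ∉ ({x, a x, c x, a (c x)} : Set X) := (h.range _).1 ⟨y, h.j_y⟩

theorem z_notMem (h : Deletes a b c a' b' c' x j y z) : b (a x) ∉ ({x, a x, c x, a (c x)} : Set X) := (h.range _).1 ⟨z, h.j_z⟩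

theorem a_mem (h : Deletes a b c a' b' c' x j y z) {u : X} (hu : u ∈ ({x, a x, c x, a (c x)} : Set X)) :
    a u ∈ ({x, a x, c x, a (c x)} : Set X) := by
  rcases hu with rfl | rfl | rfl | rfl <;> simp [h.a_a]

theorem c_mem (h : Deletes a b c a' b' c' x j y z) {u : X} (hu : u ∈ ({x, a x, c x, a (c x)} : Set X)) :
    c u ∈ ({x, a x, c x, a (c x)} : Set X) := by
  rcases hu with rfl | rfl | rfl | rfl
  · simp
  · rw [← h.a_c]; simp
  · simp [h.c_c]
  · rw [h.a_c, h.c_c]; simp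

/-- If `b d` is not deleted, then after the deletion it is followed by `b (c d)`. -/
theorem next_eq (h : Deletes a b c a' b' c' x j y z) {d : X} (hd : d ∈ ({x, a x, c x, a (c x)} : Set X)) {t t' : Y} (ht : j t = b d)
    (ht' : j t' = b (c d)) : b' t = t' := by
  have h1 := h.skip_b t
  rw [ht, h.b_b] at h1
  have h2 := skipTo_next h1 hd
  exact h.injective ((skipTo_here h2 ((h.range _).1 ⟨t', ht'⟩)).trans ht'.symm)

/-- Since `b x` and `b (a x)` are not deleted, `c x` and `a (c x)` are the only deleted elements
that `b` can exchange. In this case skipping leads from `y` through both of them to `z`. -/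
theorem next_y (h : Deletes a b c a' b' c' x j y z) (hd : b (c x) ∈ ({x, a x, c x, a (c x)} : Set X)) :
    b (c x) = a (c x) ∧ b' y = z := by
  have h0 : b (c x) = a (c x) := by
    rcases hd with h1 | h1 | h1 | h1
    · exact absurd (show b x ∈ ({x, a x, c x, a (c x)} : Set X) by
        rw [(congrArg b h1).symm.trans (h.b_b _)]; simp)
        h.y_notMem
    · exact absurd (show b (a x) ∈ ({x, a x, c x, a (c x)} : Set X) by
        rw [(congrArg b h1).symm.trans (h.b_b _)]; simp)
        h.z_notMem
    · exact absurd h1 (h.b_ne _)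
    · exact h1
  refine ⟨h0, ?_⟩
  have h1 := h.skip_b y
  rw [h.j_y, h.b_b] at h1
  have h2 := skipTo_next (skipTo_next h1 (by simp)) hd
  simp only [h0, h.a_c, h.c_c] at h2
  refine h.injective ((skipTo_here h2 ?_).trans h.j_z.symm)
  rw [← h.a_c]
  exact h.z_notMem

open Classical in
/-- The orbit of an element that may be deleted. -/
noncomputable def rep (b' c' : Y → Y) (x cx : X) (j : Y → X) (y z : Y) : X → Orb b' c' :=
  Function.extend j (Orb.mk b' c') fun d => if d = x ∨ d = cx then Orb.mk b' c' y else Orb.mk b' c' z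

theorem rep_j (h : Deletes a b c a' b' c' x j y z) (t : Y) : rep b' c' x (c x) j y z (j t) = Orb.mk b' c' t := h.injective.extend_apply _ _ _

theorem rep_x (h : Deletes a b c a' b' c' x j y z) : rep b' c' x (c x) j y z x = Orb.mk b' c' y := by
  rw [rep, Function.extend_apply' _ _ _ fun hx => (h.range _).1 hx (by simp), if_pos (.inl rfl)]

theorem rep_c (h : Deletes a b c a' b' c' x j y z) : rep b' c' x (c x) j y z (c x) = Orb.mk b' c' y := by
  rw [rep, Function.extend_apply' _ _ _ fun hx => (h.range _).1 hx (by simp), if_pos (.inr rfl)]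

theorem rep_a (h : Deletes a b c a' b' c' x j y z) : rep b' c' x (c x) j y z (a x) = Orb.mk b' c' z := by
  rw [rep, Function.extend_apply' _ _ _ fun hx => (h.range _).1 hx (by simp), if_neg]
  rintro (hx | hx)
  · exact h.a_ne hx
  · exact h.c_ne_a hx.symm

theorem rep_ac (h : Deletes a b c a' b' c' x j y z) : rep b' c' x (c x) j y z (a (c x)) = Orb.mk b' c' z := by
  rw [rep, Function.extend_apply' _ _ _ fun hx => (h.range _).1 hx (by simp), if_neg]
  rintro (hx | hx)
  · exact h.c_ne_a (by rw [← hx, h.a_a, hx])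
  · exact h.a_ne (by rw [h.a_c] at hx; rw [← h.c_c (a x), hx, h.c_c])

/-- If `b d` remains, it is `y` or `z` or becomes their neighbour under `b'`. If it is deleted too,
then `y` and `z` are neighbours by `next_y`, and their orbits coincide. -/
theorem rep_b_of_mem (h : Deletes a b c a' b' c' x j y z) {d : X} (hd : d ∈ ({x, a x, c x, a (c x)} : Set X)) :
    rep b' c' x (c x) j y z (b d) = rep b' c' x (c x) j y z d := by
  by_cases hbd : b d ∈ ({x, a x, c x, a (c x)} : Set X)
  · have h1 : b (c x) = a (c x) ∧ b' y = z := by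
      apply h.next_y
      rcases hd with rfl | rfl | rfl | rfl
      · exact absurd hbd h.y_notMem
      · exact absurd hbd h.z_notMem
      · exact hbd
      · rcases hbd with h1 | h1 | h1 | h1
        · exact absurd (show b x ∈ ({x, a x, c x, a (c x)} : Set X) by
            rw [(congrArg b h1).symm.trans (h.b_b _)]; simp) h.y_notMem
        · exact absurd (show b (a x) ∈ ({x, a x, c x, a (c x)} : Set X) by
            rw [(congrArg b h1).symm.trans (h.b_b _)]; simp) h.z_notMem
        · have h2 : b (c x) = a (c x) := (congrArg b h1).symm.trans (h.b_b _)
          rw [h2]; simp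
        · exact absurd h1 (h.b_ne _)
    have h2 : Orb.mk b' c' y = Orb.mk b' c' z := by rw [← h1.2, Orb.mk_left]
    rcases hd with rfl | rfl | rfl | rfl
    · exact absurd hbd h.y_notMem
    · exact absurd hbd h.z_notMem
    · rw [h1.1, h.rep_c, h.rep_ac, h2]
    · rw [← h1.1, h.b_b, h1.1, h.rep_c, h.rep_ac, h2]
  · obtain ⟨t, ht⟩ := (h.range _).2 hbd
    rw [← ht, h.rep_j]
    rcases hd with rfl | rfl | rfl | rfl
    · rw [h.rep_x, h.injective (ht.trans h.j_y.symm)]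
    · rw [h.rep_a, h.injective (ht.trans h.j_z.symm)]
    · rw [h.rep_c, ← h.next_eq (by simp) ht (t' := y) (by rw [h.c_c, h.j_y]), Orb.mk_left]
    · rw [h.rep_ac, ← h.next_eq (by simp) ht (t' := z) (by rw [h.a_c, h.c_c, h.j_z]), Orb.mk_left]

theorem rep_invariant (h : Deletes a b c a' b' c' x j y z) : Invariant b c (rep b' c' x (c x) j y z) := by
  intro u
  by_cases hu : u ∈ ({x, a x, c x, a (c x)} : Set X)
  · refine ⟨h.rep_b_of_mem hu, ?_⟩
    rcases hu with rfl | rfl | rfl | rfl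
    · rw [h.rep_c, h.rep_x]
    · rw [← h.a_c, h.rep_ac, h.rep_a]
    · rw [h.c_c, h.rep_c, h.rep_x]
    · rw [h.rep_ac, h.a_c, h.c_c, h.rep_a]
  · obtain ⟨t, rfl⟩ := (h.range _).2 hu
    rw [← h.map_c, h.rep_j, h.rep_j]
    refine ⟨?_, Orb.mk_right _⟩
    by_cases hb : b (j t) ∈ ({x, a x, c x, a (c x)} : Set X)
    · have := h.rep_b_of_mem hb
      rw [h.b_b, h.rep_j] at this
      exact this.symm
    · rw [← skipTo_here (h.skip_b t) hb, h.rep_j, Orb.mk_left]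

/-- `x` and `c x` are in the orbit of `y`, the other two deleted elements in that of `z`; skipping
moves within orbits. So no orbit of `b` and `c` disappears, splits or is joined to another one. -/
theorem orbProd_bc (h : Deletes a b c a' b' c' x j y z) {g : X → G} (hg : Invariant b c g) :
    orbProd b' c' (fun t => g (j t)) = orbProd b c g := by
  refine orbProd_eq_of_map j (fun t => ⟨?_, ?_⟩) _ h.rep_invariant h.rep_j (fun u => ?_) hg
  · exact (skipTo_inv (r := Orb.mk b c) (fun d _ => (Orb.mk_left _).trans (Orb.mk_right _))
      (h.skip_b t)).trans (Orb.mk_left _)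
  · simp only [h.map_c, Orb.mk_right]
  · by_cases hu : u ∈ ({x, a x, c x, a (c x)} : Set X)
    · rcases hu with rfl | rfl | rfl | rfl
      · exact ⟨y, h.j_y ▸ .symm _ _ (.rel _ _ (.inl rfl))⟩
      · exact ⟨z, h.j_z ▸ .symm _ _ (.rel _ _ (.inl rfl))⟩
      · exact ⟨y, .trans _ _ _ (h.j_y ▸ .symm _ _ (.rel _ _ (.inl rfl))) (.rel _ _ (.inr rfl))⟩
      · exact ⟨z, .trans _ _ _ (h.j_z ▸ .symm _ _ (.rel _ _ (.inl rfl))) (.rel _ _ (.inr h.a_c))⟩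
    · obtain ⟨t, rfl⟩ := (h.range _).2 hu
      exact ⟨t, .refl _⟩

/-- The four deleted elements form exactly one orbit of `a` and `c`: the edge or vertex that is
deleted. -/
theorem orbProd_ac (h : Deletes a b c a' b' c' x j y z) [Finite X] [Finite Y] {g : X → G} (hg : Invariant a c g) :
    orbProd a c g = orbProd a' c' (fun t => g (j t)) * g x := by
  refine orbProd_of_delete j h.injective h.map_a h.map_c (fun u hu => ?_)
    (fun hx => (h.range _).1 hx (by simp)) hg
  have hu : u ∈ ({x, a x, c x, a (c x)} : Set X) := by
    by_contra h'
    exact hu ((h.range _).2 h')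
  refine ⟨?_, fun h' => (h.range _).1 h' (h.a_mem hu), fun h' => (h.range _).1 h' (h.c_mem hu)⟩
  rcases hu with rfl | rfl | rfl | rfl
  · exact .refl _
  · exact .rel _ _ (.inl rfl)
  · exact .rel _ _ (.inr rfl)
  · exact .trans _ _ _ (.rel _ _ (.inr rfl)) (.rel _ _ (.inl rfl))

/-- The relation that the orbits are the same, or that they are the orbits of `p` and `q`. -/
def Merged (a b : X → X) (p q u w : X) : Prop := Around a b u w ∨
  ((Around a b u p ∨ Around a b u q) ∧ (Around a b w p ∨ Around a b w q))

theorem mem_cases {u : X} (hu : u ∈ ({x, a x, c x, a (c x)} : Set X)) :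
    Around a b u x ∨ Around a b u (c x) := by
  rcases hu with rfl | rfl | rfl | rfl
  · exact .inl (.refl _)
  · exact .inl (.symm _ _ (.rel _ _ (.inl rfl)))
  · exact .inr (.refl _)
  · exact .inr (.symm _ _ (.rel _ _ (.inl rfl)))

/-- Every skipped element is in the orbit of `x` or of `c x` under `a` and `b`, and so is the
element reached from it; without skipping nothing changes. -/
theorem skipTo_merged (h : Deletes a b c a' b' c' x j y z) {u w : X} (hs : Cob.SkipTo {x, a x, c x, a (c x)} (fun u => b (c u)) u w) :
    Merged a b x (c x) w u := by
  have key : (u ∉ ({x, a x, c x, a (c x)} : Set X) → w = u) ∧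
      (u ∈ ({x, a x, c x, a (c x)} : Set X) → Around a b w x ∨ Around a b w (c x)) := by
    induction hs with
    | here h' => exact ⟨fun _ => rfl, fun h'' => absurd h'' h'⟩
    | @next u w h1 h2 ih =>
      refine ⟨fun h' => absurd h1 h', fun _ => ?_⟩
      by_cases h3 : b (c u) ∈ ({x, a x, c x, a (c x)} : Set X)
      · exact ih.2 h3
      · rw [ih.1 h3]
        exact (mem_cases (b := b) (h.c_mem h1)).imp
          (.trans _ _ _ (.symm _ _ (.rel _ _ (.inr rfl))))
          (.trans _ _ _ (.symm _ _ (.rel _ _ (.inr rfl))))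
  by_cases hu : u ∈ ({x, a x, c x, a (c x)} : Set X)
  · exact .inr ⟨key.2 hu, mem_cases hu⟩
  · rw [key.1 hu]
    exact .inl (.refl _)

/-- If the orbits of `y` and `z` under `a'` and `b'` are the same, then the deletion identifies two
orbits. -/
theorem orbProd_ab_merge (h : Deletes a b c a' b' c' x j y z) [Finite X] [Finite Y] (hyz : Around a' b' y z)
    (hne : ¬Around a b x (c x)) {g : X → G} (hg : Invariant a b g) (hgc : g (c x) = g x) :
    orbProd a b g = orbProd a' b' (fun t => g (j t)) * g x := by
  have hD : ∀ u, u ∉ Set.range j ↔ u ∈ ({x, a x, c x, a (c x)} : Set X) := fun u => by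
    rw [h.range, not_not]
  have hρD : ∀ u ∈ ({x, a x, c x, a (c x)} : Set X),
      Function.extend j (Orb.mk a' b') (fun _ => Orb.mk a' b' y) u = Orb.mk a' b' y :=
    fun u hu => Function.extend_apply' _ _ _ ((hD u).2 hu)
  have hρj : ∀ t, Function.extend j (Orb.mk a' b') (fun _ => Orb.mk a' b' y) (j t) =
      Orb.mk a' b' t := fun t => h.injective.extend_apply _ _ _
  have hyz := Orb.mk_eq_iff.2 hyz
  have hgj : ∀ t, g (j (b' t)) = g (j t) := by
    intro t
    refine (skipTo_inv (fun d hd => ?_) (h.skip_b t)).trans (hg _).2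
    rw [(hg _).2]
    rcases hd with rfl | rfl | rfl | rfl
    · exact hgc
    · rw [← h.a_c, (hg _).1, (hg _).1, hgc]
    · rw [h.c_c, hgc]
    · rw [h.a_c, h.c_c, ← h.a_c, (hg _).1, (hg _).1, hgc]
  refine orbProd_of_merge (x₁ := x) (x₂ := c x) j
    (Function.extend j (Orb.mk a' b') fun _ => Orb.mk a' b' y) (Merged a b x (c x))
    (fun _ _ => Iff.rfl) (fun u => ?_) hρj ?_ hne (fun t => ⟨?_, ?_⟩) (fun u => ?_) hg ?_
  · have hb : ∀ d ∈ ({x, a x, c x, a (c x)} : Set X),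
        Function.extend j (Orb.mk a' b') (fun _ => Orb.mk a' b' y) (b d) = Orb.mk a' b' y := by
      intro d hd
      by_cases hbd : b d ∈ ({x, a x, c x, a (c x)} : Set X)
      · exact hρD _ hbd
      · obtain ⟨t, ht⟩ := (h.range _).2 hbd
        rw [← ht, hρj]
        rcases hd with rfl | rfl | rfl | rfl
        · rw [h.injective (ht.trans h.j_y.symm)]
        · rw [h.injective (ht.trans h.j_z.symm), hyz]
        · rw [← h.next_eq (by simp) ht (t' := y) (by rw [h.c_c, h.j_y]), Orb.mk_right]
        · rw [hyz, ← h.next_eq (by simp) ht (t' := z) (by rw [h.a_c, h.c_c, h.j_z]), Orb.mk_right]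
    by_cases hu : u ∈ ({x, a x, c x, a (c x)} : Set X)
    · rw [hρD u hu]
      exact ⟨hρD _ (h.a_mem hu), hb u hu⟩
    · obtain ⟨t, rfl⟩ := (h.range _).2 hu
      rw [← h.map_a, hρj, hρj]
      refine ⟨Orb.mk_left _, ?_⟩
      by_cases hbt : b (j t) ∈ ({x, a x, c x, a (c x)} : Set X)
      · have := hb _ hbt
        rw [h.b_b, hρj] at this
        rw [hρD _ hbt, this]
      · rw [← skipTo_here (h.skip_b t) hbt, hρj, Orb.mk_right]
  · rw [hρD x (by simp), hρD (c x) (by simp)]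
  · rw [h.map_a]
    exact .inl (.symm _ _ (.rel _ _ (.inl rfl)))
  · rcases h.skipTo_merged (h.skip_b t) with h1 | ⟨h1, h2⟩
    · exact .inl (.trans _ _ _ h1 (.symm _ _ (.rel _ _ (.inr rfl))))
    · exact .inr ⟨h1, h2.imp (.trans _ _ _ (.rel _ _ (.inr rfl))) (.trans _ _ _ (.rel _ _ (.inr rfl)))⟩
  · by_cases hu : u ∈ ({x, a x, c x, a (c x)} : Set X)
    · refine ⟨y, hρD u hu, .inr ⟨.inl ?_, mem_cases hu⟩⟩
      rw [h.j_y]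
      exact .symm _ _ (.rel _ _ (.inr rfl))
    · obtain ⟨t, rfl⟩ := (h.range _).2 hu
      exact ⟨t, hρj t, .inl (.refl _)⟩
  · intro u t hut
    have hgi : Invariant a' b' fun t => g (j t) := fun t => ⟨by simp only [h.map_a, (hg _).1], hgj t⟩
    by_cases hu : u ∈ ({x, a x, c x, a (c x)} : Set X)
    · rw [hρD u hu] at hut
      have h1 : g u = g x := (mem_cases (b := b) hu).elim hg.eq fun h' => (hg.eq h').trans hgc
      rw [h1, ← hgi.eq (Orb.mk_eq_iff.1 hut), h.j_y, (hg _).2]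
    · obtain ⟨s, rfl⟩ := (h.range _).2 hu
      rw [hρj] at hut
      exact hgi.eq (Orb.mk_eq_iff.1 hut)

/-- If the orbits of `y` and `z` under `a'` and `b'` are different, and those of `x` and `c x` are
the same, then the deletion divides an orbit. -/
theorem orbProd_ab_divide (h : Deletes a b c a' b' c' x j y z) [Finite X] [Finite Y] (hyz : ¬Around a' b' y z)
    (hx : Around a b x (c x)) {g : X → G} (hg : Invariant a b g) :
    orbProd a' b' (fun t => g (j t)) = orbProd a b g * g x := by
  have hD : ∀ u, u ∉ Set.range j ↔ u ∈ ({x, a x, c x, a (c x)} : Set X) := fun u => by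
    rw [h.range, not_not]
  have hcD : ∀ d ∈ ({x, a x, c x, a (c x)} : Set X), Around a b x d := fun d hd =>
    (mem_cases (b := b) hd).elim (fun h' => .symm _ _ h') fun h' => .trans _ _ _ hx (.symm _ _ h')
  have hjb : ∀ t, Around a b (j (b' t)) (j t) := by
    intro t
    refine Orb.mk_eq_iff.1 ((skipTo_inv (r := Orb.mk a b) (fun d hd => ?_) (h.skip_b t)).trans
      (Orb.mk_right _))
    rw [Orb.mk_right]
    exact Orb.mk_eq_iff.2 (.trans _ _ _ (.symm _ _ (hcD _ (h.c_mem hd))) (hcD _ hd))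
  have hk : ∀ t, Function.extend j id (fun _ => y) (j t) = t := fun t =>
    h.injective.extend_apply _ _ _
  have hkD : ∀ d ∈ ({x, a x, c x, a (c x)} : Set X), Function.extend j id (fun _ => y) d = y :=
    fun d hd => Function.extend_apply' _ _ _ ((hD d).2 hd)
  have hbD : ∀ d ∈ ({x, a x, c x, a (c x)} : Set X), ∀ t, j t = b d →
      Around a' b' t y ∨ Around a' b' t z := by
    intro d hd t ht
    rcases hd with rfl | rfl | rfl | rfl
    · rw [h.injective (ht.trans h.j_y.symm)]
      exact .inl (.refl _)
    · rw [h.injective (ht.trans h.j_z.symm)]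
      exact .inr (.refl _)
    · exact .inl (.rel _ _ (.inr (h.next_eq (by simp) ht (by rw [h.c_c, h.j_y])).symm))
    · exact .inr (.rel _ _ (.inr (h.next_eq (by simp) ht (by rw [h.a_c, h.c_c, h.j_z])).symm))
  have hgi : Invariant a' b' fun t => g (j t) := fun t => ⟨by simp only [h.map_a, (hg _).1], hg.eq (hjb t)⟩
  have hgy : g x = g (j y) := by rw [h.j_y, (hg _).2]
  rw [hgy]
  -- The merging lemma in the opposite direction: going back from `Y` to `X` identifies the orbits
  -- of `y` and `z`. The deleted elements are sent to `y`.
  refine orbProd_of_merge (x₁ := y) (x₂ := z) (Function.extend j id fun _ => y)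
    (fun t => Orb.mk a b (j t)) (Merged a' b' y z) (fun _ _ => Iff.rfl) (fun t => ⟨?_, ?_⟩)
    (fun u => ?_) ?_ hyz (fun u => ?_) (fun t => ⟨j t, rfl, ?_⟩) hgi ?_
  · simp only [h.map_a, Orb.mk_left]
  · exact Orb.mk_eq_iff.2 (hjb t)
  · by_cases hu : u ∈ ({x, a x, c x, a (c x)} : Set X)
    · rw [hkD u hu, h.j_y, Orb.mk_right]
      exact Orb.mk_eq_iff.2 (hcD u hu)
    · obtain ⟨t, rfl⟩ := (h.range _).2 hu
      rw [hk]
  · simp only [h.j_y, h.j_z, Orb.mk_right, Orb.mk_left]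
  · by_cases hu : u ∈ ({x, a x, c x, a (c x)} : Set X)
    · rw [hkD _ hu, hkD _ (h.a_mem hu)]
      refine ⟨.inl (.refl _), ?_⟩
      by_cases hbu : b u ∈ ({x, a x, c x, a (c x)} : Set X)
      · rw [hkD _ hbu]
        exact .inl (.refl _)
      · obtain ⟨t, ht⟩ := (h.range _).2 hbu
        rw [← ht, hk]
        exact .inr ⟨hbD u hu t ht, .inl (.refl _)⟩
    · obtain ⟨t, rfl⟩ := (h.range _).2 hu
      rw [← h.map_a, hk, hk]
      refine ⟨.inl (.symm _ _ (.rel _ _ (.inl rfl))), ?_⟩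
      by_cases hbt : b (j t) ∈ ({x, a x, c x, a (c x)} : Set X)
      · rw [hkD _ hbt]
        exact .inr ⟨.inl (.refl _), hbD _ hbt t (h.b_b _).symm⟩
      · rw [← skipTo_here (h.skip_b t) hbt, hk]
        exact .inl (.symm _ _ (.rel _ _ (.inr rfl)))
  · rw [hk]
    exact .inl (.refl _)
  · intro t u htu
    exact hg.eq (Orb.mk_eq_iff.1 htu)

end Deletes

end Deletion
-- Polygons and parity
section Polygon

variable {X : Type} {v e : X → X}

/-- The involution `e (v e)^n` is conjugate to `e` or to `v`, according to the parity of `n`, and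
these have no fixed points. -/
theorem polygon_ne (hv : ∀ x, v (v x) = x) (he : ∀ x, e (e x) = x) (hv' : ∀ x, v x ≠ x)
    (he' : ∀ x, e x ≠ x) (n : ℕ) (u : X) : e ((fun w => v (e w))^[n] u) ≠ u := by
  induction n using Nat.strong_induction_on generalizing u with
  | _ n ih =>
    intro h
    match n, ih, h with
    | 0, _, h => exact he' u h
    | 1, _, h => exact hv' (e u) ((he _).symm.trans (congrArg e h))
    | n + 2, ih, h =>
      refine ih n (by omega) (v (e u)) ?_
      rw [Function.iterate_succ_apply', Function.iterate_succ_apply] at h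
      rw [← hv (e _), ← he (v (e _)), h]

/-- The two directions of going around a polygon are disjoint orbits of the rotation `v ∘ e`. -/
theorem polygon_ne_of (hv : ∀ x, v (v x) = x) (he : ∀ x, e (e x) = x) (hv' : ∀ x, v x ≠ x)
    (he' : ∀ x, e x ≠ x) (m n : ℕ) (u : X) :
    e ((fun w => v (e w))^[m] u) ≠ (fun w => v (e w))^[n] u := by
  intro h
  rcases le_total n m with hmn | hmn
  · obtain ⟨r, rfl⟩ := Nat.exists_eq_add_of_le' hmn
    rw [Function.iterate_add_apply] at h
    exact polygon_ne hv he hv' he' _ _ h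
  · obtain ⟨r, rfl⟩ := Nat.exists_eq_add_of_le' hmn
    rw [Function.iterate_add_apply] at h
    refine polygon_ne hv he hv' he' r ((fun w => v (e w))^[m] u) ?_
    rw [← h, he]

end Polygon

/-- In a finite set with an involution without fixed points, an involution on the complement of a
point has a fixed point. -/
theorem exists_fixed_of_involutions {X : Type} [Finite X] {C : Set X} {p q : X → X} {y : X}
    (hy : y ∈ C) (hp : ∀ t ∈ C, p t ∈ C ∧ p (p t) = t ∧ p t ≠ t)
    (hq : ∀ t ∈ C, t ≠ y → q t ∈ C ∧ q t ≠ y ∧ q (q t) = t ∧ q t ≠ t) : False := by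
  classical
  have := Fintype.ofFinite X
  -- `p` pairs all elements of `C`, and `q` pairs all of them except `y`, so both `C` and `C`
  -- without `y` have even cardinality.
  have h1 : ∑ _t ∈ C.toFinset, (1 : ZMod 2) = 0 :=
    Finset.sum_involution (fun t _ => p t) (fun _ _ => by decide)
      (fun t ht _ => (hp t (by simpa using ht)).2.2)
      (fun t ht => by simpa using (hp t (by simpa using ht)).1)
      (fun t ht => (hp t (by simpa using ht)).2.1)
  have h2 : ∑ _t ∈ C.toFinset.erase y, (1 : ZMod 2) = 0 := by
    have key : ∀ t ∈ C.toFinset.erase y, t ∈ C ∧ t ≠ y := fun t ht => by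
      rw [Finset.mem_erase, Set.mem_toFinset] at ht
      exact ⟨ht.2, ht.1⟩
    have key' := fun t ht => hq t (key t ht).1 (key t ht).2
    refine Finset.sum_involution (fun t _ => q t) (fun _ _ => by decide)
      (fun t ht _ => (key' t ht).2.2.2) (fun t ht => ?_) (fun t ht => (key' t ht).2.2.1)
    rw [Finset.mem_erase, Set.mem_toFinset]
    exact ⟨(key' t ht).2.1, (key' t ht).1⟩
  rw [← Finset.add_sum_erase _ _ (show y ∈ C.toFinset by simpa using hy), h2] at h1
  exact absurd h1 (by decide)

/-! ### Faces and edges before and after a deletion -/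

namespace Cob

variable {O : Type} [InvolutiveNeg O] {B : Type} {M N : Curve O B} {S T : Cob M N} {x : S.X}
  {j : T.X → S.X} {y z : T.X}

/-- For an edge, the orbits of `b, c`, of `a, c` and of `a, b` are the vertices, the edges and the
faces. For a vertex of valence two, with `f, v, e` as `a, b, c`, they are the faces, the vertices
and the edges. So one set of lemmas on orbits serves both deletions. -/
theorem DeletesEdge.deletes (h : DeletesEdge S T x j) (hy : j y = S.e x) (hz : j z = S.e (S.v x)) :
    Deletes S.v S.e S.f T.v T.e T.f x j y z where
  a_a := S.v_v
  b_b := S.e_e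
  c_c := S.f_f
  a_c := S.v_f x
  b_ne := S.e_ne
  a_ne := S.v_ne x
  c_ne_a := S.f_ne_v x
  injective := h.injective
  range u := by rw [h.range]; rfl
  map_a := h.v
  map_c := h.f
  skip_b := h.e
  j_y := hy
  j_z := hz

theorem vertex_set (h : DeletesVertex S T x j) :
    ({x, S.f x, S.e x, S.f (S.e x)} : Set S.X) = {x, S.e x, S.f x, S.e (S.f x)} := by
  rw [h.valence_two]
  ext u
  simp only [Set.mem_insert_iff, Set.mem_singleton_iff]
  tauto

theorem DeletesVertex.deletes (h : DeletesVertex S T x j) (hy : j y = S.v x) :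
    Deletes S.f S.v S.e T.f T.v T.e x j y (T.f y) where
  a_a := S.f_f
  b_b := S.v_v
  c_c := S.e_e
  a_c := h.valence_two.symm
  b_ne := S.v_ne
  a_ne := h.interior
  c_ne_a := h.e_ne_f
  injective := h.injective
  range u := by rw [vertex_set h, h.range]; rfl
  map_a := h.f
  map_c := h.e
  skip_b t := by rw [vertex_set h]; exact h.v t
  j_y := hy
  j_z := by rw [h.f, hy, S.v_f]

theorem DeletesVertex.exists_y (h : DeletesVertex S T x j) : ∃ y, j y = S.v x := by
  have := h.v_notMem
  rwa [← Set.mem_compl_iff, ← h.range] at this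

/-- An edge has the flags `x`, `f x`, `v x`, `v (f x)` only. If `e x` were one of them, a forbidden
coincidence would result, in the last two cases that `v x` is at the deleted vertex. So the two
edges at this vertex are different. -/
theorem DeletesVertex.not_around (h : DeletesVertex S T x j) : ¬Around S.f S.v x (S.e x) := by
  intro h'
  have h2 := (h'.closed (P := fun u => u = x ∨ u = S.f x ∨ u = S.v x ∨ u = S.v (S.f x)) S.f_f S.v_v
    ?_ ?_).1 (.inl rfl)
  · rcases h2 with h2 | h2 | h2 | h2
    · exact S.e_ne x h2
    · exact h.e_ne_f h2
    · exact h.v_notMem (by rw [← h2]; simp)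
    · refine h.v_notMem ?_
      rw [S.v_f] at h2
      rw [← S.f_f (S.v x), ← h2, ← h.valence_two]
      simp
  · rintro u (rfl | rfl | rfl | rfl)
    · simp
    · simp [S.f_f]
    · simp [S.v_f]
    · simp [← S.v_f, S.f_f]
  · rintro u (rfl | rfl | rfl | rfl)
    · simp
    · simp
    · simp [S.v_v]
    · simp [S.v_v]

theorem sameFace_v (u : S.X) : SameFace S u (S.v u) := .rel _ _ (.inl rfl)
theorem sameFace_e (u : S.X) : SameFace S u (S.e u) := .rel _ _ (.inr rfl)

theorem DeletesEdge.mem_range (h : DeletesEdge S T x j) {u : S.X} :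
    (∃ t, j t = u) ↔ u ≠ x ∧ u ≠ S.v x ∧ u ≠ S.f x ∧ u ≠ S.v (S.f x) := by
  rw [← Set.mem_range, h.range]
  simp

theorem DeletesEdge.exists_yz (h : DeletesEdge S T x j) (hx : ¬SameFace S x (S.f x))
    (hx' : S.e x ≠ S.v x) : (∃ y, j y = S.e x) ∧ ∃ z, j z = S.e (S.v x) := by
  have h0 : SameFace S x (S.v (S.f x)) → False := fun h' =>
    hx (.trans _ _ _ h' (.symm _ _ (sameFace_v _)))
  rw [h.mem_range, h.mem_range]
  refine ⟨⟨S.e_ne x, hx', fun h' => hx ?_, fun h' => h0 ?_⟩,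
    fun h' => hx' ?_, S.e_ne _, fun h' => hx ?_, fun h' => h0 ?_⟩
  · exact h' ▸ sameFace_e x
  · exact h' ▸ sameFace_e x
  · conv_lhs => rw [← h']
    exact S.e_e _
  · exact h' ▸ .trans _ _ _ (sameFace_v x) (sameFace_e _)
  · exact h' ▸ .trans _ _ _ (sameFace_v x) (sameFace_e _)

/-- Removing one side from a polygon leaves a path from `y` to `z`. For the proof, consider the
flags in the new face of `y` that come from the old face of `x`. If `z` were not among them, `T.v`
would pair them all, and `T.e` all except `y`, which contradicts parity. -/
theorem DeletesEdge.around_yz (h : DeletesEdge S T x j) (hx : ¬SameFace S x (S.f x))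
    (hy : j y = S.e x) (hz : j z = S.e (S.v x)) : Around T.v T.e y z := by
  by_contra hyz
  have := T.finite
  refine exists_fixed_of_involutions (C := {t | Around T.v T.e y t ∧ SameFace S x (j t)})
    (p := T.v) (q := T.e) (y := y) ⟨.refl _, hy ▸ sameFace_e x⟩ ?_ ?_
  · rintro t ⟨h1, h2⟩
    refine ⟨⟨.trans _ _ _ h1 (.rel _ _ (.inl rfl)), ?_⟩, T.v_v t, T.v_ne t⟩
    rw [h.v]
    exact .trans _ _ _ h2 (sameFace_v _)
  · rintro t ⟨h1, h2⟩ hty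
    have h3 : Around T.v T.e y (T.e t) := .trans _ _ _ h1 (.rel _ _ (.inr rfl))
    have h4 : j (T.e t) = S.e (j t) := by
      refine skipTo_here (h.e t) fun h5 => ?_
      have h6 : SameFace S x (S.e (j t)) := .trans _ _ _ h2 (sameFace_e _)
      rcases h5 with h5 | h5 | h5 | h5
      · exact hty (h.injective (by rw [hy, ← h5, S.e_e]))
      · refine hyz ?_
        rwa [h.injective (show j z = j t by rw [hz, ← h5, S.e_e])]
      · exact hx (h5 ▸ h6)
      · exact hx (.trans _ _ _ (h5 ▸ h6) (.symm _ _ (sameFace_v _)))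
    refine ⟨⟨h3, ?_⟩, fun h5 => ?_, T.e_e t, T.e_ne t⟩
    · rw [h4]
      exact .trans _ _ _ h2 (sameFace_e _)
    · have h6 := h.mem_range.1 ⟨t, rfl⟩
      rw [h5, hy] at h4
      refine h6.1 ?_
      rw [← S.e_e (j t), ← h4, S.e_e]

/-- The face has the word `α c β c⁻¹`. The sides between `v x` and `f x` form one of the words `α`
and `β`. The flags of this word are preserved by the operations of `T`; `z` is one of them and `y`
is not. -/
theorem DeletesEdge.not_around_yz (h : DeletesEdge S T x j)
    (hx : ∃ n : ℕ, (fun w => S.v (S.e w))^[n] (S.v x) = S.f x)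
    (hy : j y = S.e x) (hz : j z = S.e (S.v x)) : ¬Around T.v T.e y z := by
  classical
  -- The least `n` is taken, so that the walk neither reaches `f x` earlier nor runs around the
  -- whole face.
  have hn := Nat.find_spec hx
  have hmin := fun m (hm : m < Nat.find hx) => Nat.find_min hx hm
  generalize Nat.find hx = n at hn hmin
  set w : ℕ → S.X := fun k => (fun w => S.v (S.e w))^[k] (S.v x) with hw
  have hw0 : w 0 = S.v x := rfl
  have hws : ∀ k, w (k + 1) = S.v (S.e (w k)) := fun k => Function.iterate_succ_apply' _ _ _
  have hne : ∀ i k, S.e (w i) ≠ w k := fun i k =>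
    polygon_ne_of S.v_v S.e_e S.v_ne S.e_ne i k (S.v x)
  change w n = S.f x at hn
  change ∀ m < n, ¬w m = S.f x at hmin
  have hn0 : n ≠ 0 := by
    rintro rfl
    exact S.f_ne_v x (hn.symm.trans hw0)
  obtain ⟨n, rfl⟩ := Nat.exists_eq_succ_of_ne_zero hn0
  have hlast : S.e (w n) = S.v (S.f x) := by rw [← hn, hws, S.v_v]
  have hx1 : ∀ k, x ≠ w k := by
    rintro (_ | k) hk
    · exact S.v_ne x (hw0.symm.trans hk.symm)
    · rw [hws] at hk
      exact hne k 0 (by rw [hw0, hk, S.v_v])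
  have hx2 : ∀ k < n + 1, x ≠ S.e (w k) := by
    intro k hk hk'
    have h1 : w (k + 1) = w 0 := by rw [hws, ← hk', hw0]
    have h2 : ∀ i, w (i + (k + 1)) = w i := by
      intro i
      induction i with
      | zero => rw [Nat.zero_add, h1]
      | succ i ih => rw [Nat.succ_add, hws, ih, ← hws]
    obtain ⟨r, hr⟩ := Nat.exists_eq_add_of_le' (show k + 1 ≤ n + 1 by omega)
    exact hmin r (by omega) (by rw [← h2, ← hr, hn])
  have hf1 : ∀ k < n + 1, S.f x ≠ w k := fun k hk hk' => hmin k hk hk'.symm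
  have hf2 : ∀ k, S.f x ≠ S.e (w k) := fun k hk => hne k (n + 1) (by rw [← hk, hn])
  set P : S.X → Prop := fun u => ∃ k < n + 1, u = w k ∨ u = S.e (w k) with hP
  have hPx : ¬P x := by
    rintro ⟨k, hk, hk' | hk'⟩
    exacts [hx1 k hk', hx2 k hk hk']
  have hPf : ¬P (S.f x) := by
    rintro ⟨k, hk, hk' | hk'⟩
    exacts [hf1 k hk hk', hf2 k hk']
  have hPe : ∀ u, P u → P (S.e u) := by
    rintro u ⟨k, hk, rfl | rfl⟩
    exacts [⟨k, hk, .inr rfl⟩, ⟨k, hk, .inl (S.e_e _)⟩]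
  have hskip : ∀ u u', SkipTo {x, S.v x, S.f x, S.v (S.f x)} (fun z => S.e (S.f z)) u u' →
      P u → P u' := by
    intro u u' hs
    induction hs with
    | here => exact fun h' => h'
    | next hd _ ih =>
      intro hu
      refine ih ?_
      rcases hd with rfl | rfl | rfl | rfl
      · exact absurd hu hPx
      · refine hPe _ ⟨n, by omega, .inr ?_⟩
        rw [hlast, S.v_f]
      · exact absurd hu hPf
      · refine hPe _ ⟨0, by omega, .inl ?_⟩
        rw [hw0, S.v_f, S.f_f]
  intro hyz
  have hc := hyz.closed (P := fun t => P (j t)) T.v_v T.e_e ?_ fun t ht => hskip _ _ (h.e t) (hPe _ ht)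
  · refine hPx ?_
    rw [← S.e_e x, ← hy]
    refine hPe _ (hc.2 ?_)
    rw [hz]
    exact ⟨0, by omega, .inr rfl⟩
  · rintro t ⟨k, hk, hk' | hk'⟩
    · rw [h.v, hk']
      rcases k with _ | k
      · exact absurd (hk'.trans hw0) (h.mem_range.1 ⟨t, rfl⟩).2.1
      · exact ⟨k, by omega, .inr (by rw [hws, S.v_v])⟩
    · rw [h.v, hk', ← hws]
      rcases Nat.lt_or_ge (k + 1) (n + 1) with h1 | h1
      · exact ⟨k + 1, h1, .inl rfl⟩
      · obtain rfl : k = n := by omega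
        exact absurd (hk'.trans hlast) (h.mem_range.1 ⟨t, rfl⟩).2.2.2

theorem around_of_iterate (hx : ∃ n : ℕ, (fun w => S.v (S.e w))^[n] (S.v x) = S.f x) :
    Around S.v S.e x (S.f x) := by
  obtain ⟨n, hn⟩ := hx
  rw [← hn]
  clear hn
  induction n with
  | zero => exact .rel _ _ (.inl rfl)
  | succ n ih =>
    rw [Function.iterate_succ_apply']
    exact .trans _ _ _ ih (.trans _ _ _ (.rel _ _ (.inr rfl)) (.rel _ _ (.inl rfl)))

end Cob
-- Colourings, the partition function, and its invariance under moves
namespace Deletes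

variable {X Y : Type} {a b c : X → X} {a' b' c' : Y → Y} {x : X} {j : Y → X} {y z : Y} {Z : Type*}

theorem invariant_of_eq (h : Deletes a b c a' b' c' x j y z) {γ : X → Z}
    (ha : ∀ u, γ (a u) = γ u) (hc : ∀ u, γ (c u) = γ u) {u : X}
    (hu : u ∈ ({x, a x, c x, a (c x)} : Set X)) : γ u = γ x := by
  rcases hu with rfl | rfl | rfl | rfl <;> simp only [ha, hc]

theorem restrict_b (h : Deletes a b c a' b' c' x j y z) {γ : X → Z}
    (hb : ∀ u, γ (b u) = γ u) (hc : ∀ u, γ (c u) = γ u) (t : Y) : γ (j (b' t)) = γ (j t) :=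
  (skipTo_inv (fun d _ => (hb _).trans (hc d)) (h.skip_b t)).trans (hb _)

theorem ext_of_restrict (h : Deletes a b c a' b' c' x j y z) {γ γ' : X → Z}
    (ha : ∀ u, γ (a u) = γ u) (hb : ∀ u, γ (b u) = γ u) (hc : ∀ u, γ (c u) = γ u)
    (ha' : ∀ u, γ' (a u) = γ' u) (hb' : ∀ u, γ' (b u) = γ' u) (hc' : ∀ u, γ' (c u) = γ' u)
    (hj : ∀ t, γ (j t) = γ' (j t)) : γ = γ' := by
  funext u
  by_cases hu : u ∈ ({x, a x, c x, a (c x)} : Set X)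
  · rw [h.invariant_of_eq ha hc hu, h.invariant_of_eq ha' hc' hu, ← hb x, ← hb' x, ← h.j_y, hj]
  · obtain ⟨t, rfl⟩ := (h.range _).2 hu
    exact hj t

/-- All deleted elements get the colour of `y`. They are connected with `y` and with `z`, so
equality of these two colours is what is needed. -/
theorem exists_extend (h : Deletes a b c a' b' c' x j y z) {γ : Y → Z}
    (ha : ∀ t, γ (a' t) = γ t) (hb : ∀ t, γ (b' t) = γ t) (hc : ∀ t, γ (c' t) = γ t)
    (hyz : γ y = γ z) : ∃ γ' : X → Z, (∀ u, γ' (a u) = γ' u) ∧ (∀ u, γ' (b u) = γ' u) ∧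
      (∀ u, γ' (c u) = γ' u) ∧ ∀ t, γ' (j t) = γ t := by
  have hj : ∀ t, Function.extend j γ (fun _ => γ y) (j t) = γ t := fun t =>
    h.injective.extend_apply _ _ _
  have hD : ∀ u ∈ ({x, a x, c x, a (c x)} : Set X), Function.extend j γ (fun _ => γ y) u = γ y :=
    fun u hu => Function.extend_apply' _ _ _ fun hu' => (h.range u).1 hu' hu
  have hDb : ∀ d ∈ ({x, a x, c x, a (c x)} : Set X),
      Function.extend j γ (fun _ => γ y) (b d) = γ y := by
    intro d hd
    by_cases hbd : b d ∈ ({x, a x, c x, a (c x)} : Set X)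
    · exact hD _ hbd
    · obtain ⟨t, ht⟩ := (h.range _).2 hbd
      rw [← ht, hj]
      rcases hd with rfl | rfl | rfl | rfl
      · rw [h.injective (ht.trans h.j_y.symm)]
      · rw [h.injective (ht.trans h.j_z.symm), hyz]
      · rw [← h.next_eq (by simp) ht (t' := y) (by rw [h.c_c, h.j_y]), hb]
      · rw [hyz, ← h.next_eq (by simp) ht (t' := z) (by rw [h.a_c, h.c_c, h.j_z]), hb]
  refine ⟨Function.extend j γ fun _ => γ y, fun u => ?_, fun u => ?_, fun u => ?_, hj⟩
  all_goals by_cases hu : u ∈ ({x, a x, c x, a (c x)} : Set X)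
  · rw [hD _ hu, hD _ (h.a_mem hu)]
  · obtain ⟨t, rfl⟩ := (h.range _).2 hu
    rw [← h.map_a, hj, hj, ha]
  · rw [hD _ hu, hDb _ hu]
  · obtain ⟨t, rfl⟩ := (h.range _).2 hu
    by_cases hbt : b (j t) ∈ ({x, a x, c x, a (c x)} : Set X)
    · exact (hD _ hbt).trans ((hDb _ hbt).symm.trans (congrArg _ (h.b_b _)))
    · rw [← skipTo_here (h.skip_b t) hbt, hj, hj, hb]
  · rw [hD _ hu, hD _ (h.c_mem hu)]
  · obtain ⟨t, rfl⟩ := (h.range _).2 hu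
    rw [← h.map_c, hj, hj, hc]

end Deletes

namespace Cob

variable {O : Type} [InvolutiveNeg O] {B : Type} {M N P : Curve O B} {K : Type*} [CommRing K]

/-- A colouring of the connected components of a surface. -/
def IsColouring (S : Cob M N) (γ : S.X → Bool) : Prop :=
  ∀ x, γ (S.v x) = γ x ∧ γ (S.e x) = γ x ∧ γ (S.f x) = γ x

theorem finite_colouring (S : Cob M N) : Finite {γ // IsColouring S γ} := by
  have := S.finite
  infer_instance

noncomputable instance (S : Cob M N) : Fintype {γ // IsColouring S γ} :=
  @Fintype.ofFinite _ (finite_colouring S)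

variable (w : Bool → Kˣ)

/-- The product over the components of the surface, to the power of the Euler characteristic. -/
noncomputable def weight (S : Cob M N) (γ : S.X → Bool) : Kˣ :=
  orbProd S.e S.f (fun x => w (γ x)) * (orbProd S.v S.f fun x => w (γ x))⁻¹ *
    orbProd S.v S.e fun x => w (γ x)

open Classical in
/-- The sum of the weights of the colourings with given values on the boundary. -/
noncomputable def partition (S : Cob M N) (h : M.X ⊕ N.X → Bool) : K :=
  ∑ γ : {γ // IsColouring S γ}, if (fun u => γ.1 (S.i u)) = h then (weight w S γ.1 : K) else 0

variable {S T : Cob M N}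

section

variable {γ : S.X → Bool} {Z : Type*} 

theorem IsColouring.ef (hγ : IsColouring S γ) (w : Bool → Z) : Invariant S.e S.f fun x => w (γ x) := fun x =>
  ⟨congrArg w (hγ x).2.1, congrArg w (hγ x).2.2⟩
theorem IsColouring.vf (hγ : IsColouring S γ) (w : Bool → Z) : Invariant S.v S.f fun x => w (γ x) := fun x =>
  ⟨congrArg w (hγ x).1, congrArg w (hγ x).2.2⟩
theorem IsColouring.ve (hγ : IsColouring S γ) (w : Bool → Z) : Invariant S.v S.e fun x => w (γ x) := fun x =>
  ⟨congrArg w (hγ x).1, congrArg w (hγ x).2.1⟩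

end

open Classical in
-- Restriction along `j` is a bijection from the colourings of `S` to those colourings of `T` that
-- satisfy `p`, and `κ` is the ratio of the weights.
theorem partition_of_restrict (j : T.X → S.X) (hi : ∀ u, j (T.i u) = S.i u)
    (hr : ∀ γ, IsColouring S γ → IsColouring T fun t => γ (j t))
    (hinj : ∀ γ γ', IsColouring S γ → IsColouring S γ' → (∀ t, γ (j t) = γ' (j t)) → γ = γ')
    (p : (T.X → Bool) → Prop) [DecidablePred p] (hp : ∀ γ, IsColouring S γ → p fun t => γ (j t))
    (hsurj : ∀ γ, IsColouring T γ → p γ → ∃ γ', IsColouring S γ' ∧ ∀ t, γ' (j t) = γ t)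
    (κ : (T.X → Bool) → Kˣ)
    (hw : ∀ γ, IsColouring S γ → weight w S γ = weight w T (fun t => γ (j t)) * κ fun t => γ (j t))
    (h : M.X ⊕ N.X → Bool) : partition w S h = ∑ γ : {γ // IsColouring T γ},
      if p γ.1 then if (fun u => γ.1 (T.i u)) = h then (weight w T γ.1 : K) * κ γ.1 else 0
      else 0 := by
  rw [partition, ← Finset.sum_filter (p := fun γ : {γ // IsColouring T γ} => p γ.1)]
  refine Finset.sum_bij (fun γ _ => ⟨_, hr γ.1 γ.2⟩) (fun γ _ => ?_) (fun γ _ γ' _ h => ?_)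
    (fun γ hγ => ?_) fun γ _ => ?_
  · simpa using hp γ.1 γ.2
  · exact Subtype.ext (hinj _ _ γ.2 γ'.2 (congrFun (congrArg Subtype.val h)))
  · obtain ⟨γ', h1, h2⟩ := hsurj γ.1 γ.2 (by simpa using hγ)
    exact ⟨⟨γ', h1⟩, Finset.mem_univ _, Subtype.ext (funext h2)⟩
  · simp only [hi, hw _ γ.2, Units.val_mul]

/-- Orientations and seams do not enter the partition function. So this covers isomorphisms and
also, for `ω = 1`, the fringe relations. -/
theorem partition_of_equiv (φ : S.X ≃ T.X) (hv : ∀ y, φ (S.v y) = T.v (φ y))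
    (he : ∀ y, φ (S.e y) = T.e (φ y)) (hf : ∀ y, φ (S.f y) = T.f (φ y))
    (hi : ∀ u, φ (S.i u) = T.i u) : partition w S = partition w T := by
  have hv' : ∀ y, φ.symm (T.v y) = S.v (φ.symm y) := fun y => by
    rw [Equiv.symm_apply_eq, hv, φ.apply_symm_apply]
  have he' : ∀ y, φ.symm (T.e y) = S.e (φ.symm y) := fun y => by
    rw [Equiv.symm_apply_eq, he, φ.apply_symm_apply]
  have hf' : ∀ y, φ.symm (T.f y) = S.f (φ.symm y) := fun y => by
    rw [Equiv.symm_apply_eq, hf, φ.apply_symm_apply]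
  funext h
  rw [partition_of_restrict w φ.symm (fun u => by rw [Equiv.symm_apply_eq, hi])
    (fun γ hγ t => by simpa only [hv', he', hf'] using hγ _)
    (fun γ γ' _ _ h => funext fun x => by simpa using h (φ x)) (fun _ => True) (fun _ _ => trivial)
    (fun γ hγ _ => ⟨fun x => γ (φ x), fun x => by simpa only [hv, he, hf] using hγ _, by simp⟩)
    (fun _ => 1) (fun γ hγ => ?_)]
  · simp [partition]
  · rw [weight, weight, orbProd_eq_of_equiv φ.symm he' hf' (hγ.ef w),
      orbProd_eq_of_equiv φ.symm hv' hf' (hγ.vf w), orbProd_eq_of_equiv φ.symm hv' he' (hγ.ve w),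
      mul_one]

theorem DeletesEdge.isColouring {x : S.X} {j : T.X → S.X} (h : DeletesEdge S T x j) {y z : T.X}
    (hy : j y = S.e x) (hz : j z = S.e (S.v x)) {γ : S.X → Bool} (hγ : IsColouring S γ) :
    IsColouring T fun t => γ (j t) := fun t => by
  refine ⟨?_, (h.deletes hy hz).restrict_b (fun u => (hγ u).2.1) (fun u => (hγ u).2.2) t, ?_⟩
  · simp only [h.v, (hγ _).1]
  · simp only [h.f, (hγ _).2.2]

open Classical in
theorem DeletesEdge.partition {x : S.X} {j : T.X → S.X} (h : DeletesEdge S T x j) {y z : T.X}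
    (hy : j y = S.e x) (hz : j z = S.e (S.v x)) (κ : (T.X → Bool) → Kˣ)
    (hw : ∀ γ, IsColouring S γ → weight w S γ = weight w T (fun t => γ (j t)) * κ fun t => γ (j t))
    (h' : M.X ⊕ N.X → Bool) : Cob.partition w S h' = ∑ γ : {γ // IsColouring T γ},
      if γ.1 y = γ.1 z then
        if (fun u => γ.1 (T.i u)) = h' then (weight w T γ.1 : K) * κ γ.1 else 0 else 0 := by
  refine partition_of_restrict w j h.i (fun γ hγ => h.isColouring hy hz hγ)
    (fun γ γ' hγ hγ' hj => (h.deletes hy hz).ext_of_restrict (fun u => (hγ u).1)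
      (fun u => (hγ u).2.1) (fun u => (hγ u).2.2) (fun u => (hγ' u).1)
      (fun u => (hγ' u).2.1) (fun u => (hγ' u).2.2) hj)
    (fun γ => γ y = γ z) (fun γ hγ => ?_) (fun γ hγ hp => ?_) κ hw h'
  · simp only [hy, hz, (hγ _).1, (hγ _).2.1]
  · obtain ⟨γ', h1, h2, h3, h4⟩ := (h.deletes hy hz).exists_extend (fun u => (hγ u).1)
      (fun u => (hγ u).2.1) (fun u => (hγ u).2.2) hp
    exact ⟨γ', fun u => ⟨h1 u, h2 u, h3 u⟩, h4⟩

/-- One edge disappears and two faces become one, so the weight of each colouring stays the same. As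
`y` and `z` are in the same face of `T`, their colours agree automatically. -/
theorem partition_edge {x : S.X} {j : T.X → S.X} (h : DeletesEdge S T x j)
    (hx : ¬SameFace S x (S.f x)) (hx' : S.e x ≠ S.v x) : partition w S = partition w T := by
  have := S.finite
  have := T.finite
  obtain ⟨⟨y, hy⟩, z, hz⟩ := h.exists_yz hx hx'
  have hd := h.deletes hy hz
  have hyz := h.around_yz hx hy hz
  funext h'
  rw [h.partition w hy hz (fun _ => 1) fun γ hγ => ?_, Cob.partition]
  · refine Finset.sum_congr rfl fun γ _ => ?_
    rw [if_pos ((γ.2.ve fun b => b).eq hyz)]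
    simp
  · have h1 := hd.orbProd_ab_merge hyz hx (hγ.ve w) (by simp only [(hγ _).2.2])
    have h2 := hd.orbProd_ac (hγ.vf w)
    have h3 := hd.orbProd_bc (hγ.ef w)
    rw [weight, weight, h1, h2, ← h3]
    rw [mul_comm _ (w (γ x)), mul_comm (orbProd T.v T.e _), mul_one]
    group

/-- One vertex disappears and two edges become one. -/
theorem partition_vertex {x : S.X} {j : T.X → S.X} (h : DeletesVertex S T x j) :
    partition w S = partition w T := by
  have := S.finite
  have := T.finite
  obtain ⟨y, hy⟩ := h.exists_y
  have hd := h.deletes hy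
  funext h'
  rw [partition_of_restrict w j h.i (fun γ hγ t => ?_) (fun γ γ' hγ hγ' hj => ?_) (fun _ => True)
    (fun _ _ => trivial) (fun γ hγ _ => ?_) (fun _ => 1) (fun γ hγ => ?_)]
  · simp [partition]
  · refine ⟨hd.restrict_b (fun u => (hγ u).1) (fun u => (hγ u).2.1) t, ?_, ?_⟩
    · simp only [h.e, (hγ _).2.1]
    · simp only [h.f, (hγ _).2.2]
  · exact hd.ext_of_restrict (fun u => (hγ u).2.2) (fun u => (hγ u).1) (fun u => (hγ u).2.1)
      (fun u => (hγ' u).2.2) (fun u => (hγ' u).1) (fun u => (hγ' u).2.1) hj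
  · obtain ⟨γ', h1, h2, h3, h4⟩ := hd.exists_extend (fun u => (hγ u).2.2)
      (fun u => (hγ u).1) (fun u => (hγ u).2.1) (hγ y).2.2.symm
    exact ⟨γ', fun u => ⟨h2 u, h3 u, h1 u⟩, h4⟩
  · have hT : IsColouring T fun t => γ (j t) := fun t => by
      refine ⟨hd.restrict_b (fun u => (hγ u).1) (fun u => (hγ u).2.1) t, ?_, ?_⟩
      · simp only [h.e, (hγ _).2.1]
      · simp only [h.f, (hγ _).2.2]
    have hfv : ∀ {S : Cob M N} {γ : S.X → Bool}, IsColouring S γ →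
      Invariant S.f S.v fun x => w (γ x) := fun hγ x => ((hγ.vf w) x).symm
    have hfe : ∀ {S : Cob M N} {γ : S.X → Bool}, IsColouring S γ →
      Invariant S.f S.e fun x => w (γ x) := fun hγ x => ((hγ.ef w) x).symm
    have h1 := hd.orbProd_ab_merge (.rel _ _ (.inl rfl)) h.not_around (hfv hγ)
      (by simp only [(hγ _).2.1])
    have h2 := hd.orbProd_ac (hfe hγ)
    have h3 := hd.orbProd_bc (hγ.ve w)
    rw [weight, weight, orbProd_comm (hfv hγ), orbProd_comm (hfe hγ), h1, h2, ← h3,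
      orbProd_comm (hfv hT), orbProd_comm (hfe hT)]
    simp only [mul_inv_rev, mul_one]
    group

open Classical in
-- One edge disappears and one face becomes two, so cutting raises the Euler characteristic by 2,
-- which the factor `w⁻²` undoes. A colouring before the cut is one after it with equal colours at
-- the two discs.
theorem partition_neck {x : S.X} {j : T.X → S.X} (h : DeletesEdge S T x j)
    (hx : ∃ n : ℕ, (fun w => S.v (S.e w))^[n] (S.v x) = S.f x)
    {y z} (hy : j y = S.e x) (hz : j z = S.e (S.v x)) (h' : M.X ⊕ N.X → Bool) :
    partition w S h' = ∑ γ : {γ // IsColouring T γ},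
      if γ.1 y = γ.1 z then if (fun u => γ.1 (T.i u)) = h' then
        (weight w T γ.1 : K) * ((w (γ.1 y) ^ 2)⁻¹ : Kˣ) else 0 else 0 := by
  have := S.finite
  have := T.finite
  have hd := h.deletes hy hz
  rw [h.partition w hy hz (fun γ => (w (γ y) ^ 2)⁻¹) fun γ hγ => ?_]
  have h1 := hd.orbProd_ab_divide (h.not_around_yz hx hy hz) (around_of_iterate hx) (hγ.ve w)
  have h2 := hd.orbProd_ac (hγ.vf w)
  have h3 := hd.orbProd_bc (hγ.ef w)
  rw [weight, weight, h1, h2, ← h3]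
  simp only [hy, (hγ x).2.1]
  rw [mul_comm (orbProd T.v T.f _), mul_comm (orbProd S.v S.e _), mul_right_comm _ _ (_ ^ 2)⁻¹]
  group

end Cob
-- Handles and spheres in the partition function
namespace Cob

variable {O : Type} [InvolutiveNeg O] {B : Type} {M N P : Curve O B} {K : Type*} [CommRing K]
  {G : Type*} [CommGroup G] (w : Bool → Kˣ) (S : Cob M N) (x : S.X)

theorem around_handleV8 (k : Fin 8) :
    Around (handleE S x) (Sum.map S.v handleV8) (.inl x) (.inr k) := by
  have h0 : Around (handleE S x) (Sum.map S.v handleV8) (.inl x) (.inr 0) :=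
    .rel _ _ (.inl (handleE_x S x).symm)
  have h1 := h0.trans _ _ _ (.rel _ (.inr 1) (.inr rfl))
  have h2 := h1.trans _ _ _ (.rel _ (.inr 2) (.inl rfl))
  have h3 := h2.trans _ _ _ (.rel _ (.inr 3) (.inr rfl))
  have h4 := h3.trans _ _ _ (.rel _ (.inr 4) (.inl rfl))
  have h5 := h4.trans _ _ _ (.rel _ (.inr 5) (.inr rfl))
  have h6 := h5.trans _ _ _ (.rel _ (.inr 6) (.inl rfl))
  have h7 := h6.trans _ _ _ (.rel _ (.inr 7) (.inr rfl))
  fin_cases k <;> assumption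

/-- The word `a b a⁻¹ b⁻¹` makes all its corners one vertex, here that of `x`. -/
theorem around_handleF8 (k : Fin 8) :
    Around (handleE S x) (Sum.map S.f handleF8) (.inl x) (.inr k) := by
  have h0 : Around (handleE S x) (Sum.map S.f handleF8) (.inl x) (.inr 0) :=
    .rel _ _ (.inl (handleE_x S x).symm)
  have h5 := h0.trans _ _ _ (.rel _ (.inr 5) (.inr rfl))
  have h6 := h5.trans _ _ _ (.rel _ (.inr 6) (.inl rfl))
  have h3 := h6.trans _ _ _ (.rel _ (.inr 3) (.inr rfl))
  have h4 := h3.trans _ _ _ (.rel _ (.inr 4) (.inl rfl))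
  have h1 := h4.trans _ _ _ (.rel _ (.inr 1) (.inr rfl))
  have h2 := h1.trans _ _ _ (.rel _ (.inr 2) (.inl rfl))
  have h7 := h2.trans _ _ _ (.rel _ (.inr 7) (.inr rfl))
  fin_cases k <;> assumption

theorem around_handle_inl_e {q : S.X ⊕ Fin 8 → S.X ⊕ Fin 8}
    (h8 : ∀ k, Around (handleE S x) q (.inl x) (.inr k)) (y : S.X) :
    Around (handleE S x) q (.inl (S.e y)) (.inl y) := by
  have hx : Around (handleE S x) q (.inl (S.e x)) (.inl x) :=
    .trans _ _ _ (.rel _ _ (.inl (handleE_ex S x).symm)) (.symm _ _ (h8 7))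
  by_cases h1 : y = x
  · exact h1 ▸ hx
  · by_cases h2 : y = S.e x
    · rw [h2, S.e_e]
      exact .symm _ _ hx
    · exact .symm _ _ (.rel _ _ (.inl (handleE_inl S x h1 h2).symm))

theorem invariant_handleE {q : S.X → S.X} {q8 : Fin 8 → Fin 8} {Z : Type*} {r : S.X → Z}
    (hr : Invariant S.e q r) :
    Invariant (handleE S x) (Sum.map q q8) (Sum.elim r fun _ => r x) := by
  rintro (y | k)
  · refine ⟨?_, (hr y).2⟩
    by_cases h1 : y = x
    · rw [h1, handleE_x]; rfl
    · by_cases h2 : y = S.e x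
      · rw [h2, handleE_ex]
        exact (hr x).1.symm
      · rw [handleE_inl S x h1 h2]
        exact (hr y).1
  · refine ⟨?_, rfl⟩
    fin_cases k
    · rfl
    · rfl
    · rfl
    · rfl
    · rfl
    · rfl
    · rfl
    · exact (hr x).1

/-- When all new flags are in the orbit of `x`, there is no new orbit. This is applied with `q = f`
for vertices and with `q = v` for faces. -/
theorem orbProd_handleE {q : S.X → S.X} {q8 : Fin 8 → Fin 8}
    (h8 : ∀ k, Around (handleE S x) (Sum.map q q8) (.inl x) (.inr k)) {g : S.X ⊕ Fin 8 → G}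
    (hg : Invariant (handleE S x) (Sum.map q q8) g) :
    orbProd S.e q (fun y => g (.inl y)) = orbProd (handleE S x) (Sum.map q q8) g := by
  refine orbProd_eq_of_map Sum.inl (fun y => ⟨?_, ?_⟩)
    (Sum.elim (Orb.mk S.e q) fun _ => Orb.mk S.e q x)
    (invariant_handleE S x fun y => ⟨Orb.mk_left y, Orb.mk_right y⟩) (fun _ => rfl) ?_ hg
  · exact Orb.mk_eq_iff.2 (around_handle_inl_e S x h8 y)
  · exact Orb.mk_eq_iff.2 (.symm _ _ (.rel _ _ (.inr rfl)))
  · rintro (y | k)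
    exacts [⟨y, .refl _⟩, ⟨x, h8 k⟩]

variable {S x}

theorem IsColouring.inr_eq {γ : S.X ⊕ Fin 8 → Bool} (hγ : IsColouring (addHandle S x) γ)
    (k : Fin 8) : γ (.inr k) = γ (.inl x) :=
  ((hγ.ef fun b => b).eq (around_handleF8 S x k)).symm

theorem IsColouring.of_addHandle {γ : S.X ⊕ Fin 8 → Bool} (hγ : IsColouring (addHandle S x) γ) :
    IsColouring S fun y => γ (.inl y) := fun y =>
  ⟨(hγ (.inl y)).1, (hγ.ef fun b => b).eq (around_handle_inl_e S x (around_handleF8 S x) y),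
    (hγ (.inl y)).2.2⟩

theorem card_orb_handle8 : Nat.card (Orb handleV8 handleF8) = 2 := by
  rw [card_orb ![0, 0, 2, 2, 0, 0, 2, 2] (by unfold Invariant; decide)]
  · decide
  · intro k
    have h : ∀ k, ![0, 0, 2, 2, 0, 0, 2, 2] k = k ∨ ![0, 0, 2, 2, 0, 0, 2, 2] k = handleV8 k ∨
      ![0, 0, 2, 2, 0, 0, 2, 2] k = handleF8 k ∨
      ![0, 0, 2, 2, 0, 0, 2, 2] k = handleF8 (handleV8 k) := by decide
    rcases h k with h | h | h | h <;> rw [h]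
    · exact .refl _
    · exact .rel _ _ (.inl rfl)
    · exact .rel _ _ (.inr rfl)
    · exact .trans _ _ _ (.rel _ _ (.inl rfl)) (.rel _ _ (.inr rfl))

/-- A handle adds two edges and no vertices or faces, so it lowers the Euler characteristic of its
component by 2. -/
theorem weight_addHandle {γ : S.X ⊕ Fin 8 → Bool} (hγ : IsColouring (addHandle S x) γ) :
    weight w (addHandle S x) γ = weight w S (fun y => γ (.inl y)) * (w (γ (.inl x)) ^ 2)⁻¹ := by
  have := S.finite
  have h1 : orbProd (handleE S x) (handleF S) (fun y => w (γ y)) = _ :=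
    (orbProd_handleE S x (around_handleF8 S x) (hγ.ef w)).symm
  have h2 : orbProd (Sum.map S.v handleV8) (handleF S) (fun y => w (γ y)) = _ :=
    orbProd_sum S.v_v (by decide) S.f_f (by decide) (hγ.vf w)
  have hev : Invariant (handleE S x) (Sum.map S.v handleV8) fun y => w (γ y) :=
    fun y => (hγ.ve w y).symm
  have h3 : orbProd (Sum.map S.v handleV8) (handleE S x) (fun y => w (γ y)) = _ :=
    (orbProd_comm hev).trans (orbProd_handleE S x (around_handleV8 S x) hev).symm
  have h4 : orbProd handleV8 handleF8 (fun k => w (γ (.inr k))) = w (γ (.inl x)) ^ 2 := by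
    simp only [hγ.inr_eq]
    rw [orbProd_const, card_orb_handle8]
  rw [orbProd_comm fun y => (hγ.of_addHandle.ve w y)] at h3
  change orbProd (handleE S x) (handleF S) (fun y => w (γ y)) *
    (orbProd (Sum.map S.v handleV8) (handleF S) (fun y => w (γ y)))⁻¹ *
    orbProd (Sum.map S.v handleV8) (handleE S x) (fun y => w (γ y)) = _
  rw [h1, h2, h3, h4, weight, mul_comm _ (_ ^ 2), mul_inv_rev, ← mul_assoc, mul_right_comm _ _⁻¹]

open Classical in
theorem partition_addHandle (S : Cob M N) (x : S.X) (h : M.X ⊕ N.X → Bool) :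
    partition w (addHandle S x) h = ∑ γ : {γ // IsColouring S γ},
      if (fun u => γ.1 (S.i u)) = h then (weight w S γ.1 : K) * ((w (γ.1 x) ^ 2)⁻¹ : Kˣ) else 0 := by
  rw [partition_of_restrict (S := addHandle S x) (T := S) w Sum.inl (fun _ => rfl)
    (fun γ hγ => hγ.of_addHandle) (fun γ γ' hγ hγ' hj => ?_) (fun _ => True) (fun _ _ => trivial)
    (fun γ hγ _ => ⟨Sum.elim γ fun _ => γ x, ?_, fun _ => rfl⟩) (fun γ => (w (γ x) ^ 2)⁻¹)
    (fun γ hγ => weight_addHandle w hγ)]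
  · simp
  · funext y
    rcases y with y | k
    · exact hj y
    · rw [hγ.inr_eq, hγ'.inr_eq, hj]
  · intro y
    have h1 := invariant_handleE S x (q8 := handleF8) (hγ.ef fun b => b) y
    refine ⟨?_, h1.1, h1.2⟩
    rcases y with y | k
    · exact (hγ y).1
    · rfl

theorem isColouring_addSphere_iff {a : O} {γ : S.X ⊕ Bool × Bool → Bool} :
    IsColouring (addSphere S a) γ ↔ IsColouring S (fun y => γ (.inl y)) ∧
      ∀ p, γ (.inr p) = γ (.inr (false, false)) := by
  constructor
  · refine fun hγ => ⟨fun y => hγ (.inl y), ?_⟩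
    have h1 : ∀ p : Bool × Bool, γ (.inr (p.1, !p.2)) = γ (.inr p) := fun p => (hγ (.inr p)).1
    have h2 : ∀ p : Bool × Bool, γ (.inr (!p.1, p.2)) = γ (.inr p) := fun p => (hγ (.inr p)).2.1
    rintro ⟨_ | _, _ | _⟩
    exacts [rfl, h1 (false, false), h2 (false, false), (h2 (false, true)).trans (h1 (false, false))]
  · rintro ⟨h1, h2⟩ (y | p)
    · exact h1 y
    · exact ⟨(h2 _).trans (h2 _).symm, (h2 _).trans (h2 _).symm, (h2 _).trans (h2 _).symm⟩

/-- A colouring of a surface and a sphere. -/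
def colouringAddSphere (S : Cob M N) (a : O) :
    {γ // IsColouring S γ} × Bool ≃ {γ // IsColouring (addSphere S a) γ} where
  toFun p := ⟨Sum.elim p.1.1 fun _ => p.2, isColouring_addSphere_iff.2 ⟨p.1.2, fun _ => rfl⟩⟩
  invFun γ := (⟨fun y => γ.1 (.inl y), (isColouring_addSphere_iff.1 γ.2).1⟩,
    γ.1 (.inr (false, false)))
  left_inv _ := rfl
  right_inv γ := Subtype.ext <| funext <| by
    rintro (y | p)
    · rfl
    · exact ((isColouring_addSphere_iff.1 γ.2).2 p).symm

theorem card_orb_sphere :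
    Nat.card (Orb (fun p : Bool × Bool => (!p.1, p.2)) fun p => (!p.1, p.2)) = 2 := by
  rw [card_orb (fun p => (false, p.2)) (by unfold Invariant; decide)]
  · rfl
  · rintro ⟨_ | _, c⟩
    · exact .refl _
    · exact .rel _ _ (.inl rfl)

/-- The sphere has two vertices, and its only edge and its only face cancel. -/
theorem weight_addSphere {a : O} {γ : S.X → Bool} (hγ : IsColouring S γ) (c : Bool) :
    weight w (addSphere S a) (Sum.elim γ fun _ => c) = weight w S γ * w c ^ 2 := by
  have := S.finite
  have hγ' : IsColouring (addSphere S a) (Sum.elim γ fun _ => c) :=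
    isColouring_addSphere_iff.2 ⟨hγ, fun _ => rfl⟩
  have h1 : orbProd (addSphere S a).e (addSphere S a).f
    (fun y => w (Sum.elim γ (fun _ => c) y)) = _ :=
    orbProd_sum S.e_e (by decide) S.f_f (by decide) (hγ'.ef w)
  have h2 : orbProd (addSphere S a).v (addSphere S a).f
    (fun y => w (Sum.elim γ (fun _ => c) y)) = _ :=
    orbProd_sum S.v_v (by decide) S.f_f (by decide) (hγ'.vf w)
  have h3 : orbProd (addSphere S a).v (addSphere S a).e
    (fun y => w (Sum.elim γ (fun _ => c) y)) = _ :=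
    orbProd_sum S.v_v (by decide) S.e_e (by decide) (hγ'.ve w)
  change orbProd (addSphere S a).e (addSphere S a).f (fun y => w (Sum.elim γ (fun _ => c) y)) *
    (orbProd (addSphere S a).v (addSphere S a).f (fun y => w (Sum.elim γ (fun _ => c) y)))⁻¹ *
    orbProd (addSphere S a).v (addSphere S a).e (fun y => w (Sum.elim γ (fun _ => c) y)) = _
  rw [h1, h2, h3]
  simp only [Sum.elim_inl, Sum.elim_inr]
  rw [orbProd_const _, card_orb_sphere, weight, mul_comm (orbProd S.v S.e _) (orbProd _ _ _),
    mul_comm (orbProd S.v S.f _) (orbProd _ _ _),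
    mul_comm _ (w c ^ 2), mul_comm _ (w c ^ 2)]
  group

theorem sum_colouring_addSphere {A : Type*} [AddCommMonoid A] (S : Cob M N) (a : O)
    (F : {γ // IsColouring (addSphere S a) γ} → A) :
    ∑ γ, F γ = ∑ γ : {γ // IsColouring S γ}, ∑ c, F (colouringAddSphere S a (γ, c)) := by
  rw [← Fintype.sum_prod_type', ← Fintype.sum_equiv (colouringAddSphere S a) _ _ fun _ => rfl]

/-- The colour of the sphere is free, and the sum over it gives the factor `w true ^ 2 + w false ^
2`. -/
theorem partition_addSphere (hw : (w true : K) ^ 2 + (w false : K) ^ 2 = 0) (S : Cob M N) (a : O) :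
    partition w (addSphere S a) = 0 := by
  classical
  funext h
  rw [partition, sum_colouring_addSphere]
  refine Finset.sum_eq_zero fun γ _ => ?_
  have : ∀ c, ((weight w (addSphere S a) (colouringAddSphere S a (γ, c)).1 : Kˣ) : K) =
    weight w S γ.1 * (w c : K) ^ 2 := fun c => by
      rw [← Units.val_pow_eq_pow_val, ← Units.val_mul, ← weight_addSphere w γ.2]
      rfl
  simp only [this]
  by_cases h' : (fun u => γ.1 (S.i u)) = h
  · refine (Finset.sum_congr rfl fun c _ => if_pos h').trans ?_
    rw [← Finset.mul_sum, Fintype.sum_bool, hw, mul_zero]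
  · exact Finset.sum_eq_zero fun c _ => if_neg h'

/-- The handle cancels the weight of the sphere, so each of the two colours contributes 1. -/
theorem partition_torus (S : Cob M N) (a : O) :
    partition w (addHandle (addSphere S a) (.inr (false, false))) = 2 • partition w S := by
  classical
  funext h
  refine (partition_addHandle w (addSphere S a) _ h).trans ?_
  rw [sum_colouring_addSphere, Pi.smul_apply, partition, Finset.smul_sum]
  refine Finset.sum_congr rfl fun γ _ => ?_
  have : ∀ c, ((weight w (addSphere S a) (colouringAddSphere S a (γ, c)).1 : Kˣ) : K) *
    ((w c ^ 2)⁻¹ : Kˣ) = weight w S γ.1 := fun c => by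
      rw [← Units.val_mul]
      refine congrArg Units.val ?_
      rw [mul_inv_eq_iff_eq_mul, ← weight_addSphere w γ.2]
      rfl
  by_cases h' : (fun u => γ.1 (S.i u)) = h
  · rw [if_pos h']
    exact (Finset.sum_congr rfl fun c _ => (if_pos h').trans (this c)).trans
      (by rw [Finset.sum_const, Finset.card_univ, Fintype.card_bool])
  · rw [if_neg h', smul_zero]
    exact Finset.sum_eq_zero fun c _ => if_neg h'

end Cob
-- Colourings of curves, and the partition function of a gluing
variable {O : Type} [InvolutiveNeg O] {B : Type} {M N P : Curve O B} {K : Type*} [CommRing K]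
  {G : Type*} [CommGroup G] (w : Bool → Kˣ)

/-- The colourings of the components of a curve with given values at the boundary points. -/
def Curve.Colouring (M : Curve O B) (β : B → Bool) : Type :=
  {q : M.X → Bool // Invariant M.v M.e q ∧ ∀ b, q (M.pt b) = β b}

instance (M : Curve O B) (β : B → Bool) : Finite (M.Colouring β) := by
  have := M.finite
  unfold Curve.Colouring
  infer_instance

noncomputable instance (M : Curve O B) (β : B → Bool) : Fintype (M.Colouring β) :=
  Fintype.ofFinite _

/-- The product over the components of a curve, to the power of the Euler characteristic. -/
noncomputable def Curve.weight (M : Curve O B) (q : M.X → Bool) : Kˣ :=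
  orbProd M.e M.e (fun x => w (q x)) * (orbProd M.v M.v fun x => w (q x))⁻¹

theorem around_self_iff {X : Type} {c : X → X} (hc : ∀ x, c (c x) = x) {x y : X} :
    Around c c x y ↔ y = x ∨ y = c x := by
  constructor
  · intro h
    exact (h.closed (P := fun y => y = x ∨ y = c x) hc hc
      (by rintro _ (rfl | rfl) <;> simp [hc]) (by rintro _ (rfl | rfl) <;> simp [hc])).1 (.inl rfl)
  · rintro (rfl | rfl)
    exacts [.refl _, .rel _ _ (.inl rfl)]

namespace Cob

variable {S : Cob M N} {T : Cob N P}

/-- By `bdry_vertex`, different vertices of `N` remain different in a surface. So the vertices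
shared by two surfaces glued along `N` can be counted on `N`. -/
theorem around_ef_tgt (n n' : N.X) :
    Around S.e S.f (S.i (.inr n)) (S.i (.inr n')) ↔ Around N.e N.e n n' := by
  rw [S.bdry_vertex, around_self_iff N.e_e, Meets.iff]
  simp only [Sum.inr.injEq]
  constructor
  · rintro (h | h)
    exacts [.inl h, .inr h.2.symm]
  · rintro (h | h)
    · exact .inl h
    · by_cases h' : N.e n = n
      · exact .inl (h.trans h')
      · exact .inr ⟨h', h.symm⟩

theorem around_ef_src (n n' : N.X) :
    Around T.e T.f (T.i (.inl n)) (T.i (.inl n')) ↔ Around N.e N.e n n' := by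
  rw [T.bdry_vertex, around_self_iff N.e_e, Meets.iff]
  simp only [Sum.inl.injEq]
  constructor
  · rintro (h | h)
    exacts [.inl h, .inr h.2.symm]
  · rintro (h | h)
    · exact .inl h
    · by_cases h' : N.e n = n
      · exact .inl (h.trans h')
      · exact .inr ⟨h', h.symm⟩

theorem around_vf_i (u u' : M.X ⊕ N.X) :
    Around S.v S.f (S.i u) (S.i u') ↔ u' = u ∨ u' = Sum.map M.v N.v u := by
  constructor
  · intro h
    have h2 := (h.closed (P := fun x => x = S.i u ∨ x = S.i (Sum.map M.v N.v u)) S.v_v S.f_f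
      (by
        rintro _ (rfl | rfl)
        · exact .inr (S.i_v u).symm
        · rw [S.i_v, S.v_v]; exact .inl rfl)
      (by rintro _ (rfl | rfl) <;> simp [S.f_i])).1 (.inl rfl)
    exact h2.imp (fun h => S.i_injective h) fun h => S.i_injective h
  · rintro (rfl | rfl)
    · exact .refl _
    · rw [S.i_v]
      exact .rel _ _ (.inl rfl)

theorem around_vf_tgt (n n' : N.X) :
    Around S.v S.f (S.i (.inr n)) (S.i (.inr n')) ↔ Around N.v N.v n n' := by
  rw [around_vf_i, around_self_iff N.v_v]
  simp

theorem around_vf_src (n n' : N.X) :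
    Around T.v T.f (T.i (.inl n)) (T.i (.inl n')) ↔ Around N.v N.v n n' := by
  rw [around_vf_i, around_self_iff N.v_v]
  simp

theorem IsColouring.glue_left {γ : S.X ⊕ T.X → Bool} (hγ : IsColouring (glue S T) γ) :
    IsColouring S fun x => γ (.inl x) := fun x => by
  refine ⟨(hγ (.inl x)).1, (hγ (.inl x)).2.1, ?_⟩
  by_cases h : ∃ n, S.i (.inr n) = x
  · obtain ⟨n, rfl⟩ := h
    rw [S.f_i]
  · have := (hγ (.inl x)).2.2
    rwa [show (glue S T).f (.inl x) = .inl (S.f x) from glueF_inl S T h] at this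

theorem IsColouring.glue_right {γ : S.X ⊕ T.X → Bool} (hγ : IsColouring (glue S T) γ) :
    IsColouring T fun x => γ (.inr x) := fun x => by
  refine ⟨(hγ (.inr x)).1, (hγ (.inr x)).2.1, ?_⟩
  by_cases h : ∃ n, T.i (.inl n) = x
  · obtain ⟨n, rfl⟩ := h
    rw [T.f_i]
  · have := (hγ (.inr x)).2.2
    rwa [show (glue S T).f (.inr x) = .inr (T.f x) from glueF_inr S T h] at this

theorem IsColouring.glue_i {γ : S.X ⊕ T.X → Bool} (hγ : IsColouring (glue S T) γ) (n : N.X) :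
    γ (.inr (T.i (.inl n))) = γ (.inl (S.i (.inr n))) := by
  have := (hγ (.inl (S.i (.inr n)))).2.2
  rwa [show (glue S T).f (.inl (S.i (.inr n))) = _ from glueF_inl_i S T n] at this

theorem isColouring_glue {γ : S.X → Bool} {γ' : T.X → Bool} (hγ : IsColouring S γ)
    (hγ' : IsColouring T γ') (h : ∀ n, γ (S.i (.inr n)) = γ' (T.i (.inl n))) :
    IsColouring (glue S T) (Sum.elim γ γ') := by
  have hf : ∀ z, Sum.elim γ γ' (glueF S T z) = Sum.elim γ γ' z := by
    intro z
    induction z using glue_cases S T with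
    | h1 n => rw [glueF_inl_i]; exact (h n).symm
    | h2 n => rw [glueF_inr_i]; exact h n
    | h3 x h' => rw [glueF_inl S T h']; exact (hγ x).2.2
    | h4 x h' => rw [glueF_inr S T h']; exact (hγ' x).2.2
  rintro (x | x)
  exacts [⟨(hγ x).1, (hγ x).2.1, hf (.inl x)⟩, ⟨(hγ' x).1, (hγ' x).2.1, hf (.inr x)⟩]

theorem mul_weight_eq {a b c a' b' a₁ b₁ c₁ a₂ b₂ c₂ : G} (ha : a * a' = a₁ * a₂)
    (hb : b * b' = b₁ * b₂) (hc : c = c₁ * c₂) :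
    a * b⁻¹ * c * (a' * b'⁻¹) = a₁ * b₁⁻¹ * c₁ * (a₂ * b₂⁻¹ * c₂) := by
  rw [show a * b⁻¹ * c * (a' * b'⁻¹) = (a * a') * (b * b')⁻¹ * c by simp only [mul_inv]; ac_rfl,
    ha, hb, hc]
  simp only [mul_inv]
  ac_rfl

/-- This is `χ(S ∪ T) + χ(N) = χ(S) + χ(T)`, applied to the parts of each colour. Faces are not
shared, while vertices and edges of `N` are counted twice on the right. -/
theorem weight_glue {γ : S.X ⊕ T.X → Bool} (hγ : IsColouring (glue S T) γ) :
    weight w (glue S T) γ * N.weight w (fun n => γ (.inl (S.i (.inr n)))) =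
      weight w S (fun x => γ (.inl x)) * weight w T fun x => γ (.inr x) := by
  have := S.finite
  have := T.finite
  have := N.finite
  have h1 := orbProd_glue S.e_e T.e_e (glueF_glueF S T) around_ef_tgt around_ef_src
    (glueF_inl_i S T) (glueF_inr_i S T) (fun x h => glueF_inl S T h) (fun x h => glueF_inr S T h)
    (fun _ => S.f_i _) (fun _ => T.f_i _) (hγ.ef w)
  have h2 := orbProd_glue S.v_v T.v_v (glueF_glueF S T) around_vf_tgt around_vf_src
    (glueF_inl_i S T) (glueF_inr_i S T) (fun x h => glueF_inl S T h) (fun x h => glueF_inr S T h)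
    (fun _ => S.f_i _) (fun _ => T.f_i _) (hγ.vf w)
  have h3 := orbProd_sum S.v_v T.v_v S.e_e T.e_e (hγ.ve w)
  exact mul_weight_eq h1 h2 h3

/-- A colouring of the glued surface is a pair of colourings that agree on `N`; the sum is arranged
by their common restriction to `N`. -/
theorem partition_glue {β : B → Bool} {p : M.X → Bool} (hp : ∀ b, p (M.pt b) = β b)
    (r : P.X → Bool) : partition w (glue S T) (Sum.elim p r) = ∑ q : N.Colouring β,
      partition w S (Sum.elim p q.1) * partition w T (Sum.elim q.1 r) *
        ((N.weight w q.1)⁻¹ : Kˣ) := by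
  classical
  have key : ∀ q : N.Colouring β, partition w S (Sum.elim p q.1) * partition w T (Sum.elim q.1 r) *
      ((N.weight w q.1)⁻¹ : Kˣ) = ∑ t : {γ // IsColouring S γ} × {γ // IsColouring T γ},
        if (fun u => t.1.1 (S.i u)) = Sum.elim p q.1 ∧ (fun u => t.2.1 (T.i u)) = Sum.elim q.1 r then
          (weight w S t.1.1 : K) * weight w T t.2.1 * ((N.weight w q.1)⁻¹ : Kˣ) else 0 := by
    intro q
    rw [partition, partition, Finset.sum_mul_sum, Fintype.sum_prod_type, Finset.sum_mul]
    refine Finset.sum_congr rfl fun γ _ => ?_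
    rw [Finset.sum_mul]
    refine Finset.sum_congr rfl fun γ' _ => ?_
    rw [ite_zero_mul_ite_zero, ite_zero_mul]
  simp only [key]
  rw [← Fintype.sum_prod_type', partition, ← Finset.sum_filter, ← Finset.sum_filter]
  have hbd : ∀ γ : {γ // IsColouring (glue S T) γ},
      ((fun u => γ.1 ((glue S T).i u)) = Sum.elim p r) ↔
      (∀ m, γ.1 (.inl (S.i (.inl m))) = p m) ∧ ∀ m, γ.1 (.inr (T.i (.inr m))) = r m := by
    intro γ
    rw [funext_iff, Sum.forall]
    rfl
  have hq : ∀ γ : {γ // IsColouring (glue S T) γ}, (∀ m, γ.1 (.inl (S.i (.inl m))) = p m) →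
      Invariant N.v N.e (fun n => γ.1 (.inl (S.i (.inr n)))) ∧
        ∀ b, γ.1 (.inl (S.i (.inr (N.pt b)))) = β b := by
    intro γ h
    have hS := γ.2.glue_left
    refine ⟨fun n => ⟨?_, ?_⟩, fun b => ?_⟩
    · have := (hS (S.i (.inr n))).1
      rw [← S.i_v] at this
      exact this
    · exact (hS.ef fun b => b).eq ((around_ef_tgt _ _).2 (.symm _ _ (.rel _ _ (.inl rfl))))
    · rw [← hp, ← h]
      exact (hS.ef fun b => b).eq ((S.bdry_vertex _ _).2 (.inr (.ts b)))
  refine Finset.sum_bij (fun γ hγ => (⟨_, hq γ ((hbd γ).1 (Finset.mem_filter.1 hγ).2).1⟩,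
    ⟨_, γ.2.glue_left⟩, ⟨_, γ.2.glue_right⟩)) ?_ ?_ ?_ ?_
  · intro γ hγ
    have h := (hbd γ).1 (Finset.mem_filter.1 hγ).2
    rw [Finset.mem_filter]
    refine ⟨Finset.mem_univ _, funext fun u => ?_, funext fun u => ?_⟩
    · rcases u with m | n
      exacts [h.1 m, rfl]
    · rcases u with m | n
      exacts [γ.2.glue_i m, h.2 n]
  · intro γ _ γ' _ h
    have h := congrArg Prod.snd h
    refine Subtype.ext (funext fun x => ?_)
    rcases x with x | x
    · exact congrFun (congrArg (fun t => t.1.1) h) x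
    · exact congrFun (congrArg (fun t => t.2.1) h) x
  · rintro ⟨q, γ, γ'⟩ h
    have h := (Finset.mem_filter.1 h).2
    have h1 := fun u => congrFun h.1 u
    have h2 := fun u => congrFun h.2 u
    refine ⟨⟨Sum.elim γ.1 γ'.1, isColouring_glue γ.2 γ'.2 fun n =>
      (h1 (.inr n)).trans (h2 (.inl n)).symm⟩, ?_, ?_⟩
    · rw [Finset.mem_filter]
      exact ⟨Finset.mem_univ _, (hbd _).2 ⟨fun m => h1 (.inl m), fun m => h2 (.inr m)⟩⟩
    · refine Prod.ext (Subtype.ext (funext fun n => h1 (.inr n))) rfl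
  · intro γ _
    rw [← Units.val_mul, ← Units.val_mul, ← weight_glue w γ.2, mul_inv_cancel_right]

end Cob
-- The partition function of a product
variable {O : Type} [InvolutiveNeg O] {B : Type} {M : Curve O B} {K : Type*} [CommRing K]
  {G : Type*} [CommGroup G] (w : Bool → Kˣ)

namespace Cob

theorem around_id_not {p} (hp : ∀ x t, p (.inr (x, t)) = .inr (x, !t)) (x : M.X) (t : Bool) :
    Around p (idE M) (.inl (x, t)) (.inl (x, !t)) := by
  by_cases h : M.e x = x
  · refine .rel _ _ (.inr ?_)
    simp [idE, h]
  · have h1 : ∀ t, Around p (idE M) (.inl (x, t)) (.inr (⟨x, h⟩, t)) := fun t =>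
      .symm _ _ (.rel _ _ (.inr rfl))
    exact .trans _ _ _ (h1 t) (.trans _ _ _ (.rel _ _ (.inl (hp _ _).symm)) (.symm _ _ (h1 _)))

theorem around_id_false {p} (hp : ∀ x t, p (.inr (x, t)) = .inr (x, !t)) (x : M.X) (t : Bool) :
    Around p (idE M) (.inl (x, false)) (.inl (x, t)) := by
  cases t
  exacts [.refl _, around_id_not hp x false]

/-- The function on the flags of the product that is given by a function on the curve. -/
def cylinder {Z : Type*} (q : M.X → Z) : (M.X × Bool) ⊕ ({x // M.e x ≠ x} × Bool) → Z :=
  Sum.elim (fun p => q p.1) fun p => q p.1.1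

theorem cylinder_idE {Z : Type*} (q : M.X → Z) (x) : cylinder q (idE M x) = cylinder q x := by
  rcases x with ⟨x, t⟩ | ⟨x, t⟩
  · by_cases h : M.e x = x <;> simp [idE, h, cylinder]
  · rfl

theorem isColouring_cylinder {q : M.X → Bool} (hq : Invariant M.v M.e q) :
    IsColouring (id M) (cylinder q) := by
  intro x
  refine ⟨?_, cylinder_idE q x, ?_⟩
  · rcases x with ⟨x, t⟩ | ⟨x, t⟩
    exacts [(hq x).1, rfl]
  · rcases x with ⟨x, t⟩ | ⟨x, t⟩
    exacts [rfl, (hq x.1).2]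

theorem IsColouring.eq_cylinder {γ : (M.X × Bool) ⊕ ({x // M.e x ≠ x} × Bool) → Bool}
    (hγ : IsColouring (id M) γ) : γ = cylinder fun x => γ (.inl (x, false)) := by
  have h : ∀ x t, γ (.inl (x, t)) = γ (.inl (x, false)) := fun x t =>
    ((hγ.ve fun b => b).eq (around_id_false (fun _ _ => rfl) x t)).symm
  funext x
  rcases x with ⟨x, t⟩ | ⟨x, t⟩
  · exact h x t
  · exact (hγ (.inr (x, t))).2.1.symm.trans (h x.1 t)

variable {q : M.X → Bool} (hq : Invariant M.v M.e q)

theorem orbProd_id_ve {r : M.X → G} (hr : ∀ x, r (M.v x) = r x) :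
    orbProd (id M).v (id M).e (cylinder r) = orbProd M.v M.v r := by
  symm
  refine orbProd_eq_of_map (a := (id M).v) (b := (id M).e) (fun x => .inl (x, false)) (fun x => ?_)
    (cylinder (Orb.mk M.v M.v)) (fun x => ⟨?_, cylinder_idE _ x⟩) (fun _ => rfl) ?_
    (fun x => ⟨?_, cylinder_idE r x⟩)
  · have h : Orb.mk (id M).v (id M).e (.inl (M.v x, false)) =
      Orb.mk (id M).v (id M).e (.inl (x, false)) := Orb.mk_left (a := (id M).v) (.inl (x, false))
    exact ⟨h, h⟩
  · rcases x with ⟨x, t⟩ | ⟨x, t⟩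
    exacts [Orb.mk_left x, rfl]
  · rintro (⟨x, t⟩ | ⟨x, t⟩)
    · exact ⟨x, around_id_false (fun _ _ => rfl) x t⟩
    · exact ⟨x.1, .trans _ _ _ (around_id_false (fun _ _ => rfl) x.1 t)
        (.symm _ _ (.rel _ _ (.inr rfl)))⟩
  · rcases x with ⟨x, t⟩ | ⟨x, t⟩
    exacts [hr x, rfl]

/-- The vertex of `M` at a flag that is not on the boundary. -/
def innerE (M : Curve O B) (x : {x // M.e x ≠ x}) : {x // M.e x ≠ x} :=
  ⟨M.e x.1, fun h => x.2 (by rw [M.e_e] at h; exact h.symm)⟩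

theorem innerE_innerE (x : {x // M.e x ≠ x}) : innerE M (innerE M x) = x := Subtype.ext (M.e_e _)

/-- The edges of the product are two copies of the edges of `M` and one edge for each inner vertex
of `M`. -/
theorem orbProd_id_vf {r : M.X → G} (hv : ∀ x, r (M.v x) = r x) (he : ∀ x, r (M.e x) = r x) :
    orbProd (id M).v (id M).f (cylinder r) = orbProd M.v M.v r * orbProd M.v M.v r *
      orbProd (innerE M) (innerE M) fun x => r x.1 := by
  have := M.finite
  have h0 : (id M).f = Sum.map (fun p => p) fun p => (innerE M p.1, p.2) := by
    funext x
    rcases x with ⟨x, t⟩ | ⟨x, t⟩ <;> rfl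
  rw [h0]
  refine (orbProd_sum (by simp [M.v_v]) (by simp) (by simp) (by simp [innerE_innerE]) ?_).trans ?_
  · rintro (⟨x, t⟩ | ⟨x, t⟩)
    exacts [⟨hv x, rfl⟩, ⟨rfl, he x.1⟩]
  congr 1
  · have h1 := orbProd_eq_of_equiv (a' := Sum.map M.v M.v) (b' := Sum.map M.v M.v)
      (a := fun p : Bool × M.X => (p.1, M.v p.2)) (b := fun p : Bool × M.X => (p.1, M.v p.2))
      (Equiv.boolProdEquivSum M.X).symm (by rintro (x | x) <;> rfl) (by rintro (x | x) <;> rfl)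
      (g := fun p => r p.2) (fun p => ⟨hv _, hv _⟩)
    have h2 := orbProd_sum M.v_v M.v_v M.v_v M.v_v
      (g := fun y => r ((Equiv.boolProdEquivSum M.X).symm y).2) (by
        rintro (x | x)
        exacts [⟨hv x, hv x⟩, ⟨hv x, hv x⟩])
    rw [← show _ = orbProd M.v M.v r * orbProd M.v M.v r from h2, h1]
    refine orbProd_eq_of_map (a' := fun p : M.X × Bool => (M.v p.1, p.2)) (b' := fun p => p)
      (a := fun p : Bool × M.X => (p.1, M.v p.2)) (b := fun p : Bool × M.X => (p.1, M.v p.2))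
      (fun p => (p.2, p.1)) (fun p => ⟨?_, rfl⟩) (fun p => Orb.mk _ _ (p.2, p.1)) (fun p => ⟨?_, ?_⟩) (fun _ => rfl) (fun p => ⟨(p.2, p.1), .refl _⟩)
      (g := fun p : Bool × M.X => r p.2) (fun p => ⟨hv _, hv _⟩)
    · exact Orb.mk_left (a := fun p : Bool × M.X => (p.1, M.v p.2)) (p.2, p.1)
    · exact Orb.mk_left (a := fun p : M.X × Bool => (M.v p.1, p.2)) (p.2, p.1)
    · exact Orb.mk_left (a := fun p : M.X × Bool => (M.v p.1, p.2)) (p.2, p.1)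
  · symm
    refine orbProd_eq_of_map (a := fun p : {x // M.e x ≠ x} × Bool => (p.1, !p.2))
      (b := fun p : {x // M.e x ≠ x} × Bool => (innerE M p.1, p.2)) (fun x => (x, false)) (fun x => ?_)
      (fun p => Orb.mk (innerE M) (innerE M) p.1) (fun p => ⟨rfl, Orb.mk_left _⟩) (fun _ => rfl)
      ?_ (g := fun p : {x // M.e x ≠ x} × Bool => r p.1.1) (fun p => ⟨rfl, he _⟩)
    · have h := Orb.mk_right (a := fun p : {x // M.e x ≠ x} × Bool => (p.1, !p.2))
        (b := fun p : {x // M.e x ≠ x} × Bool => (innerE M p.1, p.2)) (x, false)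
      exact ⟨h, h⟩
    · rintro ⟨x, _ | _⟩
      exacts [⟨x, .refl _⟩, ⟨x, .rel _ _ (.inl rfl)⟩]

/-- The product has two vertices for each inner vertex of `M`, but only one for each boundary point,
since `{b} × [0, 1]` is shrunk. -/
theorem orbProd_id_ef {r : M.X → G} (he : ∀ x, r (M.e x) = r x) :
    orbProd (id M).e (id M).f (cylinder r) = orbProd M.e M.e r *
      orbProd (innerE M) (innerE M) fun x => r x.1 := by
  classical
  have := M.finite
  have h1 : ∀ p : (M.X ⊕ {x // M.e x ≠ x}), Sum.elim r (fun x => r x.1) p = cylinder r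
      (Sum.elim (fun x => .inl (x, false)) (fun x => .inl (x.1, true)) p) := by
    rintro (x | x) <;> rfl
  have h2 := orbProd_sum M.e_e innerE_innerE M.e_e innerE_innerE
    (g := Sum.elim r (fun x : {x // M.e x ≠ x} => r x.1)) (by
      rintro (x | x)
      exacts [⟨he x, he x⟩, ⟨he x.1, he x.1⟩])
  refine Eq.trans ?_ h2
  symm
  rw [funext h1]
  have hE : ∀ (x : M.X) (h : M.e x ≠ x) t, Around (id M).e (id M).f (.inl (x, t)) (.inl (M.e x, t)) :=
    fun x h t => .trans _ _ _ (.symm _ _ (.rel (.inr (⟨x, h⟩, t)) _ (.inl rfl)))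
      (.trans _ _ _ (.rel _ _ (.inr rfl)) (.rel _ _ (.inl rfl)))
  have hE0 : ∀ x : M.X, Around (id M).e (id M).f (.inl (M.e x, false)) (.inl (x, false)) := fun x => by
    by_cases h : M.e x = x
    · rw [h]; exact .refl _
    · exact .symm _ _ (hE x h _)
  have hEn : ∀ x : M.X, M.e x = x → ∀ t, Around (id M).e (id M).f (.inl (x, !t)) (.inl (x, t)) :=
    fun x h t => .symm _ _ (.rel _ _ (.inl (by simp [id, idE, h])))
  -- At the end `true`, only inner vertices count as new ones; a boundary point is the same vertex
  -- at both ends.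
  set ρ : M.X × Bool → Orb (Sum.map M.e (innerE M)) (Sum.map M.e (innerE M)) := fun p =>
    if h : p.2 = true ∧ M.e p.1 ≠ p.1 then Orb.mk _ _ (.inr ⟨p.1, h.2⟩) else Orb.mk _ _ (.inl p.1)
  have hρ0 : ∀ x, ρ (x, false) = Orb.mk _ _ (.inl x) := fun x => dif_neg fun h => by simp at h
  have hρ1 : ∀ x : {x // M.e x ≠ x}, ρ (x.1, true) = Orb.mk _ _ (.inr x) := fun x =>
    dif_pos ⟨rfl, x.2⟩
  have hρ2 : ∀ x, M.e x = x → ρ (x, true) = Orb.mk _ _ (.inl x) := fun x h =>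
    dif_neg fun h' => h'.2 h
  clear_value ρ
  have hρe : ∀ x : {x // M.e x ≠ x}, ∀ t, ρ ((innerE M x).1, t) = ρ (x.1, t) := by
    intro x t
    rcases t with _ | _
    · rw [hρ0, hρ0]
      exact Orb.mk_left (a := Sum.map M.e (innerE M)) (.inl x.1)
    · rw [hρ1 x, hρ1 (innerE M x)]
      exact Orb.mk_left (a := Sum.map M.e (innerE M)) (.inr x)
  refine orbProd_eq_of_map (a := (id M).e) (b := (id M).f)
    (Sum.elim (fun x => .inl (x, false)) (fun x => .inl (x.1, true)))
    ?_ (Sum.elim ρ fun p => ρ (p.1.1, p.2)) ?_ ?_ ?_ (fun x => ⟨cylinder_idE r x, ?_⟩)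
  · rintro (x | x)
    · have h := Orb.mk_eq_iff.2 (hE0 x)
      exact ⟨h, h⟩
    · have h := (Orb.mk_eq_iff.2 (hE x.1 x.2 true)).symm
      exact ⟨h, h⟩
  · rintro (⟨x, t⟩ | ⟨x, t⟩)
    · refine ⟨?_, rfl⟩
      change Sum.elim ρ _ (idE M (.inl (x, t))) = ρ (x, t)
      by_cases h : M.e x = x
      · cases t <;> simp [idE, h, hρ0, hρ2]
      · simp [idE, h]
    · exact ⟨rfl, hρe x t⟩
  · rintro (x | x)
    exacts [hρ0 x, hρ1 x]
  · rintro (⟨x, t⟩ | ⟨x, t⟩)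
    · rcases t with _ | _
      · exact ⟨.inl x, .refl _⟩
      · by_cases h : M.e x = x
        · exact ⟨.inl x, hEn x h true⟩
        · exact ⟨.inr ⟨x, h⟩, .refl _⟩
    · rcases t with _ | _
      · exact ⟨.inl x.1, .symm _ _ (.rel _ _ (.inl rfl))⟩
      · exact ⟨.inr x, .symm _ _ (.rel _ _ (.inl rfl))⟩
  · rcases x with ⟨x, t⟩ | ⟨x, t⟩
    exacts [rfl, he x.1]

/-- The inner vertices contribute one more vertex and one more edge each, and one of the two copies
of the edges cancels against the faces. What remains is the Euler characteristic of `M`. -/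
theorem weight_cylinder {q : M.X → Bool} (hq : Invariant M.v M.e q) :
    weight w (id M) (cylinder q) = M.weight w q := by
  have h0 : (fun x => w (cylinder q x)) = cylinder fun x => w (q x) := by
    funext x
    rcases x with x | x <;> rfl
  have hv : ∀ x, w (q (M.v x)) = w (q x) := fun x => congrArg w (hq x).1
  have he : ∀ x, w (q (M.e x)) = w (q x) := fun x => congrArg w (hq x).2
  have h1 : orbProd (id M).e (id M).f (fun x => w (cylinder q x)) = _ :=
    (congrArg (orbProd (id M).e (id M).f) h0).trans (orbProd_id_ef he)
  have h2 : orbProd (id M).v (id M).f (fun x => w (cylinder q x)) = _ :=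
    (congrArg (orbProd (id M).v (id M).f) h0).trans (orbProd_id_vf hv he)
  have h3 : orbProd (id M).v (id M).e (fun x => w (cylinder q x)) = _ :=
    (congrArg (orbProd (id M).v (id M).e) h0).trans (orbProd_id_ve hv)
  change orbProd (id M).e (id M).f (fun x => w (cylinder q x)) *
    (orbProd (id M).v (id M).f fun x => w (cylinder q x))⁻¹ *
    orbProd (id M).v (id M).e (fun x => w (cylinder q x)) = _
  rw [h1, h2, h3, Curve.weight]
  group

open Classical in
-- A colouring of the product is constant along the interval, so it exists only if the two ends have
-- equal colours, and then it is unique.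
theorem partition_id {p q : M.X → Bool} (hp : Invariant M.v M.e p) :
    partition w (id M) (Sum.elim p q) = if p = q then (M.weight w p : K) else 0 := by
  have key : ∀ γ : {γ // IsColouring (id M) γ},
      ((fun u => γ.1 ((id M).i u)) = Sum.elim p q) ↔ γ.1 = cylinder p ∧ p = q := by
    intro γ
    rw [funext_iff, Sum.forall]
    constructor
    · rintro ⟨h1, h2⟩
      have h3 : γ.1 = cylinder p := by
        rw [γ.2.eq_cylinder]
        exact congrArg _ (funext h1)
      refine ⟨h3, funext fun x => ?_⟩
      rw [h3] at h2
      exact h2 x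
    · rintro ⟨h1, rfl⟩
      rw [h1]
      exact ⟨fun _ => rfl, fun _ => rfl⟩
  rw [partition]
  simp only [key]
  split_ifs with h
  · rw [Finset.sum_eq_single ⟨_, isColouring_cylinder hp⟩]
    · rw [if_pos ⟨rfl, h⟩, weight_cylinder w hp]
    · exact fun γ _ hγ => if_neg fun h => hγ (Subtype.ext h.1)
    · exact fun h => absurd (Finset.mem_univ _) h
  · exact Finset.sum_eq_zero fun γ _ => if_neg fun h' => h h'.2

end Cob
-- The linear extension of a functor
universe u₁ v₁ u₂ v₂ u

section FreeLift

variable {C : Type u₁} [Category.{v₁} C] {D : Type u₂} [Category.{v₂} D] [Preadditive D]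
  (k : Type u) [CommRing k] [Linear k D] (F : C ⥤ D)

/-- The linear extension of a functor, on morphisms. -/
noncomputable def freeMap (X Y : C) : (Free.of k X ⟶ Free.of k Y) →ₗ[k] (F.obj X ⟶ F.obj Y) :=
  Finsupp.linearCombination k fun f => F.map f

/-- A multiple of a morphism. -/
noncomputable def freeSingle {X Y : C} (f : X ⟶ Y) (r : k) : Free.of k X ⟶ Free.of k Y :=
  Finsupp.single f r

theorem freeSingle_comp {X Y Z : C} (f : X ⟶ Y) (g : Y ⟶ Z) (r s : k) :
    freeSingle k f r ≫ freeSingle k g s = freeSingle k (f ≫ g) (r * s) :=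
  Free.single_comp_single k C f g r s

theorem freeMap_single {X Y : C} (f : X ⟶ Y) (r : k) :
    freeMap k F X Y (freeSingle k f r) = r • F.map f := Finsupp.linearCombination_single _ _ _

theorem free_induction {X Y : C} {p : (Free.of k X ⟶ Free.of k Y) → Prop} (f) (h0 : p 0)
    (h1 : ∀ f g, p f → p g → p (f + g)) (h2 : ∀ (f : X ⟶ Y) r, p (freeSingle k f r)) : p f :=
  Finsupp.induction_linear (motive := p) f h0 h1 h2

theorem freeMap_comp {X Y Z : C} (f : Free.of k X ⟶ Free.of k Y) (g : Free.of k Y ⟶ Free.of k Z) :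
    freeMap k F X Z (f ≫ g) = freeMap k F X Y f ≫ freeMap k F Y Z g := by
  induction f using free_induction k with
  | h0 => rw [Limits.zero_comp, map_zero, map_zero, Limits.zero_comp]
  | h1 f f' h h' => rw [Preadditive.add_comp, map_add, map_add, h, h', Preadditive.add_comp]
  | h2 f r =>
    induction g using free_induction k with
    | h0 => rw [Limits.comp_zero, map_zero, map_zero, Limits.comp_zero]
    | h1 g g' h h' => rw [Preadditive.comp_add, map_add, map_add, h, h', Preadditive.comp_add]
    | h2 g s =>
      rw [freeSingle_comp, freeMap_single, freeMap_single, freeMap_single, F.map_comp,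
        Linear.smul_comp, Linear.comp_smul, smul_smul]

theorem freeMap_id (X : C) : freeMap k F X X (𝟙 (Free.of k X)) = 𝟙 (F.obj X) :=
  (freeMap_single k F (𝟙 X) 1).trans (by rw [one_smul, F.map_id])

/-- The linear extension of a functor. -/
noncomputable def freeLift : Free k C ⥤ D where
  obj X := F.obj X
  map {X Y} f := freeMap k F X Y f
  map_id := freeMap_id k F
  map_comp := freeMap_comp k F

theorem freeLift_map {X Y : C} (f : X ⟶ Y) :
    (freeLift k F).map ((Free.embedding k C).map f) = F.map f :=
  (freeMap_single k F f 1).trans (one_smul _ _)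

instance : (freeLift k F).Additive where
  map_add {X Y f g} := map_add (freeMap k F X Y) f g

instance : (freeLift k F).Linear k where
  map_smul {X Y} f r := map_smul (freeMap k F X Y) r f

end FreeLift
-- The functor of state spaces
section StateSpace

variable {O : Type} [InvolutiveNeg O] {B : Type} {M N P : Curve O B} {K : Type u} [CommRing K]
  (w : Bool → Kˣ)

/-- Put `h(c) = w(c)⁻²`. The hypothesis on `w` says that `h true + h false = 0`. For equal colours
at `y` and `z`, the mean of the two handle factors is `h`; for different colours it is 0, in
accordance with `partition_neck`, where such colourings do not occur. -/
theorem Cob.partition_neck_eq {k : Type*} [CommRing k] [Invertible (2 : k)] [Algebra k K]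
    (hw : (w true : K) ^ 2 + (w false : K) ^ 2 = 0) {S T : Cob M N} {x : S.X} {j : T.X → S.X}
    (h : DeletesEdge S T x j) (hx : ∃ n : ℕ, (fun w => S.v (S.e w))^[n] (S.v x) = S.f x)
    {y z} (hy : j y = S.e x) (hz : j z = S.e (S.v x)) :
    partition w S = ⅟(2 : k) • (partition w (addHandle T y) + partition w (addHandle T z)) := by
  classical
  funext h'
  rw [partition_neck w h hx hy hz, Pi.smul_apply, Pi.add_apply, partition_addHandle,
    partition_addHandle, ← Finset.sum_add_distrib, Finset.smul_sum]
  refine Finset.sum_congr rfl fun γ _ => ?_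
  have h0 : ∀ a : K, ⅟(2 : k) • (a + a) = a := fun a => by
    rw [← two_smul k a, smul_smul, invOf_mul_self, one_smul]
  have h1 : (((w true) ^ 2)⁻¹ : Kˣ) + (((w false) ^ 2)⁻¹ : Kˣ) = (0 : K) := by
    have h2 : (((w true) ^ 2)⁻¹ : Kˣ) + (((w false) ^ 2)⁻¹ : Kˣ) =
        ((w true : K) ^ 2 + (w false : K) ^ 2) *
          ((((w true) ^ 2)⁻¹ : Kˣ) * (((w false) ^ 2)⁻¹ : Kˣ)) := by
      rw [add_mul, ← Units.val_pow_eq_pow_val, ← Units.val_pow_eq_pow_val, ← mul_assoc,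
        Units.mul_inv, one_mul, mul_left_comm, Units.mul_inv, mul_one, add_comm]
    rw [h2, hw, zero_mul]
  by_cases hb : (fun u => γ.1 (T.i u)) = h'
  · simp only [if_pos hb]
    split_ifs with hyz
    · rw [hyz, h0]
    · rw [← mul_add]
      have h3 : (((w (γ.1 y)) ^ 2)⁻¹ : Kˣ) + (((w (γ.1 z)) ^ 2)⁻¹ : Kˣ) = (0 : K) := by
        cases h4 : γ.1 y <;> cases h5 : γ.1 z
        · exact absurd (h4.trans h5.symm) hyz
        · rw [add_comm, h1]
        · exact h1
        · exact absurd (h4.trans h5.symm) hyz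
      rw [h3, mul_zero, smul_zero]
  · simp only [if_neg hb, ite_self, add_zero, smul_zero]

variable (β : B → Bool)

/-- The matrix given by the values of a function on the colourings. -/
noncomputable def stateMatrix (Z : (M.X ⊕ N.X → Bool) → K) :
    Matrix (M.Colouring β) (N.Colouring β) K :=
  fun p q => Z (Sum.elim p.1 q.1) * ((N.weight w q.1)⁻¹ : Kˣ)

open Classical in
theorem stateMatrix_id : stateMatrix w β (Cob.partition w (Cob.id M)) = 1 := by
  ext p q
  rw [stateMatrix, Cob.partition_id w p.2.1, Matrix.one_apply]
  by_cases h : p = q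
  · rw [if_pos h, if_pos (congrArg Subtype.val h), h, Units.mul_inv]
  · rw [if_neg h, if_neg fun h' => h (Subtype.ext h'), zero_mul]

/-- Dividing each column by the weight of the target curve compensates for counting the middle curve
twice, so gluing becomes multiplication of matrices. -/
theorem stateMatrix_glue (S : Cob M N) (T : Cob N P) :
    stateMatrix w β (Cob.partition w (Cob.glue S T)) =
      stateMatrix w β (Cob.partition w S) * stateMatrix w β (Cob.partition w T) := by
  ext p r
  rw [stateMatrix, Cob.partition_glue w p.2.2, Matrix.mul_apply, Finset.sum_mul]
  refine Finset.sum_congr rfl fun q _ => ?_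
  rw [stateMatrix, stateMatrix]
  ring

open Classical in
-- The component that contains `b` has the fixed colour `β b`, so the handle factor is the same for
-- all colourings.
theorem stateMatrix_handleAt (b : B) :
    stateMatrix w β (Cob.partition w (Cob.handleAt M b)) = (((w (β b)) ^ 2)⁻¹ : Kˣ).1 • 1 := by
  rw [← stateMatrix_id w β]
  ext p q
  rw [stateMatrix, Matrix.smul_apply, stateMatrix, smul_eq_mul, ← mul_assoc]
  refine congrArg (· * _) ?_
  refine (Cob.partition_addHandle w (Cob.id M) (.inl (M.pt b, false)) _).trans ?_
  rw [Cob.partition, Finset.mul_sum]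
  refine Finset.sum_congr rfl fun γ _ => ?_
  by_cases h : (fun u => γ.1 ((Cob.id M).i u)) = Sum.elim p.1 q.1
  · rw [if_pos h, if_pos h, mul_comm]
    have : γ.1 (.inl (M.pt b, false)) = β b := (congrFun h (.inl (M.pt b))).trans (p.2.2 b)
    rw [this]
  · rw [if_neg h, if_neg h, mul_zero]

variable (k : Type u) [CommRing k] [Algebra k K]

/-- The linear map given by the values of a function on the colourings. -/
noncomputable def stateMap (Z : (M.X ⊕ N.X → Bool) → K) :
    (M.Colouring β → K) →ₗ[k] (N.Colouring β → K) :=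
  (Matrix.vecMulLinear (stateMatrix w β Z)).restrictScalars k

theorem stateMap_apply (Z : (M.X ⊕ N.X → Bool) → K) (a : M.Colouring β → K) :
    stateMap w β k Z a = Matrix.vecMul a (stateMatrix w β Z) := rfl

theorem stateMap_add (Z Z' : (M.X ⊕ N.X → Bool) → K) :
    stateMap w β k (Z + Z') = stateMap w β k Z + stateMap w β k Z' := by
  have : stateMatrix w β (Z + Z') = stateMatrix w β Z + stateMatrix w β Z' := by
    ext p q
    simp [stateMatrix, add_mul]
  refine LinearMap.ext fun a => ?_
  rw [LinearMap.add_apply, stateMap_apply, stateMap_apply, stateMap_apply, this, Matrix.vecMul_add]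

theorem stateMap_smul (r : k) (Z : (M.X ⊕ N.X → Bool) → K) :
    stateMap w β k (r • Z) = r • stateMap w β k Z := by
  have : stateMatrix w β (r • Z) = r • stateMatrix w β Z := by
    ext p q
    simp [stateMatrix]
  refine LinearMap.ext fun a => ?_
  rw [LinearMap.smul_apply, stateMap_apply, stateMap_apply, this, Matrix.vecMul_smul]

theorem stateMap_zero : stateMap w β k (0 : (M.X ⊕ N.X → Bool) → K) = 0 := by
  have := stateMap_smul w β k 0 (0 : (M.X ⊕ N.X → Bool) → K)
  rwa [zero_smul, zero_smul] at this

theorem stateMap_id : stateMap w β k (Cob.partition w (Cob.id M)) = LinearMap.id := by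
  classical
  refine LinearMap.ext fun a => ?_
  rw [stateMap_apply, stateMatrix_id, Matrix.vecMul_one, LinearMap.id_apply]

theorem stateMap_glue (S : Cob M N) (T : Cob N P) :
    stateMap w β k (Cob.partition w (Cob.glue S T)) =
      stateMap w β k (Cob.partition w T) ∘ₗ stateMap w β k (Cob.partition w S) := by
  refine LinearMap.ext fun a => ?_
  rw [LinearMap.comp_apply, stateMap_apply, stateMap_apply, stateMap_apply, stateMatrix_glue,
    Matrix.vecMul_vecMul]

/-- The action on state spaces, before passing to linear combinations. -/
noncomputable def statePrefunctor : Obj O B ⥤q ModuleCat.{u} k where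
  obj P := ModuleCat.of k (P.curve.Colouring β → K)
  map S := ModuleCat.ofHom (stateMap w β k (Cob.partition w S))

/-- The functor on formal linear combinations of cobordisms. -/
noncomputable def stateLift : Pre k O B ⥤ ModuleCat.{u} k :=
  freeLift k (Paths.lift (statePrefunctor w β k))

instance : (stateLift (O := O) w β k).Additive := inferInstanceAs (freeLift k _).Additive
instance : (stateLift (O := O) w β k).Linear k := inferInstanceAs ((freeLift k _).Linear k)

theorem stateLift_gen {P Q : Obj O B} (S : P ⟶ Q) : (stateLift w β k).map (gen k S) =
    ModuleCat.ofHom (stateMap w β k (Cob.partition w S)) := by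
  exact (freeLift_map k _ _).trans (Paths.lift_toPath _ S)

/-- The partition function ignores orientations and seams, which is consistent with the fringe
relations because here `ω = 1`. -/
theorem stateLift_basic [Invertible (2 : k)] (hw : (w true : K) ^ 2 + (w false : K) ^ 2 = 0)
    {P Q : Pre k O B} {a b : P ⟶ Q} (h : Basic k 1 a b) :
    (stateLift w β k).map a = (stateLift w β k).map b := by
  have hflip : ∀ {P Q : Obj O B} (S T : P ⟶ Q) (x φ), Cob.FlipsFace S T x φ →
      (stateLift w β k).map (gen k S) = (stateLift w β k).map (gen k T) := by
    intro P Q S T x φ h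
    rw [stateLift_gen, stateLift_gen, Cob.partition_of_equiv w φ h.v h.e h.f h.i]
  cases h with
  | id P =>
    rw [CategoryTheory.Functor.map_id]
    refine (stateLift_gen w β k (P := P) (Q := P) (Cob.id P.curve)).trans ?_
    rw [stateMap_id]
    rfl
  | @glue P Q R S T =>
    rw [Functor.map_comp, stateLift_gen, stateLift_gen]
    refine Eq.trans ?_ (stateLift_gen w β k (P := P) (Q := R) (Cob.glue S T)).symm
    rw [stateMap_glue]
    rfl
  | iso S T φ h =>
    rw [stateLift_gen, stateLift_gen, Cob.partition_of_equiv w φ h.v h.e h.f h.i]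
  | edge S T x j h hx hx' =>
    rw [stateLift_gen, stateLift_gen, Cob.partition_edge w h hx hx']
  | vertex S T x j h =>
    rw [stateLift_gen, stateLift_gen, Cob.partition_vertex w h]
  | @sphere P Q S a =>
    rw [Functor.map_zero]
    refine (stateLift_gen w β k (P := P) (Q := Q) (Cob.addSphere S a)).trans ?_
    rw [Cob.partition_addSphere w hw, stateMap_zero]
    rfl
  | @torus P Q S a =>
    rw [Functor.map_smul, stateLift_gen w β k S]
    refine (stateLift_gen w β k (P := P) (Q := Q)
      (Cob.addHandle (Cob.addSphere S a) (.inr (false, false)))).trans ?_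
    rw [Cob.partition_torus w, ← Nat.cast_smul_eq_nsmul k, stateMap_smul]
    rfl
  | @neck P Q S T x j h hx y z hy hz =>
    rw [Functor.map_smul, Functor.map_add, stateLift_gen]
    refine Eq.trans ?_ (congrArg (⅟(2 : k) • ·) (congrArg₂ (· + ·)
      (stateLift_gen w β k (P := P) (Q := Q) (Cob.addHandle T y)).symm
      (stateLift_gen w β k (P := P) (Q := Q) (Cob.addHandle T z)).symm))
    rw [Cob.partition_neck_eq w (k := k) hw h hx hy hz, stateMap_smul, stateMap_add]
    rfl
  | inward S T x φ h => rw [Units.val_one, one_smul, hflip S T x φ h]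
  | outward S T x φ h => rw [inv_one, Units.val_one, one_smul, hflip S T x φ h]
  | saddle S T x φ h => rw [inv_one, Units.val_one, one_smul, hflip S T x φ h]

theorem stateLift_rel [Invertible (2 : k)] (hw : (w true : K) ^ 2 + (w false : K) ^ 2 = 0)
    {P Q : Pre k O B} {a b : P ⟶ Q} (h : Rel k 1 a b) :
    (stateLift w β k).map a = (stateLift w β k).map b := by
  induction h with
  | basic h => exact stateLift_basic w β k hw h
  | refl => rfl
  | symm _ ih => exact ih.symm
  | trans _ _ ih ih' => exact ih.trans ih'
  | add _ _ ih ih' => rw [Functor.map_add, Functor.map_add, ih, ih']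
  | smul r _ ih => rw [Functor.map_smul, Functor.map_smul, ih]
  | comp_left c _ ih => rw [Functor.map_comp, Functor.map_comp, ih]
  | comp_right c _ ih => rw [Functor.map_comp, Functor.map_comp, ih]

/-- The functor to modules that sends a curve to the functions on its colourings. -/
noncomputable def stateFunctor [Invertible (2 : k)]
    (hw : (w true : K) ^ 2 + (w false : K) ^ 2 = 0) : CobCat k 1 O B ⥤ ModuleCat.{u} k :=
  CategoryTheory.Quotient.lift _ (stateLift w β k) fun _ _ _ _ h => stateLift_rel w β k hw h

theorem stateFunctor_hom [Invertible (2 : k)] (hw : (w true : K) ^ 2 + (w false : K) ^ 2 = 0)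
    {P Q : Obj O B} (S : Cob P.curve Q.curve) :
    (stateFunctor w β k hw).map (CobCat.hom k 1 (P := P) (Q := Q) S) =
      ModuleCat.ofHom (stateMap w β k (Cob.partition w S)) :=
  (CategoryTheory.Quotient.lift_map_functor_map _ _ _ _).trans (stateLift_gen w β k (P := P) (Q := Q) S)

instance [Invertible (2 : k)] (hw : (w true : K) ^ 2 + (w false : K) ^ 2 = 0) :
    (stateFunctor (O := O) w β k hw).Additive where
  map_add {P Q a b} := by
    obtain ⟨a, rfl⟩ := (CategoryTheory.Quotient.functor _).map_surjective a
    obtain ⟨b, rfl⟩ := (CategoryTheory.Quotient.functor _).map_surjective b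
    rw [← Functor.map_add]
    exact (stateLift w β k).map_add

end StateSpace

/-! ### Handles of different colours do not differ by a morphism through `N` -/

section Obstruction

variable {O : Type} [InvolutiveNeg O] {B : Type} {M N : Curve O B} (k : Type u) [CommRing k]

/-- The unit `i` for `true`, and `1` for `false`. -/
def unitI : Bool → (QuadraticAlgebra k (-1) 0)ˣ
  | true => ⟨⟨0, 1⟩, ⟨0, -1⟩, by ext <;> simp [QuadraticAlgebra.re_one, QuadraticAlgebra.im_one],
    by ext <;> simp [QuadraticAlgebra.re_one, QuadraticAlgebra.im_one]⟩
  | false => 1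

theorem unitI_true_sq : ((unitI k true : (QuadraticAlgebra k (-1) 0)ˣ) : QuadraticAlgebra k (-1) 0) ^ 2 =
    -1 := by
  rw [sq]
  ext <;> simp [unitI, QuadraticAlgebra.re_one, QuadraticAlgebra.im_one]

/-- If a boundary colouring extends to `M` and does not extend to `N`, then the difference of
handles at boundary points of different colours does not factor through `N`. -/
theorem handleAt_sub_handleAt_ne [Nontrivial k] [Invertible (2 : k)] {β : B → Bool}
    [IsEmpty (N.Colouring β)] (p : M.Colouring β) {b₁ b₂ : B} (h₁ : β b₁ = true) (h₂ : β b₂ = false)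
    {m n : ℤ} (f : CobCat.obj k 1 ⟨M, m⟩ ⟶ CobCat.obj k 1 ⟨N, n⟩)
    (g : CobCat.obj k 1 ⟨N, n⟩ ⟶ CobCat.obj k 1 ⟨M, m⟩) :
    f ≫ g ≠ CobCat.hom k 1 (P := ⟨M, m⟩) (Q := ⟨M, m⟩) (Cob.handleAt M b₁) -
      CobCat.hom k 1 (P := ⟨M, m⟩) (Q := ⟨M, m⟩) (Cob.handleAt M b₂) := by
  classical
  intro h
  have hw : ((unitI k true : (QuadraticAlgebra k (-1) 0)ˣ) : QuadraticAlgebra k (-1) 0) ^ 2 +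
      ((unitI k false : (QuadraticAlgebra k (-1) 0)ˣ) : QuadraticAlgebra k (-1) 0) ^ 2 = 0 := by
    rw [unitI_true_sq, unitI]
    simp
  have h3 := congrArg (stateFunctor (unitI k) β k hw).map h
  rw [Functor.map_comp, Functor.map_sub, stateFunctor_hom, stateFunctor_hom] at h3
  -- There are no colourings of `N` over `β`, so its state space is zero.
  have h4 : (stateFunctor (unitI k) β k hw).map f = 0 := by
    have : Subsingleton (N.Colouring β → QuadraticAlgebra k (-1) 0) := inferInstance
    ext1
    exact LinearMap.ext fun a => this.elim _ _
  rw [h4, Limits.zero_comp] at h3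
  have h4 := sub_eq_zero.1 h3.symm
  have h5 : stateMap (unitI k) β k (Cob.partition (unitI k) (Cob.handleAt M b₁)) =
      stateMap (unitI k) β k (Cob.partition (unitI k) (Cob.handleAt M b₂)) :=
    congrArg ModuleCat.Hom.hom h4
  have h6 := congrFun (LinearMap.congr_fun h5 (Pi.single p 1)) p
  rw [stateMap_apply, stateMap_apply, stateMatrix_handleAt, stateMatrix_handleAt,
    Matrix.vecMul_smul, Matrix.vecMul_smul, Matrix.vecMul_one, Pi.smul_apply, Pi.smul_apply,
    Pi.single_eq_same, smul_eq_mul, smul_eq_mul, mul_one, mul_one, h₁, h₂] at h6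
  -- On the basis vector of `p`, the two handles act by the inverses of `i² = -1` and of `1`. If
  -- they were equal, then `2 = 0` in `k`, but 2 is a unit and `k` is not trivial.
  have h7 := congrArg Units.val (inv_injective (Units.ext h6))
  rw [Units.val_pow_eq_pow_val, Units.val_pow_eq_pow_val, unitI_true_sq, unitI, Units.val_one,
    one_pow] at h7
  have h8 : (-1 : k) = 1 := congrArg QuadraticAlgebra.re h7
  have h9 : (2 : k) = 0 := by
    rw [← one_add_one_eq_two]
    nth_rewrite 1 [← h8]
    exact neg_add_cancel 1
  exact (isUnit_of_invertible (2 : k)).ne_zero h9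

end Obstruction
end Disor

/-! ### Complexes with two terms -/

namespace HomologicalComplex

open Limits

universe v u

variable {C : Type u} [Category.{v} C] [Preadditive C] [HasZeroObject C] {X₀ X₁ : C} {f : X₀ ⟶ X₁}
  {ι : Type} {c : ComplexShape ι} {i₀ i₁ : ι} {h₀₁ : c.Rel i₀ i₁}

/-- An endomorphism of a complex with two terms. -/
noncomputable def doubleEnd (h₀₁ : c.Rel i₀ i₁) (h : i₀ ≠ i₁) (φ₀ : X₀ ⟶ X₀) (φ₁ : X₁ ⟶ X₁)
    (comm : φ₀ ≫ f = f ≫ φ₁) : double f h₀₁ ⟶ double f h₀₁ :=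
  mkHomFromDouble h₀₁ h (φ₀ ≫ (doubleXIso₀ f h₀₁).inv) (φ₁ ≫ (doubleXIso₁ f h₀₁ h).inv)
    (by rw [double_d f h₀₁ h, Category.assoc, Iso.inv_hom_id_assoc, reassoc_of% comm])
    fun k _ => by rw [double_d_eq_zero₀ f h₀₁ i₁ k h.symm, comp_zero]

section

variable (h : i₀ ≠ i₁) {φ₀ : X₀ ⟶ X₀} {φ₁ : X₁ ⟶ X₁} (comm : φ₀ ≫ f = f ≫ φ₁)

theorem doubleEnd_f₀ : (doubleEnd h₀₁ h φ₀ φ₁ comm).f i₀ =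
    (doubleXIso₀ f h₀₁).hom ≫ φ₀ ≫ (doubleXIso₀ f h₀₁).inv := mkHomFromDouble_f₀ _ _ _ _ _ _

theorem doubleEnd_f₁ : (doubleEnd h₀₁ h φ₀ φ₁ comm).f i₁ =
    (doubleXIso₁ f h₀₁ h).hom ≫ φ₁ ≫ (doubleXIso₁ f h₀₁ h).inv := mkHomFromDouble_f₁ _ _ _ _ _ _

end

open Classical in
/-- The components of a homotopy between endomorphisms of a complex with two terms. -/
noncomputable def doubleHomotopyHom (h₀₁ : c.Rel i₀ i₁) (h : i₀ ≠ i₁) (s : X₁ ⟶ X₀) (i j : ι) :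
    (double f h₀₁).X i ⟶ (double f h₀₁).X j :=
  if hij : i = i₁ ∧ j = i₀ then
    eqToHom (by rw [hij.1]) ≫ ((doubleXIso₁ f h₀₁ h).hom ≫ s ≫ (doubleXIso₀ f h₀₁).inv) ≫
      eqToHom (by rw [hij.2])
  else 0

/-- An equality of objects is needed, not only an isomorphism: homogeneity of matrix entries is
transported along equalities. -/
theorem double_X_zero (f : X₀ ⟶ X₁) (h₀₁ : c.Rel i₀ i₁) : (double f h₀₁).X i₀ = X₀ := if_pos rfl

theorem double_X_one (f : X₀ ⟶ X₁) (h₀₁ : c.Rel i₀ i₁) (h : i₀ ≠ i₁) :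
    (double f h₀₁).X i₁ = X₁ := (if_neg h.symm).trans (if_pos rfl)

theorem doubleHomotopyHom_self (h : i₀ ≠ i₁) (s : X₁ ⟶ X₀) :
    doubleHomotopyHom (f := f) h₀₁ h s i₁ i₀ =
      (doubleXIso₁ f h₀₁ h).hom ≫ s ≫ (doubleXIso₀ f h₀₁).inv := by
  simp [doubleHomotopyHom]

theorem doubleHomotopyHom_of_ne (h : i₀ ≠ i₁) (s : X₁ ⟶ X₀) {i j : ι} (hij : ¬(i = i₁ ∧ j = i₀)) :
    doubleHomotopyHom (f := f) h₀₁ h s i j = 0 := dif_neg hij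

/-- A homotopy between endomorphisms of a complex with two terms. -/
noncomputable def doubleHomotopy (h : i₀ ≠ i₁) (s : X₁ ⟶ X₀) {F G : double f h₀₁ ⟶ double f h₀₁}
    (h₀ : F.f i₀ = (doubleXIso₀ f h₀₁).hom ≫ (f ≫ s) ≫ (doubleXIso₀ f h₀₁).inv + G.f i₀)
    (h₁ : F.f i₁ = (doubleXIso₁ f h₀₁ h).hom ≫ (s ≫ f) ≫ (doubleXIso₁ f h₀₁ h).inv + G.f i₁) :
    Homotopy F G where
  hom := doubleHomotopyHom h₀₁ h s
  zero i j hij := doubleHomotopyHom_of_ne h s (by rintro ⟨rfl, rfl⟩; exact hij h₀₁)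
  comm i := by
    by_cases hi₀ : i = i₀
    · subst hi₀
      have e : prevD i (doubleHomotopyHom (f := f) h₀₁ h s) = 0 := by
        change doubleHomotopyHom (f := f) h₀₁ h s i _ ≫ _ = 0
        rw [doubleHomotopyHom_of_ne h s fun hh => h hh.1, zero_comp]
      rw [e, dNext_eq _ h₀₁, double_d f h₀₁ h, doubleHomotopyHom_self, h₀, add_zero]
      simp
    by_cases hi₁ : i = i₁
    · subst hi₁
      have e : dNext i (doubleHomotopyHom (f := f) h₀₁ h s) = 0 := by
        change _ ≫ doubleHomotopyHom (f := f) h₀₁ h s _ i = 0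
        rw [doubleHomotopyHom_of_ne h s fun hh => h hh.2.symm, comp_zero]
      rw [e, prevD_eq _ h₀₁, double_d f h₀₁ h, doubleHomotopyHom_self, h₁, zero_add]
      simp
    · exact (isZero_double_X f h₀₁ i hi₀ hi₁).eq_of_src _ _

/-- Homotopic endomorphisms of a complex with two terms differ in the first term by a morphism that
factors through the differential. -/
theorem exists_of_homotopy {F G : double f h₀₁ ⟶ double f h₀₁} (h : i₀ ≠ i₁)
    (H : Homotopy F G) :
    ∃ s : X₁ ⟶ X₀, F.f i₀ = (doubleXIso₀ f h₀₁).hom ≫ (f ≫ s) ≫ (doubleXIso₀ f h₀₁).inv + G.f i₀ := by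
  refine ⟨(doubleXIso₁ f h₀₁ h).inv ≫ H.hom i₁ i₀ ≫ (doubleXIso₀ f h₀₁).hom, ?_⟩
  have e : prevD i₀ H.hom = 0 := by
    change _ ≫ (double f h₀₁).d _ i₀ = 0
    rw [double_d_eq_zero₁ f h₀₁ _ _ h, comp_zero]
  rw [H.comm, e, dNext_eq _ h₀₁, double_d f h₀₁ h]
  simp

end HomologicalComplex

namespace Disor

/-! ### Chain maps and homogeneous homotopies given by cobordisms -/

section TwoTerm

universe u

variable {O : Type} [InvolutiveNeg O] {B : Type} {k : Type u} [CommRing k] [Invertible (2 : k)]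
  {ω : kˣ} {M N : Curve O B} {d : Cob M N}

theorem IsHomogeneous.zero (m : ℤ) (P Q : Mat_ (CobCat k ω O B)) :
    IsHomogeneous m (0 : P ⟶ Q) := fun _ _ => Submodule.zero_mem _

theorem IsHomogeneous.eqToHom_comp {m : ℤ} {P P' Q Q' : Mat_ (CobCat k ω O B)} {a : P ⟶ Q}
    (ha : IsHomogeneous m a) (hP : P' = P) (hQ : Q = Q') :
    IsHomogeneous m (eqToHom hP ≫ a ≫ eqToHom hQ) := by
  subst hP hQ
  simpa using ha

/-- The endomorphism with the given components. -/
def IsInducedBy (x : CobCat.obj k ω ⟨M, 1⟩ ⟶ CobCat.obj k ω ⟨M, 1⟩)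
    (y : CobCat.obj k ω ⟨N, 2⟩ ⟶ CobCat.obj k ω ⟨N, 2⟩) (F : twoTerm k ω d ⟶ twoTerm k ω d) :
    Prop :=
  F.f 0 = (HomologicalComplex.doubleXIso₀ _ _).hom ≫
    (Mat_.embedding (CobCat k ω O B)).map x ≫ (HomologicalComplex.doubleXIso₀ _ _).inv ∧
  F.f 1 = (HomologicalComplex.doubleXIso₁ _ _ zero_ne_one).hom ≫
    (Mat_.embedding (CobCat k ω O B)).map y ≫ (HomologicalComplex.doubleXIso₁ _ _ zero_ne_one).inv

variable {x x' : CobCat.obj k ω ⟨M, 1⟩ ⟶ CobCat.obj k ω ⟨M, 1⟩}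
    {y y' : CobCat.obj k ω ⟨N, 2⟩ ⟶ CobCat.obj k ω ⟨N, 2⟩} {F G : twoTerm k ω d ⟶ twoTerm k ω d}

theorem exists_isInducedBy (h : x ≫ CobCat.hom k ω (P := ⟨M, 1⟩) (Q := ⟨N, 2⟩) d =
      CobCat.hom k ω (P := ⟨M, 1⟩) (Q := ⟨N, 2⟩) d ≫ y) :
    ∃ F : twoTerm k ω d ⟶ twoTerm k ω d, IsInducedBy x y F :=
  ⟨HomologicalComplex.doubleEnd _ zero_ne_one ((Mat_.embedding (CobCat k ω O B)).map x)
    ((Mat_.embedding (CobCat k ω O B)).map y) (by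
      rw [← Functor.map_comp, h, Functor.map_comp]),
    HomologicalComplex.doubleEnd_f₀ _ _, HomologicalComplex.doubleEnd_f₁ _ _⟩

theorem IsInducedBy.neg (h : IsInducedBy x y F) : IsInducedBy (-x) (-y) (-F) := by
  constructor
  · rw [Functor.map_neg, Preadditive.neg_comp, Preadditive.comp_neg, ← h.1]
    rfl
  · rw [Functor.map_neg, Preadditive.neg_comp, Preadditive.comp_neg, ← h.2]
    rfl

theorem isHomogeneous_doubleHomotopyHom {P Q : CobCat k ω O B}
    {f : (Mat_.embedding (CobCat k ω O B)).obj P ⟶ (Mat_.embedding (CobCat k ω O B)).obj Q}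
    {h₀₁ : (ComplexShape.up ℤ).Rel 0 1} {h : (0 : ℤ) ≠ 1} {m : ℤ} {r : Q ⟶ P}
    (hr : r ∈ CobCat.homogeneous k ω m Q P) (i j : ℤ) :
    IsHomogeneous m (HomologicalComplex.doubleHomotopyHom (f := f) h₀₁ h
      ((Mat_.embedding (CobCat k ω O B)).map r) i j) := by
  by_cases hij : i = 1 ∧ j = 0
  · obtain ⟨rfl, rfl⟩ := hij
    rw [HomologicalComplex.doubleHomotopyHom_self]
    -- By definition, the isomorphisms between the terms of the complex and the given objects are
    -- induced by equalities.
    exact IsHomogeneous.eqToHom_comp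
      (a := (Mat_.embedding (CobCat k ω O B)).map r) (fun _ _ => hr)
      (HomologicalComplex.double_X_one f h₀₁ h) (HomologicalComplex.double_X_zero f h₀₁).symm
  · rw [HomologicalComplex.doubleHomotopyHom_of_ne _ _ hij]
    exact IsHomogeneous.zero _ _ _

theorem IsInducedBy.exists_homotopy (hF : IsInducedBy x y F) (hG : IsInducedBy x' y' G) {m : ℤ}
    {r : CobCat.obj k ω ⟨N, 2⟩ ⟶ CobCat.obj k ω ⟨M, 1⟩}
    (hr : r ∈ CobCat.homogeneous k ω m (CobCat.obj k ω ⟨N, 2⟩) (CobCat.obj k ω ⟨M, 1⟩))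
    (hx : x = CobCat.hom k ω (P := ⟨M, 1⟩) (Q := ⟨N, 2⟩) d ≫ r + x')
    (hy : y = r ≫ CobCat.hom k ω (P := ⟨M, 1⟩) (Q := ⟨N, 2⟩) d + y') :
    ∃ h : Homotopy F G, ∀ i j, IsHomogeneous m (h.hom i j) := by
  refine ⟨HomologicalComplex.doubleHomotopy zero_ne_one
    ((Mat_.embedding (CobCat k ω O B)).map r) ?_ ?_, fun i j => ?_⟩
  · rw [hF.1, hG.1, hx, Functor.map_add, Functor.map_comp, Preadditive.add_comp,
      Preadditive.comp_add]
  · rw [hF.2, hG.2, hy, Functor.map_add, Functor.map_comp, Preadditive.add_comp,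
      Preadditive.comp_add]
  · exact isHomogeneous_doubleHomotopyHom hr i j

theorem IsInducedBy.exists_eq_comp (hF : IsInducedBy x y F) (hG : IsInducedBy x' y' G)
    (H : Homotopy F G) : ∃ r : CobCat.obj k ω ⟨N, 2⟩ ⟶ CobCat.obj k ω ⟨M, 1⟩,
      CobCat.hom k ω (P := ⟨M, 1⟩) (Q := ⟨N, 2⟩) d ≫ r = x - x' := by
  obtain ⟨s, hs⟩ := HomologicalComplex.exists_of_homotopy zero_ne_one H
  -- The embedding into matrices is full and faithful, so the factorization descends to the
  -- cobordism category.
  obtain ⟨r, rfl⟩ := (Mat_.embedding (CobCat k ω O B)).map_surjective s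
  refine ⟨r, (Mat_.embedding (CobCat k ω O B)).map_injective ?_⟩
  have h₀₁ : (ComplexShape.up ℤ).Rel 0 1 := by simp
  rw [hF.1, hG.1] at hs
  rw [Functor.map_comp, Functor.map_sub, eq_sub_iff_add_eq,
    ← cancel_mono (HomologicalComplex.doubleXIso₀ _ h₀₁).inv,
    ← cancel_epi (HomologicalComplex.doubleXIso₀ _ h₀₁).hom,
    Preadditive.add_comp, Preadditive.comp_add]
  exact hs.symm

end TwoTerm

/-! ### The degree of the reversed saddle -/

section EulerCharacteristic

variable {O : Type} [InvolutiveNeg O] {B : Type} {M N : Curve O B}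
  {O' : Type} [InvolutiveNeg O'] {B' : Type} {M' N' : Curve O' B'}

theorem card_orb_congr {X Y : Type} {a b : X → X} {a' b' : Y → Y} (φ : X ≃ Y)
    (ha : ∀ x, φ (a x) = a' (φ x)) (hb : ∀ x, φ (b x) = b' (φ x)) :
    Nat.card (Orb a b) = Nat.card (Orb a' b') := by
  refine Nat.card_congr (Quot.congr φ fun x y => ?_)
  rw [← ha, ← hb, φ.apply_eq_iff_eq, φ.apply_eq_iff_eq]

theorem Cob.eulerChar_congr {S : Cob M N} {T : Cob M' N'} (φ : S.X ≃ T.X)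
    (hv : ∀ x, φ (S.v x) = T.v (φ x)) (he : ∀ x, φ (S.e x) = T.e (φ x))
    (hf : ∀ x, φ (S.f x) = T.f (φ x)) : S.eulerChar = T.eulerChar := by
  have h1 := card_orb_congr φ he hf
  have h2 := card_orb_congr φ hv hf
  have h3 := card_orb_congr φ hv he
  unfold Orb at h1 h2 h3
  rw [Cob.eulerChar, Cob.eulerChar, h1, h2, h3]

/-- Words of length at most four reach the chosen representatives of the vertices, edges and faces
of the saddle. -/
theorem around_of_alternating {X : Type} {a b : X → X} {x y : X}
    (h : y = x ∨ y = a x ∨ y = b x ∨ y = b (a x) ∨ y = a (b x) ∨ y = a (b (a x)) ∨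
      y = b (a (b x)) ∨ y = b (a (b (a x)))) : Around a b x y := by
  have ha : ∀ {z}, Around a b x z → Around a b x (a z) := fun h => h.trans _ _ _ (.rel _ _ (.inl rfl))
  have hb : ∀ {z}, Around a b x z → Around a b x (b z) := fun h => h.trans _ _ _ (.rel _ _ (.inr rfl))
  have h0 : Around a b x x := .refl x
  rcases h with h | h | h | h | h | h | h | h <;> rw [h]
  exacts [h0, ha h0, hb h0, hb (ha h0), ha (hb h0), ha (hb (ha h0)), hb (ha (hb h0)),
    hb (ha (hb (ha h0)))]

/-- Exchange of vertices in the saddle. -/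
def saddleV (x : Corner × Fin 4) : Corner × Fin 4 :=
  (if x.2 = 0 ∨ x.2 = 3 then (!x.1.1, x.1.2) else x.1, ![0, 2, 1, 3] x.2)

/-- There are six vertices (four corners and two marks), seven edges (two in the source, four in the
target and the seam), and two faces. -/
theorem eulerChar_saddle : Disor.saddle.eulerChar = 1 := by
  have h1 : Nat.card (Orb Disor.saddle.e Disor.saddle.f) = 6 := by
    refine (card_orb (a := saddleE) (b := saddleF) (X := Corner × Fin 4)
      (fun x => if x.2 ≤ 1 then (x.1, 0) else ((x.1.1, false), 2))
      (by unfold Invariant; decide +kernel) fun x =>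
        around_of_alternating (X := Corner × Fin 4) (by revert x; decide +kernel)).trans ?_
    decide +kernel
  have h2 : Nat.card (Orb Disor.saddle.v Disor.saddle.f) = 7 := by
    refine (card_orb (a := saddleV) (b := saddleF) (X := Corner × Fin 4)
      (fun x => if x.2 = 0 then ((false, x.1.2), 0) else if x.2 = 3 then ((false, false), 3)
        else (x.1, 1))
      (by unfold Invariant; decide +kernel) fun x =>
        around_of_alternating (X := Corner × Fin 4) (by revert x; decide +kernel)).trans ?_
    decide +kernel
  have h3 : Nat.card (Orb Disor.saddle.v Disor.saddle.e) = 2 := by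
    refine (card_orb (a := saddleV) (b := saddleE) (X := Corner × Fin 4) (fun x => ((false, x.1.2), 0))
      (by unfold Invariant; decide +kernel) fun x =>
        around_of_alternating (X := Corner × Fin 4) (by revert x; decide +kernel)).trans ?_
    decide +kernel
  unfold Orb at h1 h2 h3
  rw [Cob.eulerChar, h1, h2, h3]
  norm_num

variable [DecidableEq O] [OrientationCode O] [DecidableEq O'] [OrientationCode O']
  [M.Listed] [N.Listed] [M'.Listed] [N'.Listed]

/-- The Euler characteristic depends only on the exchanges of vertices, edges and faces. The codes
of the reversed saddles share these with the saddle. -/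
theorem Net.Numbers.eulerChar_eq {S : Net M N} {C : Cob M N} {g : C.X → ℕ} (hg : S.Numbers C g)
    {T : Net M' N'} (h : T.Valid) (hs : T.size = S.size) (hv : T.v = S.v) (he : T.e = S.e)
    (hf : T.f = S.f) : h.toCob.eulerChar = C.eulerChar := by
  have hV : T.V = S.V := by unfold Net.V; rw [hv]
  have hE : T.E = S.E := by unfold Net.E; rw [he]
  have hF : T.F = S.F := by unfold Net.F; rw [hf]
  have hL : T.Live = S.Live := by unfold Net.Live; rw [hV, hs]
  let φ : C.X → T.Flag := fun y => ⟨g y, hL ▸ hg.live y⟩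
  have hφ : Function.Bijective φ := by
    refine ⟨fun y z hyz => hg.injective (congrArg Subtype.val hyz), fun x => ?_⟩
    obtain ⟨y, hy⟩ := hg.surjective x (hL ▸ x.2)
    exact ⟨y, Subtype.ext hy⟩
  refine (Cob.eulerChar_congr (S := C) (T := h.toCob) (Equiv.ofBijective φ hφ) ?_ ?_ ?_).symm
  · exact fun y => Subtype.ext ((hg.v y).trans (congrFun hV _).symm)
  · exact fun y => Subtype.ext ((hg.e y).trans (congrFun hE _).symm)
  · exact fun y => Subtype.ext ((hg.f y).trans (congrFun hF _).symm)

universe u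

variable {k : Type u} [CommRing k] [Invertible (2 : k)] {ω : kˣ}

theorem Net.hom_mem_homogeneous {M N : Curve O Corner} [M.Listed] [N.Listed] {T : Net M N} (h : T.Valid)
    (hχ : h.toCob.eulerChar = 1) :
    T.hom k ω 2 1 ∈ CobCat.homogeneous k ω (-2) (CobCat.obj k ω ⟨M, 2⟩) (CobCat.obj k ω ⟨N, 1⟩) := by
  rw [h.hom_eq]
  refine Submodule.subset_span ⟨h.toCob, ?_, rfl⟩
  -- With `χ = 1` and four boundary points, the degree is `1 - 2 + 1 - 2`.
  change h.toCob.eulerChar - (Nat.card Corner : ℤ) / 2 + 1 - 2 = -2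
  rw [hχ, Nat.card_eq_fintype_card]
  decide

theorem hom_coSaddle_mem_homogeneous : Net.coSaddle.hom k ω 2 1 ∈ CobCat.homogeneous k ω (-2)
    (CobCat.obj k ω ⟨disorientedSmoothing, 2⟩) (CobCat.obj k ω ⟨orientedSmoothing, 1⟩) :=
  Net.hom_mem_homogeneous (Net.valid_iff.1 Net.valid_coSaddle) <|
    (Net.numbers_saddle.eulerChar_eq (Net.valid_iff.1 Net.valid_coSaddle) rfl rfl rfl rfl).trans eulerChar_saddle

theorem hom_coSaddle_forget_mem_homogeneous :
    Net.coSaddle.forget.hom k ω 2 1 ∈ CobCat.homogeneous k ω (-2)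
      (CobCat.obj k ω ⟨disorientedSmoothing.forget, 2⟩)
      (CobCat.obj k ω ⟨orientedSmoothing.forget, 1⟩) :=
  Net.hom_mem_homogeneous (Net.valid_iff.1 Net.valid_coSaddle_forget) <|
    (Net.numbers_saddle.eulerChar_eq (Net.valid_iff.1 Net.valid_coSaddle_forget) rfl rfl rfl rfl).trans eulerChar_saddle

end EulerCharacteristic

/-! ### The homotopies at the crossing, and the obstruction -/

section Crossing

universe u

variable {k : Type u} [CommRing k] [Invertible (2 : k)] {ω : kˣ} {a b : ℤ}

theorem hom_saddle : CobCat.hom k ω (P := ⟨orientedSmoothing, a⟩) (Q := ⟨disorientedSmoothing, b⟩)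
    saddle = Net.saddle.hom k ω a b :=
  Net.numbers_saddle.hom_eq (Net.valid_iff.1 Net.valid_saddle)

theorem hom_saddle_forget : CobCat.hom k ω (P := ⟨orientedSmoothing.forget, a⟩)
    (Q := ⟨disorientedSmoothing.forget, b⟩) saddle.forget = Net.saddle.forget.hom k ω a b :=
  Net.numbers_saddle.forget.hom_eq (Net.valid_iff.1 Net.valid_saddle_forget)

theorem exists_isHandleMap (c : Corner) :
    ∃ F : twoTerm k ω saddle ⟶ twoTerm k ω saddle, IsHandleMap c F :=
  exists_isInducedBy <| by
    rw [hom_saddle, Net.hom_handleAt_orientedSmoothing, Net.hom_handleAt_disorientedSmoothing,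
      Net.hom_handle_comp_saddle]

theorem exists_isHandleMap_forget (c : Corner) :
    ∃ F : twoTerm k ω saddle.forget ⟶ twoTerm k ω saddle.forget, IsHandleMap c F :=
  exists_isInducedBy <| by
    rw [hom_saddle_forget, Net.hom_handleAt_orientedSmoothing_forget,
      Net.hom_handleAt_disorientedSmoothing_forget, Net.hom_handle_comp_saddle_forget]

/-- The homotopy is `2 ω⁻¹` times the reversed saddle; the coefficient cancels the `½ ω` in both
composites with the saddle. -/
theorem exists_homotopy_of_isHandleMap (hω : (ω : k) ^ 2 = -1)
    {F G : twoTerm k ω saddle ⟶ twoTerm k ω saddle} (hF : IsHandleMap topRight F)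
    (hG : IsHandleMap bottomLeft G) :
    ∃ h : Homotopy F G, ∀ i j, IsHomogeneous (-2) (h.hom i j) := by
  have e : 2 * ((ω⁻¹ : kˣ) : k) * (⅟(2 : k) * ω) = 1 := by
    rw [mul_mul_mul_comm, mul_invOf_self, Units.inv_mul, one_mul]
  refine IsInducedBy.exists_homotopy hF hG
    (Submodule.smul_mem _ (2 * ((ω⁻¹ : kˣ) : k)) hom_coSaddle_mem_homogeneous) ?_ ?_
  · rw [hom_saddle, Linear.comp_smul, Net.hom_saddle_comp_coSaddle hω, smul_smul, e, one_smul,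
      Net.hom_handleAt_orientedSmoothing, Net.hom_handleAt_orientedSmoothing, sub_add_cancel]
  · rw [hom_saddle, Linear.smul_comp, Net.hom_coSaddle_comp_saddle hω, smul_smul, e, one_smul,
      Net.hom_handleAt_disorientedSmoothing, Net.hom_handleAt_disorientedSmoothing, sub_add_cancel]

/-- The homotopy is twice the reversed saddle, as both composites are `½ (F + G)`. -/
theorem exists_homotopy_neg_of_isHandleMap
    {F G : twoTerm k ω saddle.forget ⟶ twoTerm k ω saddle.forget} (hF : IsHandleMap topRight F)
    (hG : IsHandleMap bottomLeft G) :
    ∃ h : Homotopy F (-G), ∀ i j, IsHomogeneous (-2) (h.hom i j) := by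
  refine IsInducedBy.exists_homotopy hF (IsInducedBy.neg hG)
    (Submodule.smul_mem _ (2 : k) hom_coSaddle_forget_mem_homogeneous) ?_ ?_
  · rw [hom_saddle_forget, Linear.comp_smul, Net.hom_saddle_comp_coSaddle_forget, smul_smul,
      mul_invOf_self, one_smul, Net.hom_handleAt_orientedSmoothing_forget,
      Net.hom_handleAt_orientedSmoothing_forget, add_neg_cancel_right]
  · rw [hom_saddle_forget, Linear.smul_comp, Net.hom_coSaddle_comp_saddle_forget, smul_smul,
      mul_invOf_self, one_smul, Net.hom_handleAt_disorientedSmoothing_forget,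
      Net.hom_handleAt_disorientedSmoothing_forget, add_neg_cancel_right]

theorem isEmpty_homotopy_of_isHandleMap [Nontrivial k]
    {F G : twoTerm k 1 saddle.forget ⟶ twoTerm k 1 saddle.forget} (hF : IsHandleMap topRight F)
    (hG : IsHandleMap bottomLeft G) : IsEmpty (Homotopy F G) := by
  refine ⟨fun H => ?_⟩
  obtain ⟨r, hr⟩ := IsInducedBy.exists_eq_comp hF hG H
  -- The left ends are coloured by `false`, the right ends by `true`. A horizontal arc joins a left
  -- end with a right end, so it has no colour; here this is derived along the bottom arc. The
  -- vertical strands keep to one side each.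
  have : IsEmpty (disorientedSmoothing.forget.Colouring fun c : Corner => c.2) :=
    ⟨fun q => by
      have h1 := q.2.1
      have h2 := q.2.2 (false, false)
      have h3 := q.2.2 (false, true)
      have h4 := (h1 ((false, false), true)).1
      have h5 := (h1 ((false, false), false)).2
      have h6 := (h1 ((false, true), true)).1
      exact Bool.false_ne_true (h2.symm.trans (h4.symm.trans (h5.symm.trans (h6.trans h3))))⟩
  exact handleAt_sub_handleAt_ne k (M := orientedSmoothing.forget)
    (N := disorientedSmoothing.forget) (β := fun c : Corner => c.2)
    ⟨fun c : Corner => c.2, fun _ => ⟨rfl, rfl⟩, fun _ => rfl⟩ rfl rfl _ _ hr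

end Crossing

end Disor

theorem proposition4p6 {k : Type*} [CommRing k] [Nontrivial k] [Invertible (2 : k)] :
    (∀ ω : kˣ, (ω : k) ^ 2 = -1 →
      ∃ F G : Disor.twoTerm k ω Disor.saddle ⟶ Disor.twoTerm k ω Disor.saddle,
        Disor.IsHandleMap Disor.topRight F ∧ Disor.IsHandleMap Disor.bottomLeft G ∧
        ∃ h : Homotopy F G, ∀ i j, Disor.IsHomogeneous (-2) (h.hom i j)) ∧
    (∃ F G : Disor.twoTerm k 1 Disor.saddle.forget ⟶ Disor.twoTerm k 1 Disor.saddle.forget,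
      Disor.IsHandleMap Disor.topRight F ∧ Disor.IsHandleMap Disor.bottomLeft G ∧
      (∃ h : Homotopy F (-G), ∀ i j, Disor.IsHomogeneous (-2) (h.hom i j)) ∧
      IsEmpty (Homotopy F G)) := by
  refine ⟨fun ω hω => ?_, ?_⟩
  · obtain ⟨F, hF⟩ := Disor.exists_isHandleMap (k := k) (ω := ω) Disor.topRight
    obtain ⟨G, hG⟩ := Disor.exists_isHandleMap (k := k) (ω := ω) Disor.bottomLeft
    exact ⟨F, G, hF, hG, Disor.exists_homotopy_of_isHandleMap hω hF hG⟩
  · obtain ⟨F, hF⟩ := Disor.exists_isHandleMap_forget (k := k) (ω := 1) Disor.topRight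
    obtain ⟨G, hG⟩ := Disor.exists_isHandleMap_forget (k := k) (ω := 1) Disor.bottomLeft
    exact ⟨F, G, hF, hG, Disor.exists_homotopy_neg_of_isHandleMap hF hG,
      Disor.isEmpty_homotopy_of_isHandleMap hF hG⟩
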